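/- Let $R$ be a discrete valuation ring with normalized valuation $\operatorname{val}$, maximal ideal $\mathfrak m$, residue field $k=R/\mathfrak m$ (not assumed perfect) and field of fractions $F$. Let $E\subset\mathbb P^2_R$ be the family of cubic curves given by a Weierstraß equation $$Y^2Z+a_1XYZ+a_3YZ^2=X^3+a_2X^2Z+a_4XZ^2+a_6Z^3,\qquad a_i\in R,$$ with discriminant $\Delta\neq 0$, and put $b_2=a_1^2+4a_2$ and $b_6=a_3^2+4a_6$. Let $N:E\to E$ be the sign involution $(X:Y:Z)\mapsto (X:-(Y+a_1X+a_3Z):Z)$. Let $G\subset\operatorname{Aut}_{E/R}$ be the effective model of the sign involution, that is, the schematic closure in $\operatorname{Aut}_{E/R}$ of the group $\{\operatorname{id},N\}$ of automorphisms of the generic fiber $E_F$. Write $\operatorname{Fix}(E/R)=E^G$ for the scheme of $G$-fixed points, and $\operatorname{Sing}(E/R)\subset E$ for the closed subscheme defined by the first Fitting ideal of $\Omega^1_{E/R}$. Set $\operatorname{val}(2,a_1,a_3)=\min\{\operatorname{val}(2),\operatorname{val}(a_1),\operatorname{val}(a_3)\}$. Suppose that the closed fiber $E_k$ is not smooth.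 Then the subschemes $\operatorname{Fix}(E/R)$ and $\operatorname{Sing}(E/R)$ of $E$ are disjoint if and only if the following three conditions hold: 1. The closed fiber $E_k$ is of additive type, that is, a twisted form of the rational cuspidal curve $Y^2Z=X^3$ (it becomes isomorphic to that curve over some field extension of $k$). 2. The residue field $k$ has characteristic two. 3. We have $\operatorname{val}(b_2a_4+b_6)=2\operatorname{val}(2,a_1,a_3)$. Furthermore, if $a_1=a_3=0$, then condition 3 is equivalent to $\operatorname{val}(a_2a_4+a_6)=0$. -/

import Mathlib

open CategoryTheory CategoryTheory.Limits AlgebraicGeometry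

universe u

noncomputable section

/-! ### Fitting ideals and the scheme of non-smoothness -/

/-- The `k`-th Fitting ideal of a finitely generated module `M` over a commutative ring `A`.
It is generated by the maximal minors of size `n` formed from `n` linear relations
between `n + k` generators of `M`, for all `n` and all generating families. (Every generating
family gives the same ideal, so it does no harm to let the family vary; families with fewer
than `k` members can be padded by zeros.) -/
def fittingIdeal (A M : Type*) [CommRing A] [AddCommGroup M] [Module A M] (k : ℕ) : Ideal A :=
  Ideal.span {r | ∃ (n : ℕ) (m : Fin (n + k) → M) (B : Matrix (Fin n) (Fin (n + k)) A)
    (c : Fin n ↪ Fin (n + k)),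
      Submodule.span A (Set.range m) = ⊤ ∧ (∀ i, ∑ j, B i j • m j = 0) ∧
      r = (B.submatrix id c).det}

/-- The support of the closed subscheme of `X` defined by the `k`-th Fitting ideal of the sheaf of
relative differentials `Ω¹_{X/S}`: the set of all points `z` where the `k`-th Fitting ideal
of the stalk of `Ω¹_{X/S}` at `z` is not the unit ideal. The stalk is the module of Kähler
differentials of `𝒪_{X,z}` over `𝒪_{S,f(z)}`. -/
def fittingLocus {X S : Scheme.{u}} (f : X ⟶ S) (k : ℕ) : Set X :=
  {z | letI : Algebra (S.presheaf.stalk (f z)) (X.presheaf.stalk z) :=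
        (f.stalkMap z).hom.toAlgebra
      fittingIdeal (X.presheaf.stalk z)
        (Ω[X.presheaf.stalk z⁄S.presheaf.stalk (f z)]) k ≠ ⊤}

/-- The set of points of the scheme of non-smoothness `Sing(X/S)` of a family of curves
`f : X ⟶ S`, the closed subscheme defined by the first Fitting ideal of `Ω¹_{X/S}`. -/
def singLocus {X S : Scheme.{u}} (f : X ⟶ S) : Set X := fittingLocus f 1

/-! ### The functor of relative automorphisms, schematic closure, fixed points -/

/-- A `T`-valued point of the functor `Aut_{X/S}`: an automorphism of `X_T = X ×_S T` over `T`. -/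
structure RelAut {X S T : Scheme.{u}} (f : X ⟶ S) (t : T ⟶ S) where
  /-- the automorphism of the scheme `X_T` -/
  iso : pullback f t ≅ pullback f t
  /-- the automorphism is over `T` -/
  hom_snd : iso.hom ≫ pullback.snd f t = pullback.snd f t

namespace RelAut

variable {X S T T' : Scheme.{u}} {f : X ⟶ S} {t : T ⟶ S}

lemma inv_snd (g : RelAut f t) : g.iso.inv ≫ pullback.snd f t = pullback.snd f t := by
  rw [Iso.inv_comp_eq, g.hom_snd]

/-- The projection `X_{T'} ⟶ X_T` induced by `h : T' ⟶ T`. -/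
def proj (f : X ⟶ S) (t : T ⟶ S) (h : T' ⟶ T) : pullback f (h ≫ t) ⟶ pullback f t :=
  pullback.lift (pullback.fst f (h ≫ t)) (pullback.snd f (h ≫ t) ≫ h)
    (by rw [Category.assoc, pullback.condition])

@[simp] lemma proj_fst (h : T' ⟶ T) :
    proj f t h ≫ pullback.fst f t = pullback.fst f (h ≫ t) := pullback.lift_fst _ _ _

@[simp] lemma proj_snd (h : T' ⟶ T) :
    proj f t h ≫ pullback.snd f t = pullback.snd f (h ≫ t) ≫ h := pullback.lift_snd _ _ _

/-- Base change along `h : T' ⟶ T` of a `T`-endomorphism of `X_T`. -/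
def baseChangeHom (a : pullback f t ⟶ pullback f t)
    (ha : a ≫ pullback.snd f t = pullback.snd f t) (h : T' ⟶ T) :
    pullback f (h ≫ t) ⟶ pullback f (h ≫ t) :=
  pullback.lift (proj f t h ≫ a ≫ pullback.fst f t) (pullback.snd f (h ≫ t)) (by
    rw [Category.assoc, Category.assoc, pullback.condition, reassoc_of% ha, ← Category.assoc,
      proj_snd, Category.assoc])

@[simp] lemma baseChangeHom_snd (a : pullback f t ⟶ pullback f t) (ha) (h : T' ⟶ T) :
    baseChangeHom a ha h ≫ pullback.snd f (h ≫ t) = pullback.snd f (h ≫ t) :=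
  pullback.lift_snd _ _ _

@[simp] lemma baseChangeHom_fst (a : pullback f t ⟶ pullback f t) (ha) (h : T' ⟶ T) :
    baseChangeHom a ha h ≫ pullback.fst f (h ≫ t) = proj f t h ≫ a ≫ pullback.fst f t :=
  pullback.lift_fst _ _ _

lemma baseChangeHom_proj (a : pullback f t ⟶ pullback f t) (ha) (h : T' ⟶ T) :
    baseChangeHom a ha h ≫ proj f t h = proj f t h ≫ a := by
  apply pullback.hom_ext
  · simp
  · simp [ha, reassoc_of% (baseChangeHom_snd a ha h)]

lemma baseChangeHom_comp_eq_id (a b : pullback f t ⟶ pullback f t) (ha hb) (hab : a ≫ b = 𝟙 _)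
    (h : T' ⟶ T) : baseChangeHom a ha h ≫ baseChangeHom b hb h = 𝟙 _ := by
  apply pullback.hom_ext
  · rw [Category.assoc, baseChangeHom_fst, reassoc_of% (baseChangeHom_proj a ha h),
      reassoc_of% hab, proj_fst, Category.id_comp]
  · simp

/-- The restriction map `Aut_{X/S}(T) → Aut_{X/S}(T')` along `h : T' ⟶ T`. -/
def baseChange (g : RelAut f t) (h : T' ⟶ T) : RelAut f (h ≫ t) where
  iso :=
    { hom := baseChangeHom g.iso.hom g.hom_snd h
      inv := baseChangeHom g.iso.inv g.inv_snd h
      hom_inv_id := baseChangeHom_comp_eq_id _ _ _ _ g.iso.hom_inv_id h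
      inv_hom_id := baseChangeHom_comp_eq_id _ _ _ _ g.iso.inv_hom_id h }
  hom_snd := baseChangeHom_snd _ g.hom_snd _

/-- The identity of `X_T`. -/
def refl (f : X ⟶ S) (t : T ⟶ S) : RelAut f t := ⟨Iso.refl _, Category.id_comp _⟩

/-- The automorphism `a × id` of `X_T = X ×_S T` induced by an automorphism `a` of `X` over `S`. -/
def ofIso (a : X ≅ X) (ha : a.hom ≫ f = f) (t : T ⟶ S) : RelAut f t where
  iso := asIso (pullback.map f t f t a.hom (𝟙 _) (𝟙 _) (by simp [ha]) (by simp))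
  hom_snd := by simp only [asIso_hom, pullback.map, pullback.lift_snd, Category.comp_id]

/-- The action `X(T) → X(T)` of a `T`-valued point `g` of `Aut_{X/S}`. -/
def act (g : RelAut f t) (x : T ⟶ X) (hx : x ≫ f = t) : T ⟶ X :=
  pullback.lift x (𝟙 T) (by rw [hx, Category.id_comp]) ≫ g.iso.hom ≫ pullback.fst f t

end RelAut

/-- A family of subsets `H(T) ⊆ Aut_{X/S}(T)`, for all `S`-schemes `T`. -/
abbrev AutSubfamily {X S : Scheme.{u}} (f : X ⟶ S) : Type (u + 1) :=
  ∀ ⦃T : Scheme.{u}⦄ (t : T ⟶ S), Set (RelAut f t)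

/-- `H` is a closed subfunctor of `Aut_{X/S}`: for each `T`-valued point `g` of `Aut_{X/S}` there is
a closed subscheme `T₀` of `T` such that the restriction of `g` along a morphism `h : T' ⟶ T`
belongs to `H` if and only if `h` factors over `T₀`. (In particular, `H` is then stable under
restriction.) If `Aut_{X/S}` is representable, the closed subfunctors are exactly
the closed subschemes of the representing scheme. -/
def AutSubfamily.IsClosed {X S : Scheme.{u}} {f : X ⟶ S} (H : AutSubfamily f) : Prop :=
  ∀ ⦃T : Scheme.{u}⦄ (t : T ⟶ S) (g : RelAut f t),
    ∃ (T₀ : Scheme.{u}) (i : T₀ ⟶ T), IsClosedImmersion i ∧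
      ∀ ⦃T' : Scheme.{u}⦄ (h : T' ⟶ T),
        g.baseChange h ∈ H (h ≫ t) ↔ ∃ h₀ : T' ⟶ T₀, h₀ ≫ i = h

/-- The schematic closure in `Aut_{X/S}` of a set `P` of `U`-valued points: the smallest closed
subfunctor through which all members of `P` factor. -/
def schematicClosure {X S U : Scheme.{u}} {f : X ⟶ S} {r : U ⟶ S} (P : Set (RelAut f r)) :
    AutSubfamily f :=
  fun _ t => {g | ∀ H : AutSubfamily f, H.IsClosed → P ⊆ H r → g ∈ H t}

/-- The `T`-valued point `x` of `X` belongs to the fixed functor `X^G(T)`: for all `h : T' ⟶ T` and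
all `g ∈ G(T')`, the restriction of `x` to `T'` is fixed by `g`. -/
def IsFixedPoint {X S T : Scheme.{u}} {f : X ⟶ S} (G : AutSubfamily f) (x : T ⟶ X) : Prop :=
  ∀ ⦃T' : Scheme.{u}⦄ (h : T' ⟶ T) (t' : T' ⟶ S) (ht' : (h ≫ x) ≫ f = t'),
    ∀ g ∈ G t', g.act (h ≫ x) ht' = h ≫ x

/-- The set of points of the scheme of fixed points `X^G`: a point `z` of `X` lies on the closed
subscheme `X^G` if and only if the canonical morphism `Spec κ(z) ⟶ X` factors over it. -/
def fixedLocus {X S : Scheme.{u}} {f : X ⟶ S} (G : AutSubfamily f) : Set X :=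
  {z | IsFixedPoint G (X.fromSpecResidueField z)}

/-! ### The family of plane cubics attached to a Weierstrass equation -/

namespace WeierstrassCurve

variable {R : Type u} [CommRing R] (W : WeierstrassCurve R)

/-- The homogeneous coordinate ring `R[X, Y, Z] / (F)`, where `F` is the homogeneous Weierstrass
polynomial `Y²Z + a₁XYZ + a₃YZ² - (X³ + a₂X²Z + a₄XZ² + a₆Z³)`. -/
abbrev HomogCoordRing : Type u :=
  MvPolynomial (Fin 3) R ⧸ Ideal.span {W.toProjective.polynomial}

/-- The grading of the homogeneous coordinate ring by degree. -/
def grading (n : ℕ) : Submodule R W.HomogCoordRing :=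
  (MvPolynomial.homogeneousSubmodule (Fin 3) R n).map
    (Ideal.Quotient.mkₐ R (Ideal.span {W.toProjective.polynomial})).toLinearMap

lemma mk_mem_grading {n : ℕ} {p : MvPolynomial (Fin 3) R} (hp : p.IsHomogeneous n) :
    (Ideal.Quotient.mk _ p : W.HomogCoordRing) ∈ W.grading n :=
  ⟨p, hp, rfl⟩

lemma isHomogeneous_polynomial : (W.toProjective.polynomial).IsHomogeneous 3 := by
  have X' : ∀ i, (MvPolynomial.X i : MvPolynomial (Fin 3) R).IsHomogeneous 1 :=
    MvPolynomial.isHomogeneous_X R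
  have C' : ∀ a, (MvPolynomial.C a : MvPolynomial (Fin 3) R).IsHomogeneous 0 :=
    MvPolynomial.isHomogeneous_C _
  unfold Projective.polynomial
  refine ((((X' 1).pow 2).mul (X' 2)).add ((((C' _).mul (X' 0)).mul (X' 1)).mul (X' 2)) |>.add
    (((C' _).mul (X' 1)).mul ((X' 2).pow 2))).sub
    ((((X' 0).pow 3).add (((C' _).mul ((X' 0).pow 2)).mul (X' 2))).add
      (((C' _).mul (X' 0)).mul ((X' 2).pow 2)) |>.add ((C' _).mul ((X' 2).pow 3)))

instance : SetLike.GradedMonoid W.grading where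
  one_mem := ⟨1, MvPolynomial.isHomogeneous_one _ _, rfl⟩
  mul_mem := by
    rintro i j _ _ ⟨p, hp, rfl⟩ ⟨q, hq, rfl⟩
    exact ⟨p * q, hp.mul hq, rfl⟩

attribute [local instance] MvPolynomial.gradedAlgebra

/-- The residue class map `R[X, Y, Z]_n → (R[X, Y, Z] / (F))_n`. -/
def mkDegree (n : ℕ) : MvPolynomial.homogeneousSubmodule (Fin 3) R n →ₗ[R] W.grading n :=
  ((Ideal.Quotient.mkₐ R (Ideal.span {W.toProjective.polynomial})).toLinearMap.restrict
    fun _ hp => W.mk_mem_grading hp)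

/-- The residue class map `R[X, Y, Z] → R[X, Y, Z] / (F)` on direct sums of homogeneous parts. -/
def mkSum : (DirectSum ℕ fun n => MvPolynomial.homogeneousSubmodule (Fin 3) R n) →ₐ[R]
    DirectSum ℕ fun n => W.grading n :=
  DirectSum.toAlgebra R (fun n => MvPolynomial.homogeneousSubmodule (Fin 3) R n)
    (fun n => (DirectSum.lof R ℕ (fun n => W.grading n) n).comp (W.mkDegree n))
    (by rfl)
    (fun {i j} p q => by
      simp only [LinearMap.comp_apply, DirectSum.lof_eq_of]
      rw [DirectSum.of_mul_of]
      rfl)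

lemma mkSum_of {n : ℕ} (p : MvPolynomial.homogeneousSubmodule (Fin 3) R n) :
    W.mkSum (DirectSum.of (fun n => MvPolynomial.homogeneousSubmodule (Fin 3) R n) n p) =
      DirectSum.of (fun n => W.grading n) n (W.mkDegree n p) :=
  DirectSum.toAddMonoid_of _ _ _

/-- Auxiliary map for the decomposition of the homogeneous coordinate ring. -/
def decomposeAux : MvPolynomial (Fin 3) R →ₐ[R] DirectSum ℕ fun n => W.grading n :=
  W.mkSum.comp
    (DirectSum.decomposeAlgEquiv (MvPolynomial.homogeneousSubmodule (Fin 3) R)).toAlgHom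

lemma decomposeAux_of_isHomogeneous {n : ℕ} {p : MvPolynomial (Fin 3) R}
    (hp : p.IsHomogeneous n) :
    W.decomposeAux p = DirectSum.of (fun n => W.grading n) n ⟨_, W.mk_mem_grading hp⟩ := by
  have h : DirectSum.decomposeAlgEquiv (MvPolynomial.homogeneousSubmodule (Fin 3) R) p =
      DirectSum.of (fun n => MvPolynomial.homogeneousSubmodule (Fin 3) R n) n ⟨p, hp⟩ :=
    DirectSum.decompose_of_mem _ hp
  refine (congrArg W.mkSum h).trans ?_
  rw [mkSum_of]
  rfl

instance : GradedAlgebra W.grading :=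
  GradedAlgebra.ofAlgHom W.grading
    (Ideal.Quotient.liftₐ _ W.decomposeAux (fun a ha => by
      have : Ideal.span {W.toProjective.polynomial} ≤ RingHom.ker W.decomposeAux := by
        rw [Ideal.span_singleton_le_iff_mem, RingHom.mem_ker,
          W.decomposeAux_of_isHomogeneous W.isHomogeneous_polynomial]
        have h0 : (⟨_, W.mk_mem_grading W.isHomogeneous_polynomial⟩ : W.grading 3) = 0 :=
          Subtype.ext (Ideal.Quotient.eq_zero_iff_mem.2 (Ideal.mem_span_singleton_self _))
        rw [h0, map_zero]
      exact this ha))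
    (by
      apply Ideal.Quotient.algHom_ext
      apply MvPolynomial.algHom_ext
      intro i
      have h := W.decomposeAux_of_isHomogeneous (MvPolynomial.isHomogeneous_X R i)
      change DirectSum.coeAlgHom W.grading (W.decomposeAux (MvPolynomial.X i)) = _
      rw [h, DirectSum.coeAlgHom_of]
      rfl)
    (by
      rintro n ⟨_, p, hp, rfl⟩
      exact W.decomposeAux_of_isHomogeneous hp)

/-- The family of plane cubics `E = V₊(F) = Proj R[X, Y, Z] / (F)` inside `ℙ²_R`. -/
abbrev model : Scheme.{u} := Proj W.grading

/-- The structure morphism `E ⟶ Spec R`. -/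
def modelHom : W.model ⟶ Spec (.of R) :=
  Proj.toSpecZero W.grading ≫ Spec.map (CommRingCat.ofHom (algebraMap R (W.grading 0)))

/-! ### The sign involution -/

/-- The substitution `X ↦ X`, `Y ↦ -(Y + a₁X + a₃Z)`, `Z ↦ Z`. -/
def signPoly : MvPolynomial (Fin 3) R →ₐ[R] MvPolynomial (Fin 3) R :=
  MvPolynomial.aeval ![MvPolynomial.X 0,
    -(MvPolynomial.X 1 + MvPolynomial.C W.a₁ * MvPolynomial.X 0
      + MvPolynomial.C W.a₃ * MvPolynomial.X 2),
    MvPolynomial.X 2]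

lemma signPoly_polynomial :
    W.signPoly W.toProjective.polynomial = W.toProjective.polynomial := by
  simp only [Projective.polynomial, signPoly, map_sub, map_add, map_mul, map_pow,
    MvPolynomial.aeval_X, MvPolynomial.aeval_C]
  simp [MvPolynomial.algebraMap_eq]
  ring

lemma signPoly_isHomogeneous {n : ℕ} {p : MvPolynomial (Fin 3) R} (hp : p.IsHomogeneous n) :
    (W.signPoly p).IsHomogeneous n := by
  have X' : ∀ i, (MvPolynomial.X i : MvPolynomial (Fin 3) R).IsHomogeneous 1 :=
    MvPolynomial.isHomogeneous_X R
  have C' : ∀ a, (MvPolynomial.C a : MvPolynomial (Fin 3) R).IsHomogeneous 0 :=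
    MvPolynomial.isHomogeneous_C _
  have h : (MvPolynomial.aeval ![MvPolynomial.X 0,
      -(MvPolynomial.X 1 + MvPolynomial.C W.a₁ * MvPolynomial.X 0
        + MvPolynomial.C W.a₃ * MvPolynomial.X 2),
      MvPolynomial.X 2] p : MvPolynomial (Fin 3) R).IsHomogeneous (1 * n) := by
    refine MvPolynomial.IsHomogeneous.aeval hp _ ?_
    rw [Fin.forall_fin_succ, Fin.forall_fin_two]
    have h1 := ((X' 1).add (by simpa using (C' W.a₁).mul (X' 0))).add
      (by simpa using (C' W.a₃).mul (X' 2))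
    refine ⟨?_, ?_, ?_⟩
    · simpa using X' 0
    · simpa using h1.neg
    · simpa [Fin.succ_one_eq_two] using X' 2
  rw [one_mul] at h
  exact h

lemma signPoly_signPoly (p : MvPolynomial (Fin 3) R) : W.signPoly (W.signPoly p) = p := by
  have : W.signPoly.comp W.signPoly = AlgHom.id R _ := by
    apply MvPolynomial.algHom_ext
    intro i
    fin_cases i
    · simp [signPoly]
    · simp [signPoly, MvPolynomial.algebraMap_eq]
      ring
    · simp [signPoly]
  exact DFunLike.congr_fun this p

/-- The automorphism of the homogeneous coordinate ring given by
`X ↦ X`, `Y ↦ -(Y + a₁X + a₃Z)`, `Z ↦ Z`. -/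
def signRingHom : W.HomogCoordRing →ₐ[R] W.HomogCoordRing :=
  Ideal.Quotient.liftₐ _ ((Ideal.Quotient.mkₐ R _).comp W.signPoly) (fun a ha => by
    obtain ⟨b, rfl⟩ := Ideal.mem_span_singleton.1 ha
    simp only [AlgHom.comp_apply, map_mul, signPoly_polynomial]
    refine mul_eq_zero_of_left (Ideal.Quotient.eq_zero_iff_mem.2 ?_) _
    exact Ideal.mem_span_singleton_self _)

lemma signRingHom_mk (p : MvPolynomial (Fin 3) R) :
    W.signRingHom (Ideal.Quotient.mk _ p) = Ideal.Quotient.mk _ (W.signPoly p) := rfl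

lemma signRingHom_signRingHom (a : W.HomogCoordRing) : W.signRingHom (W.signRingHom a) = a := by
  obtain ⟨p, rfl⟩ := Ideal.Quotient.mk_surjective a
  rw [signRingHom_mk, signRingHom_mk, signPoly_signPoly]

/-- `signRingHom` as a homomorphism of graded rings. -/
def signGraded : GradedRingHom W.grading W.grading where
  __ := W.signRingHom.toRingHom
  map_mem := by
    rintro n _ ⟨p, hp, rfl⟩
    exact W.mk_mem_grading (W.signPoly_isHomogeneous hp)

lemma signGraded_apply (a : W.HomogCoordRing) : W.signGraded a = W.signRingHom a := rfl

lemma signGraded_comp : W.signGraded.comp W.signGraded = GradedRingHom.id W.grading :=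
  GradedRingHom.ext fun a => W.signRingHom_signRingHom a

lemma irrelevant_le_map_signGraded :
    HomogeneousIdeal.irrelevant W.grading ≤
      (HomogeneousIdeal.irrelevant W.grading).map W.signGraded := by
  rw [HomogeneousIdeal.irrelevant_le]
  intro i hi a ha
  have h1 : W.signGraded a ∈ HomogeneousIdeal.irrelevant W.grading :=
    HomogeneousIdeal.mem_irrelevant_of_mem _ hi (W.signGraded.map_mem ha)
  have h2 := Ideal.mem_map_of_mem W.signGraded h1
  have h3 : W.signGraded (W.signGraded a) = a := W.signRingHom_signRingHom a
  rw [h3] at h2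
  exact h2

/-- The sign involution `N : E ⟶ E`, given by `(X : Y : Z) ↦ (X : -(Y + a₁X + a₃Z) : Z)`. -/
def signHom : W.model ⟶ W.model :=
  Proj.map W.signGraded W.irrelevant_le_map_signGraded

lemma signHom_signHom : W.signHom ≫ W.signHom = 𝟙 W.model := by
  have h := Proj.map_comp W.signGraded W.signGraded W.irrelevant_le_map_signGraded
    W.irrelevant_le_map_signGraded
  have h' := Proj.map_id (𝒜 := W.grading)
  rw [signHom, ← h]
  simp only [signGraded_comp]
  exact h'

lemma awayι_signHom_modelHom {i : ℕ} (hi : 0 < i) (s : W.HomogCoordRing)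
    (hs : s ∈ W.grading i) :
    Proj.awayι W.grading (W.signGraded s) (W.signGraded.map_mem hs) hi ≫ W.signHom ≫ W.modelHom =
      Proj.awayι W.grading (W.signGraded s) (W.signGraded.map_mem hs) hi ≫ W.modelHom := by
  rw [signHom, modelHom, Proj.awayι_comp_map_assoc _ _ hi _ hs, Proj.awayι_toSpecZero_assoc,
    Proj.awayι_toSpecZero_assoc, ← Spec.map_comp, ← Spec.map_comp, ← Spec.map_comp,
    ← CommRingCat.ofHom_comp, ← CommRingCat.ofHom_comp, ← CommRingCat.ofHom_comp]
  congr 2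
  ext r
  have h : W.signGraded (algebraMap R W.HomogCoordRing r) = algebraMap R _ r :=
    W.signRingHom.commutes r
  have h1 : W.signGraded 1 = 1 := map_one W.signRingHom
  change (HomogeneousLocalization.mk _).val = (HomogeneousLocalization.mk _).val
  rw [HomogeneousLocalization.val_mk, HomogeneousLocalization.val_mk]
  congr 1
  exact Subtype.ext h1

lemma signHom_modelHom : W.signHom ≫ W.modelHom = W.modelHom :=
  (Proj.mapAffineOpenCover W.signGraded W.irrelevant_le_map_signGraded).openCover.hom_ext _ _
    fun s => W.awayι_signHom_modelHom s.1.2 _ s.2.2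

/-- The sign involution as an automorphism of the scheme `E`. -/
def signIso : W.model ≅ W.model := ⟨W.signHom, W.signHom, W.signHom_signHom, W.signHom_signHom⟩

end WeierstrassCurve

/-! ### Twisted forms and additive closed fibers -/

/-- Two schemes `X`, `Y` over a field `k` are twisted forms of each other: they become isomorphic
over some field extension `K` of `k`. -/
def IsTwistedForm {k : Type u} [Field k] {X Y : Scheme.{u}} (f : X ⟶ Spec (.of k))
    (g : Y ⟶ Spec (.of k)) : Prop :=
  ∃ (K : Type u) (_ : Field K) (_ : Algebra k K)
    (e : pullback f (Spec.map (CommRingCat.ofHom (algebraMap k K))) ≅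
      pullback g (Spec.map (CommRingCat.ofHom (algebraMap k K)))),
    e.hom ≫ pullback.snd _ _ = pullback.snd _ _

/-- The equation `y² = x³` over a field `k`. Its projective model is the rational cuspidal curve
`Spec k[u², u³] ∪ Spec k[u⁻¹]`, with `x = u²` and `y = u³`. -/
def cuspidalCubic (k : Type u) [Field k] : WeierstrassCurve k := ⟨0, 0, 0, 0, 0⟩

namespace WeierstrassCurve

variable {R : Type u} [CommRing R]

section ClosedFiber

variable [IsLocalRing R] (W : WeierstrassCurve R)

/-- The structure morphism of the closed fiber `E_k = E ×_R Spec k`, with `k = R/𝔪`. -/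
def closedFiberHom :
    pullback W.modelHom (Spec.map (CommRingCat.ofHom (IsLocalRing.residue R))) ⟶
      Spec (.of (IsLocalRing.ResidueField R)) :=
  pullback.snd _ _

/-- The closed fiber `E_k` is of additive type: a twisted form of the rational cuspidal curve. -/
def HasAdditiveClosedFiber : Prop :=
  IsTwistedForm W.closedFiberHom (cuspidalCubic (IsLocalRing.ResidueField R)).modelHom

end ClosedFiber

/-- The inclusion `Spec F ⟶ Spec R` of the generic point, where `F = Frac(R)`. -/
def genericPoint (R : Type u) [CommRing R] [IsDomain R] :
    Spec (.of (FractionRing R)) ⟶ Spec (.of R) :=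
  Spec.map (CommRingCat.ofHom (algebraMap R (FractionRing R)))

variable [IsDomain R] (W : WeierstrassCurve R)

/-- The effective model of the sign involution: the schematic closure `G ⊆ Aut_{E/R}` of the group
`{id, N}` of automorphisms of the generic fiber `E_F`. -/
def effectiveModel : AutSubfamily W.modelHom :=
  schematicClosure (r := genericPoint R)
    {RelAut.refl W.modelHom (genericPoint R),
      RelAut.ofIso W.signIso W.signHom_modelHom (genericPoint R)}

/-- The set of points of the fixed scheme `Fix(E/R) = E^G` of the effective model `G`. -/
def fixLocus : Set W.model := fixedLocus W.effectiveModel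

end WeierstrassCurve

end

/-! Write 2 = dα, a₁ = dβ, a₃ = dγ with d of minimal valuation, so that one of α, β, γ is a unit,
and put L = αY + βX + γZ. The sign involution N is Y ↦ Y - dL. The substitution Y ↦ Y - tL changes
the Weierstrass polynomial by (t² - dt)ZL². Over D = R[t]/(t² - dt) it is therefore an automorphism,
equal to id at t = 0 and to N at t = d. An element of D is determined by its values at these two
points over F, so the whole family lies in the effective model G
(`baseChange_mem_schematicClosure`). If d is not a unit, t ↦ ε defines a point of G over the dual
numbers of the residue field, and it moves the y-coordinate of a singular point z by -εL(z). Hence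
L(z) = 0 when z is fixed (`notMem_fixLocus`).

Conversely, let z be singular with L(z) = 0. Intersecting E with the line L = 0 yields a free
R-algebra A and an A-valued point of E on this line that specializes to z (`hasFixedLift`). This
point is fixed by id and N. The automorphisms fixing an A-valued point form a closed subfunctor, by
Weil restriction along the free algebra A of the locus where two morphisms agree
(`isClosed_fixingFamily`), so this subfunctor contains G and z is fixed.

Singular points exist because E_k is not smooth (Jacobian criterion), they are the affine points
where both partial derivatives vanish, and they lie in the closed fiber because Δ ≠ 0 vanishes at
them.

If d is a unit, then 2y + a₁x + a₃ = 0 gives L(z) = 0, so the two loci meet. Conditions 1 and 2 then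
cannot both hold: additive type in characteristic two forces a₁ ∈ 𝔪, so a₃ is a unit, and 2y + a₁x +
a₃ cannot vanish. If d is not a unit, then k has characteristic two, a₁ and a₃ vanish in k, and E_k
is of additive type. At a singular point x² = a₄, and the equation gives L(z)² = c with c = (β² +
α²a₂)a₄ + γ² + α²a₆. Since b₂a₄ + b₆ = d²c, condition 3 says exactly that c is a unit, that is, L(z)
≠ 0.

That additive type forces a₁ ∈ 𝔪 needs an invariant of abstract isomorphisms. It is
`HasCuspidalPoint`: which tangent vectors at a rational point lift to K[t]/(t³). -/

noncomputable section

/-! ### Points of `Proj` given by homogeneous coordinates -/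

namespace ProjPoint

open HomogeneousLocalization

variable {S σ : Type u} [CommRing S] [SetLike σ S] [AddSubgroupClass σ S] (𝒜 : ℕ → σ)
  [GradedRing 𝒜] {A B : Type u} [CommRing A] [CommRing B]

/-- The homomorphism `S_(s) → A` induced by a homomorphism `S → A` that makes `s` invertible. -/
def lift (φ : S →+* A) (s : S) (h : IsUnit (φ s)) : Away 𝒜 s →+* A :=
  (IsLocalization.Away.lift (S := Localization.Away s) s h).comp
    (algebraMap (Away 𝒜 s) (Localization.Away s))

lemma lift_eq (φ : S →+* A) (s : S) (h : IsUnit (φ s)) (x : Away 𝒜 s) :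
    lift 𝒜 φ s h x = IsLocalization.Away.lift (S := Localization.Away s) s h x.val := rfl

variable {𝒜}

lemma lift_mk_mul (φ : S →+* A) {s : S} {d : ℕ} (hs : s ∈ 𝒜 d) (h : IsUnit (φ s)) (n : ℕ)
    (x : S) (hx : x ∈ 𝒜 (n • d)) :
    lift 𝒜 φ s h (Away.mk 𝒜 hs n x hx) * φ s ^ n = φ x := by
  rw [lift_eq, Away.val_mk, Localization.mk_eq_mk', ← map_pow,
    ← IsLocalization.Away.lift_eq (S := Localization.Away s) s h (s ^ n), ← map_mul,
    IsLocalization.mk'_spec_mk, IsLocalization.Away.lift_eq]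

/-- Elements of `Away 𝒜 s` are fractions x / sⁿ, and the unit φ(s)ⁿ can be cancelled. -/
lemma lift_eq_iff (φ : S →+* A) {s : S} {d : ℕ} (hs : s ∈ 𝒜 d) (h : IsUnit (φ s))
    (f : Away 𝒜 s →+* A) (hf : ∀ n x hx, f (Away.mk 𝒜 hs n x hx) * φ s ^ n = φ x) :
    f = lift 𝒜 φ s h := by
  ext x
  obtain ⟨n, a, ha, rfl⟩ := Away.mk_surjective 𝒜 hs x
  apply (h.pow n).mul_left_injective
  change _ * _ = _ * _
  rw [hf, lift_mk_mul]

lemma comp_lift (φ : S →+* A) {s : S} {d : ℕ} (hs : s ∈ 𝒜 d) (h : IsUnit (φ s)) (ψ : A →+* B) :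
    ψ.comp (lift 𝒜 φ s h) = lift 𝒜 (ψ.comp φ) s (h.map ψ) := by
  apply lift_eq_iff _ hs
  intro n x hx
  simp only [RingHom.comp_apply]
  rw [← map_pow, ← map_mul, lift_mk_mul]

lemma lift_comp_fromZero (φ : S →+* A) (s : S) (h : IsUnit (φ s)) (x : 𝒜 0) :
    lift 𝒜 φ s h (fromZeroRingHom 𝒜 _ x) = φ x := by
  change IsLocalization.Away.lift (S := Localization.Away s) s h (Localization.mk x.1 1) = _
  rw [Localization.mk_one_eq_algebraMap, IsLocalization.Away.lift_eq]

lemma lift_comp_awayMap (φ : S →+* A) {s t u : S} {d e : ℕ} (hs : s ∈ 𝒜 d) (ht : t ∈ 𝒜 e)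
    (hu : u = s * t) (h : IsUnit (φ s)) (h' : IsUnit (φ u)) :
    (lift 𝒜 φ u h').comp (awayMap 𝒜 ht hu) = lift 𝒜 φ s h := by
  apply lift_eq_iff _ hs
  intro n x hx
  rw [RingHom.comp_apply, awayMap_mk]
  have ht' : IsUnit (φ t) := by
    rw [hu, map_mul] at h'
    exact isUnit_of_mul_isUnit_right h'
  apply (ht'.pow n).mul_left_injective
  have := lift_mk_mul (𝒜 := 𝒜) φ (hu ▸ SetLike.mul_mem_graded hs ht) h' n (x * t ^ n)
    (by rw [smul_add]; exact SetLike.mul_mem_graded hx (SetLike.pow_mem_graded n ht))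
  simp only [map_mul, map_pow] at this
  simp only [← this]
  have e : φ u = φ s * φ t := by rw [hu, map_mul]
  rw [mul_assoc, ← mul_pow, ← e]

lemma lift_comp_map {T τ : Type u} [CommRing T] [SetLike τ T] [AddSubgroupClass τ T] {ℬ : ℕ → τ}
    [GradedRing ℬ] (θ : GradedRingHom 𝒜 ℬ) (φ : T →+* A) {s : S} {d : ℕ} (hs : s ∈ 𝒜 d)
    (h : IsUnit (φ (θ s))) :
    (lift ℬ φ (θ s) h).comp (Away.map θ s) = lift 𝒜 (φ.comp θ.toRingHom) s h := by
  apply lift_eq_iff _ hs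
  intro n x hx
  rw [RingHom.comp_apply, Away.map_mk]
  exact lift_mk_mul φ (θ.map_mem hs) h n (θ x) (θ.map_mem hx)

variable (𝒜) in
/-- The morphism `Spec A ⟶ Proj S` with homogeneous coordinates `φ : S → A`, for `φ s` invertible. -/
def point (φ : S →+* A) (s : S) {d : ℕ} (hs : s ∈ 𝒜 d) (hd : 0 < d) (h : IsUnit (φ s)) :
    Spec (.of A) ⟶ Proj 𝒜 :=
  Spec.map (CommRingCat.ofHom (lift 𝒜 φ s h)) ≫ Proj.awayι 𝒜 s hs hd

section

variable (φ : S →+* A) {s : S} {d : ℕ} (hs : s ∈ 𝒜 d) (hd : 0 < d) (h : IsUnit (φ s))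

lemma specMap_point (ψ : A →+* B) :
    Spec.map (CommRingCat.ofHom ψ) ≫ point 𝒜 φ s hs hd h =
      point 𝒜 (ψ.comp φ) s hs hd (h.map ψ) := by
  rw [point, point, ← Category.assoc, ← Spec.map_comp, ← CommRingCat.ofHom_comp,
    comp_lift φ hs h ψ]

lemma point_toSpecZero :
    point 𝒜 φ s hs hd h ≫ Proj.toSpecZero 𝒜 =
      Spec.map (CommRingCat.ofHom (φ.comp (algebraMap (𝒜 0) S))) := by
  rw [point, Category.assoc, Proj.awayι_toSpecZero, ← Spec.map_comp, ← CommRingCat.ofHom_comp]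
  congr 2
  ext x
  exact lift_comp_fromZero φ s h x

lemma point_mul {t u : S} {e : ℕ} (ht : t ∈ 𝒜 e) (hu : u = s * t) (hu' : u ∈ 𝒜 (d + e))
    (h' : IsUnit (φ u)) :
    point 𝒜 φ u hu' (by omega) h' = point 𝒜 φ s hs hd h := by
  rw [point, point, ← Proj.SpecMap_awayMap_awayι 𝒜 hs hd ht hu, ← Category.assoc,
    ← Spec.map_comp, ← CommRingCat.ofHom_comp, lift_comp_awayMap φ hs ht hu h]

/-- Both morphisms agree with the one defined by the smaller chart of the product s * t. -/
lemma point_congr {t : S} {e : ℕ} (ht : t ∈ 𝒜 e) (he : 0 < e) (h' : IsUnit (φ t)) :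
    point 𝒜 φ s hs hd h = point 𝒜 φ t ht he h' := by
  have hu : IsUnit (φ (s * t)) := by
    rw [map_mul]
    exact h.mul h'
  have h1 := point_mul φ hs hd h ht rfl (SetLike.mul_mem_graded hs ht) hu
  have h2 := point_mul φ ht he h' hs (mul_comm s t)
    (mul_comm t s ▸ SetLike.mul_mem_graded ht hs) hu
  rw [← h1, ← h2]
  congr 1
  exact add_comm d e

lemma point_map {T τ : Type u} [CommRing T] [SetLike τ T] [AddSubgroupClass τ T] {ℬ : ℕ → τ}
    [GradedRing ℬ] (θ : GradedRingHom 𝒜 ℬ)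
    (hθ : HomogeneousIdeal.irrelevant ℬ ≤ (HomogeneousIdeal.irrelevant 𝒜).map θ)
    (φ : T →+* A) {s : S} {d : ℕ} (hs : s ∈ 𝒜 d) (hd : 0 < d) (h : IsUnit (φ (θ s))) :
    point ℬ φ (θ s) (θ.map_mem hs) hd h ≫ Proj.map θ hθ =
      point 𝒜 (φ.comp θ.toRingHom) s hs hd h := by
  rw [point, point, Category.assoc, Proj.awayι_comp_map θ hθ hd s hs, ← Category.assoc,
    ← Spec.map_comp, ← CommRingCat.ofHom_comp, lift_comp_map θ φ hs h]

end

/-! The universal property of `S_(s)` for `s` of degree one -/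

variable {s : S} (hs : s ∈ 𝒜 1)

/-- The homomorphism `⨁ Sₙ → S_(s)` with `x ↦ x / sⁿ` for `x` of degree `n`. -/
def dehomSum : (DirectSum ℕ fun n => 𝒜 n) →+* Away 𝒜 s :=
  DirectSum.toSemiring (A := fun n => 𝒜 n)
    (fun n => AddMonoidHom.mk' (fun x : 𝒜 n => Away.mk 𝒜 hs n x.1 (by simp))
      (fun x y => by
        ext
        rw [val_add]
        simp only [Away.val_mk]
        rw [Localization.add_mk_self]
        rfl))
    (by
      ext
      simp only [AddMonoidHom.mk'_apply]
      rw [Away.val_mk, val_one, ← Localization.mk_one]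
      congr 1
      exact Subtype.ext (pow_zero s))
    (fun {i j} x y => by
      ext
      simp only [AddMonoidHom.mk'_apply]
      rw [val_mul]
      simp only [Away.val_mk]
      rw [Localization.mk_mul]
      congr 1
      exact Subtype.ext (pow_add s i j))

lemma dehomSum_of {n : ℕ} (x : 𝒜 n) :
    dehomSum hs (DirectSum.of (fun n => 𝒜 n) n x) = Away.mk 𝒜 hs n x.1 (by simp) :=
  DirectSum.toSemiring_of ..

/-- The homomorphism `S → S_(s)` with `x ↦ x / sⁿ` for `x` homogeneous of degree `n`. -/
def dehom : S →+* Away 𝒜 s :=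
  (dehomSum hs).comp (DirectSum.decomposeRingEquiv 𝒜).toRingHom

lemma dehom_of_mem {n : ℕ} {x : S} (hx : x ∈ 𝒜 n) (hx' : x ∈ 𝒜 (n • 1)) :
    dehom hs x = Away.mk 𝒜 hs n x hx' := by
  have h : (DirectSum.decomposeRingEquiv 𝒜) x = DirectSum.of (fun n => 𝒜 n) n ⟨x, hx⟩ :=
    DirectSum.decompose_of_mem _ hx
  exact (congrArg (dehomSum hs) h).trans (dehomSum_of hs ⟨x, hx⟩)

@[simp] lemma dehom_self : dehom hs s = 1 := by
  rw [dehom_of_mem hs hs (by simpa using hs)]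
  ext
  rw [Away.val_mk, val_one, ← Localization.mk_one, Localization.mk_eq_mk_iff,
    Localization.r_iff_exists]
  exact ⟨1, by simp⟩

/-- Since s has degree one, every fraction x / sⁿ is the dehomogenization of x. Homomorphisms out of
the chart thus correspond to homomorphisms out of S that send s to 1. -/
lemma hom_eq_lift (f : Away 𝒜 s →+* A) :
    f = lift 𝒜 (f.comp (dehom hs)) s (by simp) := by
  apply lift_eq_iff _ hs
  intro n x hx
  have hx' : x ∈ 𝒜 n := by simpa using hx
  rw [RingHom.comp_apply, dehom_self, map_one, one_pow, mul_one, RingHom.comp_apply,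
    dehom_of_mem hs hx' hx]

lemma lift_comp_dehom (φ : S →+* A) (h : φ s = 1) :
    (lift 𝒜 φ s (h ▸ isUnit_one)).comp (dehom hs) = φ := by
  ext x
  induction x using DirectSum.Decomposition.inductionOn 𝒜 with
  | zero => simp
  | @homogeneous i m =>
    have h1 := lift_mk_mul φ hs (h ▸ isUnit_one) i m.1 (by simp)
    simp only [h, one_pow, mul_one] at h1
    rw [RingHom.comp_apply, dehom_of_mem hs m.2 (by simp), h1]
  | add m m' h1 h2 => rw [map_add, map_add, h1, h2]

lemma hom_ext {f g : Away 𝒜 s →+* A} (h : f.comp (dehom hs) = g.comp (dehom hs)) : f = g := by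
  rw [hom_eq_lift hs f, hom_eq_lift hs g]
  congr 1

lemma point_injective {φ ψ : S →+* A} (hφ : φ s = 1) (hψ : ψ s = 1)
    (h : point 𝒜 φ s hs one_pos (hφ ▸ isUnit_one) =
      point 𝒜 ψ s hs one_pos (hψ ▸ isUnit_one)) : φ = ψ := by
  rw [point, point, cancel_mono] at h
  have h1 := congrArg CommRingCat.Hom.hom (Spec.map_injective h)
  simp only [CommRingCat.hom_ofHom] at h1
  rw [← lift_comp_dehom hs φ hφ, ← lift_comp_dehom hs ψ hψ, h1]

lemma exists_eq_point (m : Spec (.of A) ⟶ Proj 𝒜)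
    (hm : ∀ x, m x ∈ Proj.basicOpen 𝒜 s) :
    ∃ (φ : S →+* A) (h : φ s = 1), m = point 𝒜 φ s hs one_pos (h ▸ isUnit_one) := by
  have hr : Set.range m ⊆ Set.range (Proj.awayι 𝒜 s hs one_pos) := by
    rintro _ ⟨x, rfl⟩
    have := hm x
    rw [← Proj.opensRange_awayι 𝒜 s hs one_pos] at this
    exact this
  obtain ⟨f, hf⟩ := Spec.map_surjective
    (IsOpenImmersion.lift (Proj.awayι 𝒜 s hs one_pos) m hr)
  refine ⟨f.hom.comp (dehom hs), by simp, ?_⟩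
  rw [point, ← hom_eq_lift hs f.hom, CommRingCat.ofHom_hom, hf, IsOpenImmersion.lift_fac]

end ProjPoint

/-! ### Coordinates on the plane cubic -/

namespace WeierstrassCurve

open MvPolynomial (aeval)

section Coordinates

variable {R : Type u} [CommRing R] (W : WeierstrassCurve R)

/-- The residue classes of the coordinates `X`, `Y`, `Z`. -/
def coord (i : Fin 3) : W.HomogCoordRing := Ideal.Quotient.mk _ (MvPolynomial.X i)

lemma coord_mem (i : Fin 3) : W.coord i ∈ W.grading 1 :=
  W.mk_mem_grading (MvPolynomial.isHomogeneous_X R i)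

/-- A form of positive degree has no constant term. -/
lemma irrelevant_le_span_coord :
    (HomogeneousIdeal.irrelevant W.grading).toIdeal ≤ Ideal.span (Set.range W.coord) := by
  rw [HomogeneousIdeal.toIdeal_irrelevant_le]
  rintro i hi _ ⟨p, hp, rfl⟩
  have h : p ∈ MvPolynomial.idealOfVars (Fin 3) R := by
    rw [← pow_one (MvPolynomial.idealOfVars (Fin 3) R), MvPolynomial.mem_pow_idealOfVars_iff']
    intro d hd
    exact hp.coeff_eq_zero (by omega)
  have h2 := Ideal.mem_map_of_mem (Ideal.Quotient.mk (Ideal.span {W.toProjective.polynomial})) h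
  rw [Ideal.map_span, ← Set.range_comp] at h2
  exact h2

variable {A B : Type u} [CommRing A] [Algebra R A] [CommRing B] [Algebra R B]

/-- The homogeneous Weierstrass equation for elements of an `R`-algebra. -/
def Eqn (v : Fin 3 → A) : Prop :=
  v 1 ^ 2 * v 2 + algebraMap R A W.a₁ * v 0 * v 1 * v 2 + algebraMap R A W.a₃ * v 1 * v 2 ^ 2 =
    v 0 ^ 3 + algebraMap R A W.a₂ * v 0 ^ 2 * v 2 + algebraMap R A W.a₄ * v 0 * v 2 ^ 2 +
      algebraMap R A W.a₆ * v 2 ^ 3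

lemma eqn_iff (v : Fin 3 → A) : W.Eqn v ↔ aeval v W.toProjective.polynomial = 0 := by
  simp only [Eqn, Projective.polynomial, map_sub, map_add, map_mul, map_pow, MvPolynomial.aeval_X,
    MvPolynomial.aeval_C, sub_eq_zero]

/-- The homomorphism from the homogeneous coordinate ring given by a solution of the homogeneous
Weierstrass equation. -/
def coordHom (v : Fin 3 → A) (hv : W.Eqn v) : W.HomogCoordRing →ₐ[R] A :=
  Ideal.Quotient.liftₐ _ (aeval v) (fun a ha => by
    obtain ⟨b, rfl⟩ := Ideal.mem_span_singleton.1 ha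
    rw [map_mul, (W.eqn_iff v).1 hv, zero_mul])

lemma coordHom_mk (v : Fin 3 → A) (hv : W.Eqn v) (p : MvPolynomial (Fin 3) R) :
    W.coordHom v hv (Ideal.Quotient.mk _ p) = aeval v p := rfl

@[simp] lemma coordHom_coord (v : Fin 3 → A) (hv : W.Eqn v) (i : Fin 3) :
    W.coordHom v hv (W.coord i) = v i := by
  rw [coord, coordHom_mk, MvPolynomial.aeval_X]

lemma mk_eq_aeval (p : MvPolynomial (Fin 3) R) :
    (Ideal.Quotient.mk _ p : W.HomogCoordRing) = aeval W.coord p := by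
  have h : Ideal.Quotient.mkₐ R (Ideal.span {W.toProjective.polynomial}) = aeval W.coord := by
    apply MvPolynomial.algHom_ext
    intro i
    rw [MvPolynomial.aeval_X]
    rfl
  exact DFunLike.congr_fun h p

variable {W} in
lemma algHom_ext {φ ψ : W.HomogCoordRing →ₐ[R] A} (h : ∀ i, φ (W.coord i) = ψ (W.coord i)) :
    φ = ψ := by
  apply Ideal.Quotient.algHom_ext
  apply MvPolynomial.algHom_ext
  exact h

lemma eqn_coord : W.Eqn W.coord := by
  rw [eqn_iff, ← mk_eq_aeval]
  exact Ideal.Quotient.eq_zero_iff_mem.2 (Ideal.mem_span_singleton_self _)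

variable {W} in
lemma Eqn.map {v : Fin 3 → A} (hv : W.Eqn v) (f : A →ₐ[R] B) : W.Eqn (fun i => f (v i)) := by
  rw [eqn_iff] at hv ⊢
  have := congrArg f hv
  rw [map_zero, ← AlgHom.comp_apply] at this
  rw [← this]
  congr 1
  apply MvPolynomial.algHom_ext
  simp

lemma eqn_algHom (φ : W.HomogCoordRing →ₐ[R] A) : W.Eqn (fun i => φ (W.coord i)) :=
  W.eqn_coord.map φ

lemma coord_zero_pow_mem :
    W.coord 0 ^ 3 ∈ Ideal.span {W.coord 1, W.coord 2} := by
  have h := W.eqn_coord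
  rw [Ideal.mem_span_pair]
  unfold Eqn at h
  refine ⟨0, W.coord 1 ^ 2 + algebraMap R _ W.a₁ * W.coord 0 * W.coord 1 +
    algebraMap R _ W.a₃ * W.coord 1 * W.coord 2 -
    (algebraMap R _ W.a₂ * W.coord 0 ^ 2 + algebraMap R _ W.a₄ * W.coord 0 * W.coord 2 +
      algebraMap R _ W.a₆ * W.coord 2 ^ 2), ?_⟩
  linear_combination h

/-- A homogeneous prime containing Y and Z contains X³, hence X, hence the irrelevant ideal. So the
charts Y ≠ 0 and Z ≠ 0 cover E. -/
lemma mem_basicOpen_or (x : W.model) :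
    x ∈ Proj.basicOpen W.grading (W.coord 1) ∨ x ∈ Proj.basicOpen W.grading (W.coord 2) := by
  by_contra! h
  obtain ⟨h1, h2⟩ := h
  rw [Proj.mem_basicOpen, not_not] at h1 h2
  have h1' : W.coord 1 ∈ x.asHomogeneousIdeal.toIdeal := h1
  have h2' : W.coord 2 ∈ x.asHomogeneousIdeal.toIdeal := h2
  have h0 : W.coord 0 ∈ x.asHomogeneousIdeal.toIdeal := by
    apply x.isPrime.mem_of_pow_mem 3
    refine (Ideal.span_le.2 ?_) W.coord_zero_pow_mem
    rintro _ (rfl | rfl)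
    · exact h1'
    · exact h2'
  apply x.not_irrelevant_le
  refine W.irrelevant_le_span_coord.trans (Ideal.span_le.2 ?_)
  rintro _ ⟨i, rfl⟩
  fin_cases i
  · exact h0
  · exact h1'
  · exact h2'

lemma point_modelHom (φ : W.HomogCoordRing →ₐ[R] A) {s : W.HomogCoordRing} {d : ℕ}
    (hs : s ∈ W.grading d) (hd : 0 < d) (h : IsUnit (φ s)) :
    ProjPoint.point W.grading φ.toRingHom s hs hd h ≫ W.modelHom =
      Spec.map (CommRingCat.ofHom (algebraMap R A)) := by
  rw [modelHom, reassoc_of% (ProjPoint.point_toSpecZero (𝒜 := W.grading) φ.toRingHom hs hd h),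
    ← Spec.map_comp, ← CommRingCat.ofHom_comp]
  congr 2
  ext r
  exact φ.commutes r

/-- The `A`-valued point of the plane cubic with homogeneous coordinates `φ`, where `φ` maps the
`i`-th coordinate to `1`. -/
def pt (φ : W.HomogCoordRing →ₐ[R] A) (i : Fin 3) (h : φ (W.coord i) = 1) :
    Spec (.of A) ⟶ W.model :=
  ProjPoint.point W.grading φ.toRingHom (W.coord i) (W.coord_mem i) one_pos
    (by change IsUnit (φ _); simp [h])

lemma pt_modelHom (φ : W.HomogCoordRing →ₐ[R] A) (i : Fin 3) (h : φ (W.coord i) = 1) :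
    W.pt φ i h ≫ W.modelHom = Spec.map (CommRingCat.ofHom (algebraMap R A)) :=
  W.point_modelHom φ _ _ _

variable {W} in
lemma specMap_pt (φ : W.HomogCoordRing →ₐ[R] A) (i : Fin 3) (h : φ (W.coord i) = 1)
    (f : A →ₐ[R] B) :
    Spec.map (CommRingCat.ofHom f.toRingHom) ≫ W.pt φ i h =
      W.pt (f.comp φ) i (by simp [h]) :=
  ProjPoint.specMap_point (𝒜 := W.grading) φ.toRingHom _ _ _ f.toRingHom

variable {W} in
lemma pt_injective {φ ψ : W.HomogCoordRing →ₐ[R] A} {i : Fin 3} {hφ : φ (W.coord i) = 1}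
    {hψ : ψ (W.coord i) = 1} (h : W.pt φ i hφ = W.pt ψ i hψ) : φ = ψ := by
  have := ProjPoint.point_injective (W.coord_mem i) (φ := φ.toRingHom) (ψ := ψ.toRingHom) hφ hψ h
  ext x
  exact DFunLike.congr_fun this x

/-- Compatibility with the structure morphism is R-linearity of the homomorphism of coordinates. -/
lemma exists_pt (m : Spec (.of A) ⟶ W.model)
    (hm : m ≫ W.modelHom = Spec.map (CommRingCat.ofHom (algebraMap R A))) (i : Fin 3)
    (hi : ∀ x, m x ∈ Proj.basicOpen W.grading (W.coord i)) :
    ∃ (φ : W.HomogCoordRing →ₐ[R] A) (h : φ (W.coord i) = 1), m = W.pt φ i h := by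
  obtain ⟨φ, h, rfl⟩ := ProjPoint.exists_eq_point (W.coord_mem i) m hi
  rw [modelHom, reassoc_of% (ProjPoint.point_toSpecZero (𝒜 := W.grading) φ),
    ← Spec.map_comp, ← CommRingCat.ofHom_comp] at hm
  have h1 := congrArg CommRingCat.Hom.hom (Spec.map_injective hm)
  exact ⟨{ φ with commutes' := fun r => DFunLike.congr_fun h1 r }, h, rfl⟩

end Coordinates

/-! ### Morphisms between plane cubics given by linear substitutions -/

section Substitution

variable {R R' : Type u} [CommRing R] [CommRing R'] [Algebra R R'] (W : WeierstrassCurve R)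
  (W' : WeierstrassCurve R') (l : Fin 3 → W'.HomogCoordRing) (hl : W.Eqn l)
  (hd : ∀ i, l i ∈ W'.grading 1)

include hd in
variable {W'} in
lemma aeval_mem_grading {n : ℕ} {p : MvPolynomial (Fin 3) R} (hp : p.IsHomogeneous n) :
    aeval l p ∈ W'.grading n := by
  choose q hq hq' using hd
  have h : aeval l p = (Ideal.Quotient.mk _ (aeval q p) : W'.HomogCoordRing) := by
    change _ = (Ideal.Quotient.mkₐ R (Ideal.span {W'.toProjective.polynomial})) (aeval q p)
    rw [← AlgHom.comp_apply]
    congr 1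
    apply MvPolynomial.algHom_ext
    intro i
    rw [MvPolynomial.aeval_X, AlgHom.comp_apply, MvPolynomial.aeval_X, ← hq']
    rfl
  rw [h]
  apply W'.mk_mem_grading
  have := MvPolynomial.IsHomogeneous.aeval hp q (n := 1) hq
  rwa [one_mul] at this

/-- The homomorphism of graded rings given by a linear substitution. -/
def substGraded : GradedRingHom W.grading W'.grading where
  __ := (W.coordHom l hl).toRingHom
  map_mem := by
    rintro n _ ⟨p, hp, rfl⟩
    exact aeval_mem_grading l hd hp

lemma substGraded_apply (x : W.HomogCoordRing) :
    W.substGraded W' l hl hd x = W.coordHom l hl x := rfl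

variable (hspan : ∀ i, W'.coord i ∈ Ideal.span (Set.range l))

include hspan in
lemma irrelevant_le_map_substGraded :
    HomogeneousIdeal.irrelevant W'.grading ≤
      (HomogeneousIdeal.irrelevant W.grading).map (W.substGraded W' l hl hd) := by
  have h1 : Ideal.span (Set.range l) ≤
      ((HomogeneousIdeal.irrelevant W.grading).map (W.substGraded W' l hl hd)).toIdeal := by
    rw [Ideal.span_le]
    rintro _ ⟨i, rfl⟩
    have := Ideal.mem_map_of_mem (W.substGraded W' l hl hd)
      (HomogeneousIdeal.mem_irrelevant_of_mem W.grading one_pos (W.coord_mem i))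
    rw [substGraded_apply, coordHom_coord] at this
    exact this
  refine W'.irrelevant_le_span_coord.trans (le_trans ?_ h1)
  rw [Ideal.span_le]
  rintro _ ⟨i, rfl⟩
  exact hspan i

/-- The morphism of plane cubics given by a linear substitution. -/
def substHom : W'.model ⟶ W.model :=
  Proj.map (W.substGraded W' l hl hd) (W.irrelevant_le_map_substGraded W' l hl hd hspan)

variable {A : Type u} [CommRing A] [Algebra R A] [Algebra R' A] [IsScalarTower R R' A]

/-- Pulling back homogeneous coordinates along a linear substitution. -/
def substComp (φ : W'.HomogCoordRing →ₐ[R'] A) : W.HomogCoordRing →ₐ[R] A :=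
  (φ.restrictScalars R).comp (W.coordHom l hl)

@[simp] lemma substComp_coord (φ : W'.HomogCoordRing →ₐ[R'] A) (i : Fin 3) :
    W.substComp W' l hl φ (W.coord i) = φ (l i) := by
  simp [substComp]

lemma point_substHom (φ : W'.HomogCoordRing →ₐ[R'] A) {s' : W'.HomogCoordRing} {d : ℕ}
    (hs' : s' ∈ W'.grading d) (hd0 : 0 < d) (h' : IsUnit (φ s')) {s : W.HomogCoordRing} {e : ℕ}
    (hs : s ∈ W.grading e) (he : 0 < e) (h : IsUnit (W.substComp W' l hl φ s)) :
    ProjPoint.point W'.grading φ.toRingHom s' hs' hd0 h' ≫ W.substHom W' l hl hd hspan =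
      ProjPoint.point W.grading (W.substComp W' l hl φ).toRingHom s hs he h := by
  rw [ProjPoint.point_congr (𝒜 := W'.grading) φ.toRingHom hs' hd0 h'
    ((W.substGraded W' l hl hd).map_mem hs) he h]
  exact ProjPoint.point_map (W.substGraded W' l hl hd) _ φ.toRingHom hs he h

lemma pt_substHom (φ : W'.HomogCoordRing →ₐ[R'] A) (i j : Fin 3) (hi : φ (W'.coord i) = 1)
    (hj : φ (l j) = 1) :
    W'.pt φ i hi ≫ W.substHom W' l hl hd hspan =
      W.pt (W.substComp W' l hl φ) j (by simpa using hj) :=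
  W.point_substHom W' l hl hd hspan φ _ _ _ _ _ _

end Substitution

end WeierstrassCurve

/-! ### Base change of the plane cubic -/

namespace WeierstrassCurve

section BaseChange

open HomogeneousLocalization

variable {R : Type u} [CommRing R] (W : WeierstrassCurve R)

/-- The structure homomorphism of the coordinate ring of the chart `D₊(s)`. -/
def awayStr (s : W.HomogCoordRing) : R →+* Away W.grading s :=
  (fromZeroRingHom W.grading (Submonoid.powers s)).comp (algebraMap R (W.grading 0))

lemma awayι_modelHom {s : W.HomogCoordRing} {d : ℕ} (hs : s ∈ W.grading d) (hd : 0 < d) :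
    Proj.awayι W.grading s hs hd ≫ W.modelHom =
      Spec.map (CommRingCat.ofHom (W.awayStr s)) := by
  rw [modelHom, Proj.awayι_toSpecZero_assoc, ← Spec.map_comp]
  rfl

lemma dehom_comp_algebraMap {s : W.HomogCoordRing} (hs : s ∈ W.grading 1) :
    (ProjPoint.dehom hs).comp (algebraMap R _) = W.awayStr s := by
  ext1 r
  have h0 : algebraMap R W.HomogCoordRing r ∈ W.grading 0 := (algebraMap R (W.grading 0) r).2
  rw [RingHom.comp_apply, ProjPoint.dehom_of_mem hs h0 (by simpa using h0)]
  ext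
  change Localization.mk _ _ = Localization.mk _ _
  congr 1
  exact Subtype.ext (pow_zero s)

variable (R' : Type u) [CommRing R'] [Algebra R R']

lemma eqn_map_iff {A : Type u} [CommRing A] [Algebra R A] [Algebra R' A] [IsScalarTower R R' A]
    (v : Fin 3 → A) : (W.map (algebraMap R R')).Eqn v ↔ W.Eqn v := by
  simp only [Eqn, map_a₁, map_a₂, map_a₃, map_a₄, map_a₆, ← IsScalarTower.algebraMap_apply]

/-- The homomorphism of homogeneous coordinate rings belonging to the base change `E_{R'} ⟶ E`. -/
abbrev baseGraded : GradedRingHom W.grading (W.map (algebraMap R R')).grading :=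
  W.substGraded _ (W.map (algebraMap R R')).coord
    ((W.eqn_map_iff R' _).1 (eqn_coord _)) (coord_mem _)

/-- The projection `E_{R'} ⟶ E` of the base change. -/
def baseHom : (W.map (algebraMap R R')).model ⟶ W.model :=
  W.substHom _ (W.map (algebraMap R R')).coord
    ((W.eqn_map_iff R' _).1 (eqn_coord _)) (coord_mem _)
    (fun i => Ideal.subset_span ⟨i, rfl⟩)

lemma baseGraded_coord (i : Fin 3) :
    W.baseGraded R' (W.coord i) = (W.map (algebraMap R R')).coord i :=
  W.coordHom_coord _ ((W.eqn_map_iff R' _).1 (eqn_coord _)) i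

lemma baseGraded_algebraMap (r : R) :
    W.baseGraded R' (algebraMap R _ r) = algebraMap R' _ (algebraMap R R' r) := by
  rw [substGraded_apply, AlgHom.commutes]
  exact IsScalarTower.algebraMap_apply R R' _ r

lemma awayMap_comp_awayStr (s : W.HomogCoordRing) :
    (Away.map (W.baseGraded R') s).comp (W.awayStr s) =
      ((W.map (algebraMap R R')).awayStr (W.baseGraded R' s)).comp (algebraMap R R') := by
  ext1 r
  ext
  have h1 : W.baseGraded R' 1 = 1 := map_one (W.baseGraded R').toRingHom
  change Localization.mk _ _ = Localization.mk _ _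
  congr 1
  · exact W.baseGraded_algebraMap R' r
  · exact Subtype.ext h1

lemma awayMap_comp_dehom {s : W.HomogCoordRing} (hs : s ∈ W.grading 1) :
    (Away.map (W.baseGraded R') s).comp (ProjPoint.dehom hs) =
      (ProjPoint.dehom ((W.baseGraded R').map_mem hs)).comp (W.baseGraded R').toRingHom := by
  refine RingHom.ext fun x => ?_
  induction x using DirectSum.Decomposition.inductionOn W.grading with
  | zero => simp
  | @homogeneous i m =>
    have hm : (W.baseGraded R').toRingHom m.1 ∈ (W.map (algebraMap R R')).grading i :=
      (W.baseGraded R').map_mem m.2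
    rw [RingHom.comp_apply, RingHom.comp_apply, ProjPoint.dehom_of_mem hs m.2 (by simp),
      ProjPoint.dehom_of_mem _ hm (by simpa using hm), Away.map_mk]
    rfl
  | add m m' h1 h2 => rw [map_add, map_add, h1, h2]

/-- The map g amounts to a solution in T of the Weierstrass equation over R with i-th entry 1. The
same triple solves the equation over R', which gives u. -/
lemma exists_desc_away (i : Fin 3) {T : Type u} [CommRing T] (g : Away W.grading (W.coord i) →+* T)
    (f : R' →+* T) (h : g.comp (W.awayStr _) = f.comp (algebraMap R R')) :
    ∃ u : Away (W.map (algebraMap R R')).grading (W.baseGraded R' (W.coord i)) →+* T,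
      u.comp (Away.map (W.baseGraded R') (W.coord i)) = g ∧ u.comp (awayStr _ _) = f := by
  let := f.toAlgebra
  let := (f.comp (algebraMap R R')).toAlgebra
  have : IsScalarTower R R' T := IsScalarTower.of_algebraMap_eq fun _ => rfl
  have hs := W.coord_mem i
  have hs' : W.baseGraded R' (W.coord i) ∈ (W.map (algebraMap R R')).grading 1 :=
    (W.baseGraded R').map_mem hs
  let φ : W.HomogCoordRing →ₐ[R] T :=
    { g.comp (ProjPoint.dehom hs) with
      commutes' := fun r => by
        have h1 := DFunLike.congr_fun (W.dehom_comp_algebraMap hs) r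
        have h2 := DFunLike.congr_fun h r
        simp only [RingHom.comp_apply] at h1 h2
        change g (ProjPoint.dehom hs (algebraMap R W.HomogCoordRing r)) = f (algebraMap R R' r)
        rw [h1, h2] }
  have hφ : φ (W.coord i) = 1 := by
    change g (ProjPoint.dehom hs (W.coord i)) = 1
    rw [ProjPoint.dehom_self, map_one]
  let φ' := (W.map (algebraMap R R')).coordHom _ ((W.eqn_map_iff R' _).2 (W.eqn_algHom φ))
  have hφ'' : φ'.toRingHom.comp (W.baseGraded R').toRingHom = φ.toRingHom := by
    have : W.substComp _ _ ((W.eqn_map_iff R' _).1 (eqn_coord _)) φ' = φ := by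
      apply algHom_ext
      intro j
      rw [substComp_coord, coordHom_coord]
    exact congrArg AlgHom.toRingHom this
  have hφ' : φ' (W.baseGraded R' (W.coord i)) = 1 := by
    rw [← hφ]
    exact DFunLike.congr_fun hφ'' (W.coord i)
  refine ⟨ProjPoint.lift _ φ'.toRingHom _ (hφ'.symm ▸ isUnit_one : IsUnit (φ' _)), ?_, ?_⟩
  · apply ProjPoint.hom_ext hs
    rw [RingHom.comp_assoc, awayMap_comp_dehom _ _ hs, ← RingHom.comp_assoc,
      ProjPoint.lift_comp_dehom hs' φ'.toRingHom hφ', hφ'']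
  · rw [← dehom_comp_algebraMap _ hs', ← RingHom.comp_assoc,
      ProjPoint.lift_comp_dehom hs' φ'.toRingHom hφ']
    ext1 r
    exact φ'.commutes r

lemma desc_away_unique (i : Fin 3) {T : Type u} [CommRing T]
    {u v : Away (W.map (algebraMap R R')).grading (W.baseGraded R' (W.coord i)) →+* T}
    (h1 : u.comp (Away.map (W.baseGraded R') (W.coord i)) =
      v.comp (Away.map (W.baseGraded R') (W.coord i)))
    (h2 : u.comp (awayStr _ _) = v.comp (awayStr _ _)) : u = v := by
  have hs := W.coord_mem i
  have hs' : W.baseGraded R' (W.coord i) ∈ (W.map (algebraMap R R')).grading 1 :=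
    (W.baseGraded R').map_mem hs
  apply ProjPoint.hom_ext hs'
  have h3 := congrArg (fun w => w.comp (ProjPoint.dehom hs)) h1
  simp only [RingHom.comp_assoc, awayMap_comp_dehom _ _ hs] at h3
  rw [← dehom_comp_algebraMap _ hs'] at h2
  apply Ideal.Quotient.ringHom_ext
  apply MvPolynomial.ringHom_ext
  · intro r
    exact DFunLike.congr_fun h2 r
  · intro j
    have h4 := DFunLike.congr_fun h3 (W.coord j)
    simp only [RingHom.comp_apply] at h4
    have h5 : (W.baseGraded R').toRingHom (W.coord j) = (W.map (algebraMap R R')).coord j :=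
      W.baseGraded_coord R' j
    change u (ProjPoint.dehom hs' ((W.baseGraded R').toRingHom (W.coord j))) =
      v (ProjPoint.dehom hs' ((W.baseGraded R').toRingHom (W.coord j))) at h4
    rw [h5] at h4
    exact h4

lemma isPushout_awayMap (i : Fin 3) :
    IsPushout (CommRingCat.ofHom (W.awayStr (W.coord i))) (CommRingCat.ofHom (algebraMap R R'))
      (CommRingCat.ofHom (Away.map (W.baseGraded R') (W.coord i)))
      (CommRingCat.ofHom
        ((W.map (algebraMap R R')).awayStr (W.baseGraded R' (W.coord i)))) := by
  have w : CommRingCat.ofHom (W.awayStr (W.coord i)) ≫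
      CommRingCat.ofHom (Away.map (W.baseGraded R') (W.coord i)) =
      CommRingCat.ofHom (algebraMap R R') ≫ CommRingCat.ofHom
        ((W.map (algebraMap R R')).awayStr (W.baseGraded R' (W.coord i))) := by
    rw [← CommRingCat.ofHom_comp, ← CommRingCat.ofHom_comp, awayMap_comp_awayStr]
  have key : ∀ c : PushoutCocone (CommRingCat.ofHom (W.awayStr (W.coord i)))
      (CommRingCat.ofHom (algebraMap R R')), _ := fun c =>
    W.exists_desc_away R' i c.inl.hom c.inr.hom
      (congrArg CommRingCat.Hom.hom c.condition)
  refine IsPushout.of_isColimit' ⟨w⟩ (PushoutCocone.IsColimit.mk _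
    (fun c => CommRingCat.ofHom (key c).choose) (fun c => ?_) (fun c => ?_) (fun c m h1 h2 => ?_))
  · ext1
    exact (key c).choose_spec.1
  · ext1
    exact (key c).choose_spec.2
  · ext1
    refine W.desc_away_unique R' i ?_ ?_
    · rw [CommRingCat.hom_ofHom, (key c).choose_spec.1]
      exact congrArg CommRingCat.Hom.hom h1
    · rw [CommRingCat.hom_ofHom, (key c).choose_spec.2]
      exact congrArg CommRingCat.Hom.hom h2

lemma isPullback_awayι_baseHom (i : Fin 3) :
    IsPullback
      (Proj.awayι _ (W.baseGraded R' (W.coord i)) ((W.baseGraded R').map_mem (W.coord_mem i))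
        one_pos)
      (Spec.map (CommRingCat.ofHom (Away.map (W.baseGraded R') (W.coord i))))
      (W.baseHom R') (Proj.awayι _ (W.coord i) (W.coord_mem i) one_pos) := by
  refine (IsOpenImmersion.isPullback _ _ _ _ ?_ ?_).flip
  · exact Proj.awayι_comp_map _ _ one_pos _ _
  · rw [Proj.opensRange_awayι, Proj.opensRange_awayι]
    rfl

/-- Being Cartesian is local on E. The preimage of a standard chart is the corresponding chart of
E_{R'}, and there the square is dual to a pushout of rings. -/
lemma isPullback_baseHom :
    IsPullback (W.baseHom R') (W.map (algebraMap R R')).modelHom W.modelHom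
      (Spec.map (CommRingCat.ofHom (algebraMap R R'))) := by
  refine Scheme.isPullback_of_openCover _ _ _ _
    (Proj.affineOpenCoverOfIrrelevantLESpan W.grading W.coord W.coord_mem (fun _ => one_pos)
      W.irrelevant_le_span_coord).openCover (fun i => ?_)
  have h := isPullback_SpecMap_of_isPushout _ _ _ _ (W.isPushout_awayMap R' i)
  refine IsPullback.of_iso h (W.isPullback_awayι_baseHom R' i).isoPullback (Iso.refl _)
    (Iso.refl _) (Iso.refl _) ?_ ?_ ?_ ?_
  · simp only [Iso.refl_hom]
    exact ((W.isPullback_awayι_baseHom R' i).isoPullback_hom_snd).symm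
  · rw [← awayι_modelHom _ ((W.baseGraded R').map_mem (W.coord_mem i)) one_pos]
    simp only [Iso.refl_hom, Category.comp_id]
    exact ((W.isPullback_awayι_baseHom R' i).isoPullback_hom_fst_assoc _).symm
  · simp only [Iso.refl_hom, Category.comp_id]
    exact (W.awayι_modelHom (W.coord_mem i) one_pos).symm
  · simp

end BaseChange

end WeierstrassCurve

/-! ### The first Fitting ideal over a local ring -/

section Fitting

variable {A M : Type*} [CommRing A] [AddCommGroup M] [Module A M]

lemma fittingIdeal_one_eq_top_of_span_eq_top (m : M) (hm : Submodule.span A {m} = ⊤) :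
    fittingIdeal A M 1 = ⊤ := by
  rw [Ideal.eq_top_iff_one]
  -- One generator and no relations: the empty minor has determinant 1.
  refine Ideal.subset_span ⟨0, fun _ => m, 0, ⟨Fin.elim0, fun a => a.elim0⟩, ?_, fun i => i.elim0,
    ?_⟩
  · rw [Set.range_const, hm]
  · simp

/-- Over a local ring some maximal minor must be a unit. By Cramer's rule the generators belonging
to its columns are multiples of the single remaining one. -/
lemma exists_span_eq_top_of_fittingIdeal_one_eq_top [IsLocalRing A] (h : fittingIdeal A M 1 = ⊤) :
    ∃ m : M, Submodule.span A {m} = ⊤ := by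
  by_contra! hne
  refine (IsLocalRing.maximalIdeal.isMaximal A).ne_top (top_le_iff.1 ?_)
  rw [← h, fittingIdeal, Ideal.span_le]
  rintro r ⟨n, m, B, c, hm, hB, rfl⟩
  by_contra hu
  have hu : IsUnit (B.submatrix id c).det := by simpa using hu
  -- A minor with n of the n + 1 columns omits exactly one column.
  obtain ⟨j₀, hj₀⟩ : ∃ j₀, j₀ ∉ Set.range c := by
    by_contra! hsurj
    have := Fintype.card_le_of_surjective c hsurj
    simp at this
  have hcompl : ∀ j, j ≠ j₀ → j ∈ Set.range c := by
    intro j hj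
    by_contra hjc
    have hle := Finset.card_le_card
      (Finset.subset_univ (insert j (insert j₀ (Finset.univ.map c))))
    rw [Finset.card_insert_of_notMem, Finset.card_insert_of_notMem, Finset.card_map] at hle
    · simp at hle
    · simpa using hj₀
    · simpa [hj] using hjc
  refine hne (m j₀) (top_le_iff.1 ?_)
  rw [← hm, Submodule.span_le]
  rintro _ ⟨j, rfl⟩
  by_cases hj : j = j₀
  · rw [hj]
    exact Submodule.mem_span_singleton_self _
  obtain ⟨k, rfl⟩ := hcompl j hj
  have hrel : ∀ i, ∑ l, B i (c l) • m (c l) = -(B i j₀ • m j₀) := by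
    intro i
    rw [eq_neg_iff_add_eq_zero, ← hB i]
    have huniv : (Finset.univ : Finset (Fin (n + 1))) = insert j₀ (Finset.univ.map c) := by
      ext j
      by_cases hj : j = j₀
      · simp [hj]
      · simpa [hj] using hcompl j hj
    rw [huniv, Finset.sum_insert (by simpa using hj₀), Finset.sum_map, add_comm]
  have key : (B.submatrix id c).det • m (c k) ∈ Submodule.span A {m j₀} := by
    have h1 : ∑ i, (B.submatrix id c).adjugate k i • ∑ l, B i (c l) • m (c l) =
        (B.submatrix id c).det • m (c k) := by
      simp_rw [Finset.smul_sum, smul_smul]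
      rw [Finset.sum_comm]
      simp_rw [← Finset.sum_smul]
      have h2 : ∀ l, ∑ i, (B.submatrix id c).adjugate k i * B i (c l) =
          ((B.submatrix id c).adjugate * B.submatrix id c) k l := fun l => rfl
      simp_rw [h2, Matrix.adjugate_mul, Matrix.smul_apply, Matrix.one_apply]
      simp
    rw [← h1]
    refine Submodule.sum_mem _ fun i _ => Submodule.smul_mem _ _ ?_
    rw [hrel]
    exact Submodule.neg_mem _ (Submodule.smul_mem _ _ (Submodule.mem_span_singleton_self _))
  exact (Submodule.smul_mem_iff_of_isUnit _ hu).1 key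

end Fitting

/-! ### The points of non-smoothness of the plane cubic -/

namespace WeierstrassCurve

section SingularLocus

variable {R : Type u} [CommRing R] (W : WeierstrassCurve R) (z : W.model)

/-- The structure homomorphism of the local ring of the plane cubic at a point. -/
def stalkStr : R →+* W.model.presheaf.stalk z :=
  (Spec.preimage (W.model.fromSpecStalk z ≫ W.modelHom)).hom

/-- The local ring of the plane cubic at a point as an algebra. -/
abbrev stalkAlgebra : Algebra R (W.model.presheaf.stalk z) := (W.stalkStr z).toAlgebra

lemma specMap_stalkStr :
    Spec.map (CommRingCat.ofHom (W.stalkStr z)) = W.model.fromSpecStalk z ≫ W.modelHom := by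
  rw [stalkStr, CommRingCat.ofHom_hom, Spec.map_preimage]

variable {z}

lemma stalkMap_comp_toStalk :
    (W.modelHom.stalkMap z).hom.comp
      (Spec.preimage ((Spec (.of R)).fromSpecStalk (W.modelHom z))).hom = W.stalkStr z := by
  have h := Scheme.SpecMap_stalkMap_fromSpecStalk W.modelHom (x := z)
  rw [← Spec.map_preimage ((Spec (.of R)).fromSpecStalk (W.modelHom z)), ← Spec.map_comp,
    ← specMap_stalkStr] at h
  exact congrArg CommRingCat.Hom.hom (Spec.map_injective h)

/-- As `fromSpecStalk` is a monomorphism, homomorphisms out of a stalk can be compared as points of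
the scheme, hence through their coordinates. -/
lemma stalk_hom_ext {X : Scheme.{u}} {x : X} {T : CommRingCat.{u}}
    {g g' : X.presheaf.stalk x ⟶ T}
    (h : Spec.map g ≫ X.fromSpecStalk x = Spec.map g' ≫ X.fromSpecStalk x) : g = g' := by
  rw [cancel_mono] at h
  exact Spec.map_injective h

lemma stalk_hom_eq_of_comp_eq {T : Type u} [CommRing T]
    {u v : (Spec (.of R)).presheaf.stalk (W.modelHom z) →+* T}
    (h : u.comp (Spec.preimage ((Spec (.of R)).fromSpecStalk (W.modelHom z))).hom =
      v.comp (Spec.preimage ((Spec (.of R)).fromSpecStalk (W.modelHom z))).hom) : u = v := by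
  have h1 : CommRingCat.ofHom u = CommRingCat.ofHom v := by
    apply stalk_hom_ext
    rw [← Spec.map_preimage ((Spec (.of R)).fromSpecStalk (W.modelHom z)), ← Spec.map_comp,
      ← Spec.map_comp]
    congr 1
    ext1
    exact h
  exact congrArg CommRingCat.Hom.hom h1

/-- An open set containing the image of the closed point of a local spectrum contains the whole
image. -/
lemma exists_pt_fromSpecStalk (i : Fin 3) (hi : z ∈ Proj.basicOpen W.grading (W.coord i)) :
    letI := W.stalkAlgebra z
    ∃ (φ : W.HomogCoordRing →ₐ[R] W.model.presheaf.stalk z) (h : φ (W.coord i) = 1),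
      W.model.fromSpecStalk z = W.pt φ i h := by
  let := W.stalkAlgebra z
  apply W.exists_pt _ (W.specMap_stalkStr z).symm i
  intro x
  have h := Scheme.preimage_eq_top_of_closedPoint_mem (W.model.fromSpecStalk z)
    (U := Proj.basicOpen W.grading (W.coord i)) (by rwa [Scheme.fromSpecStalk_closedPoint])
  have : x ∈ W.model.fromSpecStalk z ⁻¹ᵁ Proj.basicOpen W.grading (W.coord i) := by
    rw [h]
    trivial
  exact this

section Derivation

variable {i : Fin 3} [alg : Algebra R (W.model.presheaf.stalk z)]
  (halg : algebraMap R (W.model.presheaf.stalk z) = W.stalkStr z)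
  [algS : Algebra ((Spec (.of R)).presheaf.stalk (W.modelHom z)) (W.model.presheaf.stalk z)]
  (halgS : algebraMap ((Spec (.of R)).presheaf.stalk (W.modelHom z)) (W.model.presheaf.stalk z) =
    (W.modelHom.stalkMap z).hom)
  {φ : W.HomogCoordRing →ₐ[R] W.model.presheaf.stalk z} {h : φ (W.coord i) = 1}
  (hφ : W.model.fromSpecStalk z = W.pt φ i h)
  {M : Type u} [AddCommGroup M] [Module (W.model.presheaf.stalk z) M]
  [Module ((Spec (.of R)).presheaf.stalk (W.modelHom z)) M]
  (D : Derivation ((Spec (.of R)).presheaf.stalk (W.modelHom z)) (W.model.presheaf.stalk z) M)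

include halg halgS in
lemma derivation_algebraMap (r : R) : D (algebraMap R _ r) = 0 := by
  rw [halg, ← stalkMap_comp_toStalk, RingHom.comp_apply, ← halgS, D.map_algebraMap]

include halg halgS hφ in
-- The maps a ↦ a + εD(a) and a ↦ a into the square-zero extension agree on the coordinates. They
-- therefore define the same point of E and coincide.
lemma derivation_eq_zero (hD : ∀ j, D (φ (W.coord j)) = 0) (a : W.model.presheaf.stalk z) :
    D a = 0 := by
  -- The ring structure on `TrivSqZeroExt` also asks for a right action, here the left one by
  -- commutativity.
  let : Module (W.model.presheaf.stalk z)ᵐᵒᵖ M :=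
    Module.compHom M ((RingHom.id (W.model.presheaf.stalk z)).fromOpposite mul_comm)
  have : IsCentralScalar (W.model.presheaf.stalk z) M := ⟨fun _ _ => rfl⟩
  let g : W.model.presheaf.stalk z →+* TrivSqZeroExt (W.model.presheaf.stalk z) M :=
    { toFun := fun a => TrivSqZeroExt.inl a + TrivSqZeroExt.inr (D a)
      map_one' := by ext <;> simp
      map_zero' := by ext <;> simp
      map_add' := fun a b => by ext <;> simp
      map_mul' := fun a b => by ext <;> simp }
  let : Algebra R (TrivSqZeroExt (W.model.presheaf.stalk z) M) :=
    ((TrivSqZeroExt.inlHom _ M).comp (algebraMap R _)).toAlgebra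
  let g₀ : W.model.presheaf.stalk z →ₐ[R] TrivSqZeroExt (W.model.presheaf.stalk z) M :=
    { TrivSqZeroExt.inlHom _ _ with commutes' := fun r => rfl }
  have hg : ∀ r, g (algebraMap R _ r) = algebraMap R _ r := by
    intro r
    change (TrivSqZeroExt.inl (algebraMap R (W.model.presheaf.stalk z) r) +
      TrivSqZeroExt.inr (D (algebraMap R _ r)) : TrivSqZeroExt (W.model.presheaf.stalk z) M) =
      TrivSqZeroExt.inl (algebraMap R (W.model.presheaf.stalk z) r)
    rw [W.derivation_algebraMap halg halgS D r]
    simp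
  let g₁ : W.model.presheaf.stalk z →ₐ[R] TrivSqZeroExt (W.model.presheaf.stalk z) M :=
    { g with commutes' := hg }
  have h1 : g₁.comp φ = g₀.comp φ := by
    apply algHom_ext
    intro j
    change (TrivSqZeroExt.inl (φ (W.coord j)) + TrivSqZeroExt.inr (D (φ (W.coord j))) :
      TrivSqZeroExt (W.model.presheaf.stalk z) M) = TrivSqZeroExt.inl (φ (W.coord j))
    rw [hD]
    simp
  have h2 : CommRingCat.ofHom g₁.toRingHom = CommRingCat.ofHom g₀.toRingHom := by
    apply stalk_hom_ext
    rw [hφ]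
    have e1 := specMap_pt φ i h g₁
    have e0 := specMap_pt φ i h g₀
    refine e1.trans (Eq.trans ?_ e0.symm)
    congr 1
  have h3 := congrArg TrivSqZeroExt.snd
    (DFunLike.congr_fun (congrArg CommRingCat.Hom.hom h2) a)
  change (TrivSqZeroExt.inl a + TrivSqZeroExt.inr (D a) : TrivSqZeroExt _ M).snd =
    (TrivSqZeroExt.inl a : TrivSqZeroExt _ M).snd at h3
  simpa using h3

end Derivation

end SingularLocus

end WeierstrassCurve

/-! ### The differentials of the affine coordinates and the relation between them -/

namespace WeierstrassCurve

section SingularLocus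

open IsLocalRing

variable {R : Type u} [CommRing R] (W : WeierstrassCurve R) {z : W.model}

lemma mem_basicOpen_of_point {A : Type u} [CommRing A] [IsLocalRing A]
    {φ : W.HomogCoordRing →+* A} {s : W.HomogCoordRing} {d : ℕ} (hs : s ∈ W.grading d)
    (hd : 0 < d) (h : IsUnit (φ s)) (x : Spec (.of A)) :
    ProjPoint.point W.grading φ s hs hd h x ∈ Proj.basicOpen W.grading s := by
  rw [← Proj.opensRange_awayι W.grading s hs hd, ProjPoint.point]
  exact ⟨_, rfl⟩

section Span

variable {i : Fin 3} [alg : Algebra R (W.model.presheaf.stalk z)]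
  (halg : algebraMap R (W.model.presheaf.stalk z) = W.stalkStr z)
  [algS : Algebra ((Spec (.of R)).presheaf.stalk (W.modelHom z)) (W.model.presheaf.stalk z)]
  (halgS : algebraMap ((Spec (.of R)).presheaf.stalk (W.modelHom z)) (W.model.presheaf.stalk z) =
    (W.modelHom.stalkMap z).hom)
  {φ : W.HomogCoordRing →ₐ[R] W.model.presheaf.stalk z} {h : φ (W.coord i) = 1}
  (hφ : W.model.fromSpecStalk z = W.pt φ i h)

include halg halgS hφ in
-- The universal derivation followed by the quotient map modulo N kills the coordinates, so it is
-- zero.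
lemma mem_of_forall_D_mem
    (N : Submodule (W.model.presheaf.stalk z) (KaehlerDifferential
      ((Spec (.of R)).presheaf.stalk (W.modelHom z)) (W.model.presheaf.stalk z)))
    (hN : ∀ j, KaehlerDifferential.D _ _ (φ (W.coord j)) ∈ N) : N = ⊤ := by
  rw [← top_le_iff, ← KaehlerDifferential.span_range_derivation, Submodule.span_le]
  rintro _ ⟨a, rfl⟩
  have h1 := W.derivation_eq_zero halg halgS hφ (N.mkQ.compDer (KaehlerDifferential.D
    ((Spec (.of R)).presheaf.stalk (W.modelHom z)) (W.model.presheaf.stalk z)))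
    (fun j => by simpa using hN j) a
  simpa using h1

include halg halgS hφ in
-- The i-th coordinate is 1 and has zero differential. A unit coefficient eliminates one of the
-- other two differentials, so the module is cyclic.
lemma fittingIdeal_eq_top_of_relation {j k : Fin 3} (hijk : ∀ l, l = i ∨ l = j ∨ l = k)
    {p q : W.model.presheaf.stalk z} (hp : IsUnit p)
    (hpq : p • KaehlerDifferential.D ((Spec (.of R)).presheaf.stalk (W.modelHom z))
        (W.model.presheaf.stalk z) (φ (W.coord j)) +
      q • KaehlerDifferential.D ((Spec (.of R)).presheaf.stalk (W.modelHom z))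
        (W.model.presheaf.stalk z) (φ (W.coord k)) = 0) :
    fittingIdeal (W.model.presheaf.stalk z) (KaehlerDifferential
      ((Spec (.of R)).presheaf.stalk (W.modelHom z)) (W.model.presheaf.stalk z)) 1 = ⊤ := by
  apply fittingIdeal_one_eq_top_of_span_eq_top (KaehlerDifferential.D
    ((Spec (.of R)).presheaf.stalk (W.modelHom z)) (W.model.presheaf.stalk z) (φ (W.coord k)))
  apply W.mem_of_forall_D_mem halg halgS hφ
  intro l
  rcases hijk l with rfl | rfl | rfl
  · rw [h, Derivation.map_one_eq_zero]
    exact zero_mem _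
  · rw [← Submodule.smul_mem_iff_of_isUnit _ hp, eq_neg_of_add_eq_zero_left hpq]
    exact neg_mem (Submodule.smul_mem _ _ (Submodule.mem_span_singleton_self _))
  · exact Submodule.mem_span_singleton_self _

include halg halgS in
-- This is the universal derivation applied to the equation with Z = 1.
lemma D_relation_two (h : φ (W.coord 2) = 1) :
    (2 * φ (W.coord 1) + algebraMap R _ W.a₁ * φ (W.coord 0) + algebraMap R _ W.a₃) •
        KaehlerDifferential.D ((Spec (.of R)).presheaf.stalk (W.modelHom z))
        (W.model.presheaf.stalk z) (φ (W.coord 1)) +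
      (algebraMap R _ W.a₁ * φ (W.coord 1) - (3 * φ (W.coord 0) ^ 2 +
        2 * algebraMap R _ W.a₂ * φ (W.coord 0) + algebraMap R _ W.a₄)) •
        KaehlerDifferential.D ((Spec (.of R)).presheaf.stalk (W.modelHom z))
        (W.model.presheaf.stalk z) (φ (W.coord 0)) = 0 := by
  have hD := W.derivation_algebraMap halg halgS (KaehlerDifferential.D
    ((Spec (.of R)).presheaf.stalk (W.modelHom z)) (W.model.presheaf.stalk z))
  have e := W.eqn_algHom φ
  simp only [Eqn, h, mul_one, one_pow] at e
  have e2 := congrArg (KaehlerDifferential.D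
    ((Spec (.of R)).presheaf.stalk (W.modelHom z)) (W.model.presheaf.stalk z)) e
  simp only [map_add, Derivation.leibniz, Derivation.leibniz_pow, hD, smul_zero, add_zero,
    smul_smul] at e2
  rw [← sub_eq_zero] at e2
  rw [← e2]
  module

include halg halgS in
lemma D_relation_one (h : φ (W.coord 1) = 1) :
    (1 + algebraMap R _ W.a₁ * φ (W.coord 0) + 2 * algebraMap R _ W.a₃ * φ (W.coord 2) -
      (algebraMap R _ W.a₂ * φ (W.coord 0) ^ 2 +
        2 * algebraMap R _ W.a₄ * φ (W.coord 0) * φ (W.coord 2) +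
        3 * algebraMap R _ W.a₆ * φ (W.coord 2) ^ 2)) •
        KaehlerDifferential.D ((Spec (.of R)).presheaf.stalk (W.modelHom z))
        (W.model.presheaf.stalk z) (φ (W.coord 2)) +
      (algebraMap R _ W.a₁ * φ (W.coord 2) - (3 * φ (W.coord 0) ^ 2 +
        2 * algebraMap R _ W.a₂ * φ (W.coord 0) * φ (W.coord 2) +
        algebraMap R _ W.a₄ * φ (W.coord 2) ^ 2)) •
        KaehlerDifferential.D ((Spec (.of R)).presheaf.stalk (W.modelHom z))
        (W.model.presheaf.stalk z) (φ (W.coord 0)) = 0 := by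
  have hD := W.derivation_algebraMap halg halgS (KaehlerDifferential.D
    ((Spec (.of R)).presheaf.stalk (W.modelHom z)) (W.model.presheaf.stalk z))
  have e := W.eqn_algHom φ
  simp only [Eqn, h, mul_one, one_pow, one_mul] at e
  have e2 := congrArg (KaehlerDifferential.D
    ((Spec (.of R)).presheaf.stalk (W.modelHom z)) (W.model.presheaf.stalk z)) e
  simp only [map_add, Derivation.leibniz, Derivation.leibniz_pow, hD, smul_zero, add_zero,
    smul_smul] at e2
  rw [← sub_eq_zero] at e2
  rw [← e2]
  module

end Span

end SingularLocus

end WeierstrassCurve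

/-! ### Singular points lie in the affine part and annihilate both partial derivatives -/

namespace WeierstrassCurve

section SingularLocus

open IsLocalRing

variable {R : Type u} [CommRing R] (W : WeierstrassCurve R) {z : W.model}

lemma not_isUnit_partials_of_mem_singLocus (hz : z ∈ singLocus W.modelHom) :
    letI := W.stalkAlgebra z
    ∀ (φ : W.HomogCoordRing →ₐ[R] W.model.presheaf.stalk z) (h : φ (W.coord 2) = 1),
      W.model.fromSpecStalk z = W.pt φ 2 h →
      ¬ IsUnit (2 * φ (W.coord 1) + algebraMap R _ W.a₁ * φ (W.coord 0) + algebraMap R _ W.a₃) ∧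
      ¬ IsUnit (algebraMap R _ W.a₁ * φ (W.coord 1) - (3 * φ (W.coord 0) ^ 2 +
        2 * algebraMap R _ W.a₂ * φ (W.coord 0) + algebraMap R _ W.a₄)) := by
  intro φ h hφ
  let := W.stalkAlgebra z
  let : Algebra ((Spec (.of R)).presheaf.stalk (W.modelHom z)) (W.model.presheaf.stalk z) :=
    (W.modelHom.stalkMap z).hom.toAlgebra
  have hrel := W.D_relation_two rfl rfl h
  refine ⟨fun hu => hz ?_, fun hu => hz ?_⟩
  · exact W.fittingIdeal_eq_top_of_relation (i := 2) rfl rfl hφ (j := 1) (k := 0)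
      (by decide) hu hrel
  · rw [add_comm] at hrel
    exact W.fittingIdeal_eq_top_of_relation (i := 2) rfl rfl hφ (j := 0) (k := 1)
      (by decide) hu hrel

/-- If Z is not a unit at z, then neither is X, by the equation. The Z-derivative of the equation
with Y = 1 is then congruent to 1, so z is not singular. -/
lemma isUnit_coord_two_of_mem_singLocus (hz : z ∈ singLocus W.modelHom) :
    letI := W.stalkAlgebra z
    ∀ (φ : W.HomogCoordRing →ₐ[R] W.model.presheaf.stalk z) (h : φ (W.coord 1) = 1),
      W.model.fromSpecStalk z = W.pt φ 1 h → IsUnit (φ (W.coord 2)) := by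
  intro φ h hφ
  let := W.stalkAlgebra z
  let : Algebra ((Spec (.of R)).presheaf.stalk (W.modelHom z)) (W.model.presheaf.stalk z) :=
    (W.modelHom.stalkMap z).hom.toAlgebra
  have hrel := W.D_relation_one rfl rfl h
  by_contra hu
  have h2 : φ (W.coord 2) ∈ maximalIdeal (W.model.presheaf.stalk z) := hu
  have h0 : φ (W.coord 0) ∈ maximalIdeal (W.model.presheaf.stalk z) := by
    apply Ideal.IsPrime.mem_of_pow_mem inferInstance 3
    have e := W.eqn_algHom φ
    simp only [Eqn, h, mul_one, one_pow, one_mul] at e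
    have : φ (W.coord 0) ^ 3 = (1 + algebraMap R _ W.a₁ * φ (W.coord 0) +
        algebraMap R _ W.a₃ * φ (W.coord 2) - (algebraMap R _ W.a₂ * φ (W.coord 0) ^ 2 +
        algebraMap R _ W.a₄ * φ (W.coord 0) * φ (W.coord 2) +
        algebraMap R _ W.a₆ * φ (W.coord 2) ^ 2)) * φ (W.coord 2) := by
      linear_combination -e
    rw [this]
    exact Ideal.mul_mem_left _ _ h2
  refine hz (W.fittingIdeal_eq_top_of_relation (i := 1) rfl rfl hφ (j := 2) (k := 0)
      (by decide) ?_ hrel)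
  -- The coefficient of dZ is 1 minus this element.
  have hsub : (algebraMap R _ W.a₂ * φ (W.coord 0) - algebraMap R _ W.a₁) * φ (W.coord 0) +
      (2 * algebraMap R _ W.a₄ * φ (W.coord 0) + 3 * algebraMap R _ W.a₆ * φ (W.coord 2) -
        2 * algebraMap R _ W.a₃) * φ (W.coord 2) ∈ maximalIdeal (W.model.presheaf.stalk z) :=
    add_mem (Ideal.mul_mem_left _ _ h0) (Ideal.mul_mem_left _ _ h2)
  have := isUnit_one_sub_self_of_mem_nonunits _ hsub
  convert this using 1
  ring

lemma mem_basicOpen_two_of_mem_singLocus (hz : z ∈ singLocus W.modelHom) :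
    z ∈ Proj.basicOpen W.grading (W.coord 2) := by
  rcases W.mem_basicOpen_or z with h1 | h2
  · let := W.stalkAlgebra z
    obtain ⟨φ, h, hφ⟩ := W.exists_pt_fromSpecStalk 1 h1
    have hu := W.isUnit_coord_two_of_mem_singLocus hz φ h hφ
    have h3 := W.mem_basicOpen_of_point (φ := φ.toRingHom) (W.coord_mem 2) one_pos hu
      (closedPoint (W.model.presheaf.stalk z))
    rw [← ProjPoint.point_congr (𝒜 := W.grading) φ.toRingHom (W.coord_mem 1) one_pos
      (by change IsUnit (φ _); simp [h]) (W.coord_mem 2) one_pos hu] at h3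
    have h4 := congrArg (fun m => m (closedPoint (W.model.presheaf.stalk z))) hφ
    simp only [Scheme.fromSpecStalk_closedPoint] at h4
    rw [h4]
    exact h3
  · exact h2

lemma exists_stalkHom {T : Type u} [CommRing T] [IsLocalRing T] [Algebra R T]
    (m : Spec (.of T) ⟶ W.model)
    (hm : m ≫ W.modelHom = Spec.map (CommRingCat.ofHom (algebraMap R T)))
    (hz : m (closedPoint T) = z) :
    letI := W.stalkAlgebra z
    ∃ g : W.model.presheaf.stalk z →ₐ[R] T, IsLocalHom g.toRingHom ∧
      Spec.map (CommRingCat.ofHom g.toRingHom) ≫ W.model.fromSpecStalk z = m := by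
  subst hz
  let := W.stalkAlgebra (m (closedPoint T))
  have h := Scheme.Spec_stalkClosedPointTo_fromSpecStalk (R := .of T) m
  refine ⟨{ (Scheme.stalkClosedPointTo (R := .of T) m).hom with commutes' := ?_ },
    Scheme.isLocalHom_stalkClosedPointTo' m, h⟩
  have h1 := congrArg (· ≫ W.modelHom) h
  simp only [Category.assoc, hm] at h1
  rw [← specMap_stalkStr, ← Spec.map_comp] at h1
  exact DFunLike.congr_fun (congrArg CommRingCat.Hom.hom (Spec.map_injective h1))

/-- The partial derivatives are nonunits in the local ring at the point, so the local homomorphism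
to the field K sends them to zero. -/
lemma exists_pt_of_mem_singLocus {K : Type u} [Field K] [Algebra R K]
    (m : Spec (.of K) ⟶ W.model)
    (hm : m ≫ W.modelHom = Spec.map (CommRingCat.ofHom (algebraMap R K)))
    (hz : m (closedPoint K) ∈ singLocus W.modelHom) :
    ∃ (φ : W.HomogCoordRing →ₐ[R] K) (h : φ (W.coord 2) = 1), m = W.pt φ 2 h ∧
      2 * φ (W.coord 1) + algebraMap R _ W.a₁ * φ (W.coord 0) + algebraMap R _ W.a₃ = 0 ∧
      algebraMap R _ W.a₁ * φ (W.coord 1) = 3 * φ (W.coord 0) ^ 2 +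
        2 * algebraMap R _ W.a₂ * φ (W.coord 0) + algebraMap R _ W.a₄ := by
  let := W.stalkAlgebra (m (closedPoint K))
  obtain ⟨φ, h, hφ⟩ := W.exists_pt_fromSpecStalk 2 (W.mem_basicOpen_two_of_mem_singLocus hz)
  obtain ⟨g, hg, hgm⟩ := W.exists_stalkHom m hm rfl
  obtain ⟨h1, h2⟩ := W.not_isUnit_partials_of_mem_singLocus hz φ h hφ
  have hzero : ∀ a, ¬ IsUnit a → g a = 0 := by
    intro a ha
    by_contra hne
    exact ha (hg.map_nonunit a (Ne.isUnit hne))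
  refine ⟨g.comp φ, by simp [h], ?_, ?_, ?_⟩
  · exact hgm.symm.trans ((congrArg _ hφ).trans (specMap_pt φ 2 h g))
  · have := hzero _ h1
    simp only [map_add, map_mul, AlgHom.commutes, map_ofNat] at this
    exact this
  · have := hzero _ h2
    simp only [map_add, map_sub, map_mul, map_pow, AlgHom.commutes, map_ofNat, sub_eq_zero] at this
    exact this

end SingularLocus

end WeierstrassCurve

/-! ### Points with vanishing partial derivatives are singular -/

namespace WeierstrassCurve

section SingularLocus

open IsLocalRing

variable {R : Type u} [CommRing R] (W : WeierstrassCurve R) {K : Type u} [Field K] [Algebra R K]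

/-- The tangent vector `(p, q)` at a point with vanishing partial derivatives. -/
lemma eqn_tangent {x y : K} (hv : W.Eqn ![x, y, 1])
    (hy : 2 * y + algebraMap R _ W.a₁ * x + algebraMap R _ W.a₃ = 0)
    (hx : algebraMap R _ W.a₁ * y = 3 * x ^ 2 + 2 * algebraMap R _ W.a₂ * x + algebraMap R _ W.a₄)
    (p q : K) :
    W.Eqn (A := TrivSqZeroExt K K) ![TrivSqZeroExt.inl x + TrivSqZeroExt.inr p,
      TrivSqZeroExt.inl y + TrivSqZeroExt.inr q, 1] := by
  have e : ∀ r : R, algebraMap R (TrivSqZeroExt K K) r = TrivSqZeroExt.inl (algebraMap R K r) :=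
    fun r => rfl
  simp only [Eqn, e, Matrix.cons_val_zero, Matrix.cons_val_one, Matrix.cons_val] at hv ⊢
  ext
  · simp
    linear_combination hv
  · simp [pow_succ]
    linear_combination q * hy + p * hx

lemma closedPoint_eq_of_specMap {X : Scheme.{u}} {A B : Type u} [CommRing A] [IsLocalRing A]
    [CommRing B] [IsLocalRing B] (f : A →+* B) [IsLocalHom f] {m : Spec (.of A) ⟶ X}
    {n : Spec (.of B) ⟶ X} (h : Spec.map (CommRingCat.ofHom f) ≫ m = n) :
    m (closedPoint A) = n (closedPoint B) := by
  subst h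
  exact congrArg m (IsLocalRing.comap_closedPoint f).symm

/-- Both partial derivatives vanish, so every (p, q) is a tangent vector, that is, a K[ε]-valued
point of E at z. The ε-part of the induced homomorphism on the local ring is a derivation with
values p and q on the coordinates. -/
lemma exists_linear_form_kaehlerDifferential {φ : W.HomogCoordRing →ₐ[R] K}
    (h : φ (W.coord 2) = 1)
    (hy : 2 * φ (W.coord 1) + algebraMap R _ W.a₁ * φ (W.coord 0) + algebraMap R _ W.a₃ = 0)
    (hx : algebraMap R _ W.a₁ * φ (W.coord 1) = 3 * φ (W.coord 0) ^ 2 +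
      2 * algebraMap R _ W.a₂ * φ (W.coord 0) + algebraMap R _ W.a₄)
    {z : W.model} (hz : W.pt φ 2 h (closedPoint K) = z)
    [alg : Algebra R (W.model.presheaf.stalk z)]
    (halg : algebraMap R (W.model.presheaf.stalk z) = W.stalkStr z)
    [algS : Algebra ((Spec (.of R)).presheaf.stalk (W.modelHom z)) (W.model.presheaf.stalk z)]
    (halgS : algebraMap ((Spec (.of R)).presheaf.stalk (W.modelHom z))
      (W.model.presheaf.stalk z) = (W.modelHom.stalkMap z).hom)
    {φ' : W.HomogCoordRing →ₐ[R] W.model.presheaf.stalk z} {h' : φ' (W.coord 2) = 1}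
    (hφ' : W.model.fromSpecStalk z = W.pt φ' 2 h')
    (g₀ : W.model.presheaf.stalk z →ₐ[R] K)
    (hg₀ : Spec.map (CommRingCat.ofHom g₀.toRingHom) ≫ W.model.fromSpecStalk z = W.pt φ 2 h)
    (p q : K) :
    ∃ l : KaehlerDifferential ((Spec (.of R)).presheaf.stalk (W.modelHom z))
        (W.model.presheaf.stalk z) →+ K,
      (∀ a m, l (a • m) = g₀ a * l m) ∧
      l (KaehlerDifferential.D _ _ (φ' (W.coord 0))) = p ∧
      l (KaehlerDifferential.D _ _ (φ' (W.coord 1))) = q := by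
  have hv : W.Eqn ![φ (W.coord 0), φ (W.coord 1), 1] := by
    have := W.eqn_algHom φ
    simp only [Eqn, h] at this
    simpa only [Eqn, Matrix.cons_val_zero, Matrix.cons_val_one, Matrix.cons_val] using this
  let ψ := W.coordHom _ (W.eqn_tangent hv hy hx p q)
  have hψ2 : ψ (W.coord 2) = 1 := by simp [ψ]
  let fst : TrivSqZeroExt K K →ₐ[R] K := TrivSqZeroExt.fstHom R K K
  have hfst : fst.comp ψ = φ := by
    apply algHom_ext
    intro i
    fin_cases i <;> simp [ψ, fst, h]
  have hm := specMap_pt ψ 2 hψ2 fst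
  have hm' : Spec.map (CommRingCat.ofHom fst.toRingHom) ≫ W.pt ψ 2 hψ2 = W.pt φ 2 h := by
    refine hm.trans ?_
    congr 1
  have : IsLocalHom fst.toRingHom := ⟨fun a ha => (TrivSqZeroExt.isUnit_iff_isUnit_fst).2 ha⟩
  have hz' : W.pt ψ 2 hψ2 (closedPoint (TrivSqZeroExt K K)) = z := by
    rw [← hz]
    exact closedPoint_eq_of_specMap fst.toRingHom hm'
  obtain ⟨g, hgm⟩ : ∃ g : W.model.presheaf.stalk z →ₐ[R] TrivSqZeroExt K K,
      Spec.map (CommRingCat.ofHom g.toRingHom) ≫ W.model.fromSpecStalk z = W.pt ψ 2 hψ2 := by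
    obtain rfl : alg = W.stalkAlgebra z :=
      Algebra.algebra_ext _ _ fun r => DFunLike.congr_fun halg r
    obtain ⟨g, -, hgm⟩ := W.exists_stalkHom (W.pt ψ 2 hψ2) (W.pt_modelHom _ _ _) hz'
    exact ⟨g, hgm⟩
  have hgφ : g.comp φ' = ψ := by
    apply W.pt_injective (i := 2) (hφ := by simp [h']) (hψ := hψ2)
    rw [← hgm, ← specMap_pt φ' 2 h' g, hφ']
  have hg1 : fst.comp g = g₀ := by
    have : CommRingCat.ofHom (fst.comp g).toRingHom = CommRingCat.ofHom g₀.toRingHom := by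
      apply stalk_hom_ext
      rw [hg₀, ← hm', ← hgm, ← Category.assoc, ← Spec.map_comp]
      rfl
    exact AlgHom.ext fun a => DFunLike.congr_fun (congrArg CommRingCat.Hom.hom this) a
  have hfst' (a) : (g a).fst = g₀ a := DFunLike.congr_fun hg1 a
  -- On the local ring of the base the ε-part vanishes, because g is R-linear. This makes the
  -- derivation linear over that local ring.
  have hS : g.toRingHom.comp (W.modelHom.stalkMap z).hom =
      (TrivSqZeroExt.inlHom K K).comp (g₀.toRingHom.comp (W.modelHom.stalkMap z).hom) := by
    apply stalk_hom_eq_of_comp_eq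
    rw [RingHom.comp_assoc, RingHom.comp_assoc, RingHom.comp_assoc, stalkMap_comp_toStalk, ← halg]
    ext r : 1
    exact (g.commutes r).trans (congrArg TrivSqZeroExt.inl (g₀.commutes r).symm)
  have hS' (s) : (g (algebraMap ((Spec (.of R)).presheaf.stalk (W.modelHom z)) _ s)).snd = 0 := by
    rw [halgS]
    exact congrArg TrivSqZeroExt.snd (DFunLike.congr_fun hS s)
  let : Module (W.model.presheaf.stalk z) K := Module.compHom K g₀.toRingHom
  let : Module ((Spec (.of R)).presheaf.stalk (W.modelHom z)) K :=
    Module.compHom K (algebraMap _ (W.model.presheaf.stalk z))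
  have : IsScalarTower ((Spec (.of R)).presheaf.stalk (W.modelHom z))
      (W.model.presheaf.stalk z) K := .of_algebraMap_smul fun _ _ => rfl
  have hsm (a : W.model.presheaf.stalk z) (b : K) : a • b = g₀ a * b := rfl
  have hsmS (s : (Spec (.of R)).presheaf.stalk (W.modelHom z)) (b : K) :
    s • b = g₀ (algebraMap _ _ s) * b := rfl
  let D : Derivation ((Spec (.of R)).presheaf.stalk (W.modelHom z))
      (W.model.presheaf.stalk z) K :=
    { toFun := fun a => (g a).snd
      map_add' := fun a b => by simp
      map_smul' := fun s a => by
        simp [Algebra.smul_def, hS', hfst', hsmS]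
      map_one_eq_zero' := by simp
      leibniz' := fun a b => by
        simp [hfst', hsm, mul_comm (g a).snd] }
  refine ⟨D.liftKaehlerDifferential.toAddMonoidHom, fun a m => ?_, ?_, ?_⟩
  · exact D.liftKaehlerDifferential.map_smul a m
  · have := D.liftKaehlerDifferential_comp_D (φ' (W.coord 0))
    refine this.trans ?_
    have h0 := DFunLike.congr_fun hgφ (W.coord 0)
    change (g (φ' (W.coord 0))).snd = p
    rw [AlgHom.comp_apply] at h0
    simp [h0, ψ]
  · have := D.liftKaehlerDifferential_comp_D (φ' (W.coord 1))
    refine this.trans ?_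
    have h0 := DFunLike.congr_fun hgφ (W.coord 1)
    change (g (φ' (W.coord 1))).snd = q
    rw [AlgHom.comp_apply] at h0
    simp [h0, ψ]

lemma mem_singLocus_of_partials_eq_zero {φ : W.HomogCoordRing →ₐ[R] K} (h : φ (W.coord 2) = 1)
    (hy : 2 * φ (W.coord 1) + algebraMap R _ W.a₁ * φ (W.coord 0) + algebraMap R _ W.a₃ = 0)
    (hx : algebraMap R _ W.a₁ * φ (W.coord 1) = 3 * φ (W.coord 0) ^ 2 +
      2 * algebraMap R _ W.a₂ * φ (W.coord 0) + algebraMap R _ W.a₄) :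
    W.pt φ 2 h (closedPoint K) ∈ singLocus W.modelHom := by
  intro hF
  obtain ⟨z, hz⟩ : ∃ z, W.pt φ 2 h (closedPoint K) = z := ⟨_, rfl⟩
  rw [hz] at hF
  let := W.stalkAlgebra z
  let : Algebra ((Spec (.of R)).presheaf.stalk (W.modelHom z)) (W.model.presheaf.stalk z) :=
    (W.modelHom.stalkMap z).hom.toAlgebra
  obtain ⟨w, hw⟩ := exists_span_eq_top_of_fittingIdeal_one_eq_top hF
  have hz2 : z ∈ Proj.basicOpen W.grading (W.coord 2) := by
    rw [← hz]
    exact W.mem_basicOpen_of_point (φ := φ.toRingHom) (W.coord_mem 2) one_pos _ _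
  obtain ⟨φ', h', hφ'⟩ := W.exists_pt_fromSpecStalk 2 hz2
  obtain ⟨g₀, -, hg₀⟩ := W.exists_stalkHom (W.pt φ 2 h) (W.pt_modelHom _ _ _) hz
  have key := W.exists_linear_form_kaehlerDifferential h hy hx hz rfl rfl hφ' g₀ hg₀
  have hmem (m) : ∃ a : W.model.presheaf.stalk z, a • w = m :=
    Submodule.mem_span_singleton.1 (hw ▸ Submodule.mem_top)
  obtain ⟨a, ha⟩ := hmem (KaehlerDifferential.D _ _ (φ' (W.coord 0)))
  obtain ⟨b, hb⟩ := hmem (KaehlerDifferential.D _ _ (φ' (W.coord 1)))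
  obtain ⟨l, hl, hl0, hl1⟩ := key 1 0
  obtain ⟨l', hl', hl0', hl1'⟩ := key 0 1
  rw [← ha, hl] at hl0
  rw [← hb, hl] at hl1
  rw [← hb, hl'] at hl1'
  have h1 : l w ≠ 0 := fun e => by simp [e] at hl0
  have h2 : g₀ b ≠ 0 := fun e => by simp [e] at hl1'
  exact mul_ne_zero h2 h1 hl1

end SingularLocus

end WeierstrassCurve

/-! ### Coordinates in a free algebra and base change -/

section CoordIdeal

variable {ι : Type*} {P B P' B' : Type*} [CommRing P] [CommRing B] [CommRing P'] [CommRing B']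

/-- The linear combination of a family in an algebra. -/
def expansion (f : P →+* B) (e : ι → B) (c : ι →₀ P) : B := c.sum fun i p => f p * e i

lemma map_expansion {f : P →+* B} {e : ι → B} {f' : P' →+* B'} {g : P →+* P'} {k : B →+* B'}
    (hk : k.comp f = f'.comp g) (c : ι →₀ P) :
    k (expansion f e c) = expansion f' (fun i => k (e i)) (c.mapRange g (map_zero g)) := by
  rw [expansion, expansion, Finsupp.sum_mapRange_index (by simp), Finsupp.sum, map_sum,
    Finsupp.sum]
  refine Finset.sum_congr rfl fun i _ => ?_
  rw [map_mul]
  exact congrArg (· * _) (DFunLike.congr_fun hk _)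

/-- The ideal generated by the coordinates of the elements of an ideal. -/
def coordIdeal (f : P →+* B) (e : ι → B) (J : Ideal B) : Ideal P :=
  Ideal.span {p | ∃ c : ι →₀ P, expansion f e c ∈ J ∧ ∃ i, c i = p}

lemma le_map_coordIdeal {f : P →+* B} {e : ι → B} (h : Function.Surjective (expansion f e))
    (J : Ideal B) : J ≤ (coordIdeal f e J).map f := by
  intro x hx
  obtain ⟨c, rfl⟩ := h x
  refine sum_mem fun i _ => Ideal.mul_mem_right _ _ (Ideal.mem_map_of_mem _ ?_)
  exact Ideal.subset_span ⟨c, hx, i, rfl⟩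

/-- Together with `le_map_coordIdeal`, this identifies the coordinate ideal as the least ideal of P
whose extension to B contains J. -/
lemma coordIdeal_le {f : P →+* B} {e : ι → B} (h : Function.Bijective (expansion f e))
    {J : Ideal B} {a : Ideal P} (hJ : J ≤ a.map f) : coordIdeal f e J ≤ a := by
  rw [coordIdeal, Ideal.span_le]
  rintro _ ⟨c, hc, i, rfl⟩
  -- Elements of the extended ideal have coordinates in a. For a generator f(p), these are p times
  -- the coordinates of 1.
  have key : ∀ x ∈ a.map f, ∃ d : ι →₀ P, expansion f e d = x ∧ ∀ i, d i ∈ a := by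
    intro x hx
    refine Submodule.span_induction ?_ ?_ ?_ ?_ hx
    · rintro _ ⟨p, hp, rfl⟩
      obtain ⟨d, hd⟩ := h.2 1
      refine ⟨p • d, ?_, fun i => a.mul_mem_right _ hp⟩
      rw [expansion, Finsupp.sum_smul_index (by simp)]
      simp only [map_mul, mul_assoc]
      rw [← Finsupp.mul_sum]
      change f p * expansion f e d = _
      rw [hd, mul_one]
    · exact ⟨0, by simp [expansion], fun i => a.zero_mem⟩
    · rintro x y - - ⟨d, rfl, hd⟩ ⟨d', rfl, hd'⟩
      refine ⟨d + d', ?_, fun i => a.add_mem (hd i) (hd' i)⟩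
      exact Finsupp.sum_add_index' (by simp) (by simp [add_mul])
    · rintro y x - ⟨d, rfl, hd⟩
      choose m hm using fun i => h.2 (y * e i)
      refine ⟨d.sum fun i p => p • m i, ?_, fun i => ?_⟩
      · have hadd : ∀ c c', expansion f e (c + c') = expansion f e c + expansion f e c' :=
          fun c c' => Finsupp.sum_add_index' (by simp) (by simp [add_mul])
        let E : (ι →₀ P) →+ B := ⟨⟨expansion f e, by simp [expansion]⟩, hadd⟩
        change E _ = _
        rw [map_finsuppSum, expansion, smul_eq_mul, Finsupp.mul_sum]
        refine Finsupp.sum_congr fun i _ => ?_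
        change expansion f e _ = _
        rw [expansion, Finsupp.sum_smul_index (by simp)]
        simp only [map_mul, mul_assoc]
        rw [← Finsupp.mul_sum]
        change f _ * expansion f e (m i) = _
        rw [hm]
        ring
      · rw [Finsupp.sum, Finsupp.finsetSum_apply]
        exact sum_mem fun j _ => a.mul_mem_right _ (hd j)
  obtain ⟨d, hd, hda⟩ := key _ (hJ hc)
  rw [← h.1 hd]
  exact hda i

lemma map_coordIdeal_le {f : P →+* B} {e : ι → B} {f' : P' →+* B'} {g : P →+* P'}
    {k : B →+* B'} {e' : ι → B'} (hk : k.comp f = f'.comp g) (he : ∀ i, k (e i) = e' i)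
    (J : Ideal B) : (coordIdeal f e J).map g ≤ coordIdeal f' e' (J.map k) := by
  obtain rfl : (fun i => k (e i)) = e' := funext he
  rw [coordIdeal, Ideal.map_span, Ideal.span_le]
  rintro _ ⟨_, ⟨c, hc, i, rfl⟩, rfl⟩
  refine Ideal.subset_span ⟨_, ?_, i, Finsupp.mapRange_apply (hf := map_zero g)⟩
  rw [← map_expansion hk]
  exact Ideal.mem_map_of_mem _ hc

/-- Both inclusions follow from the minimality of coordinate ideals. Applied to localizations, this
makes the local ideals glue to an ideal sheaf. -/
lemma map_coordIdeal {f : P →+* B} {e : ι → B} {f' : P' →+* B'} {g : P →+* P'}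
    {k : B →+* B'} {e' : ι → B'} (hk : k.comp f = f'.comp g) (he : ∀ i, k (e i) = e' i)
    (h : Function.Surjective (expansion f e)) (h' : Function.Bijective (expansion f' e'))
    (J : Ideal B) : (coordIdeal f e J).map g = coordIdeal f' e' (J.map k) := by
  refine (map_coordIdeal_le hk he J).antisymm (coordIdeal_le h' ?_)
  rw [Ideal.map_map, ← hk, ← Ideal.map_map]
  exact Ideal.map_mono (le_map_coordIdeal h J)

lemma bijective_expansion_of_isPushout {R A P B : Type u} [CommRing R] [CommRing A] [CommRing P]
    [CommRing B] [Algebra R A] (b : Module.Basis ι R A) {g : R →+* P} {k : A →+* B} {l : P →+* B}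
    (h : IsPushout (CommRingCat.ofHom (algebraMap R A)) (CommRingCat.ofHom g)
      (CommRingCat.ofHom k) (CommRingCat.ofHom l)) :
    Function.Bijective (expansion l fun i => k (b i)) := by
  algebraize [g, k, l, l.comp g]
  have : IsScalarTower R A B := .of_algebraMap_eq' (congrArg CommRingCat.Hom.hom h.w).symm
  have := (CommRingCat.isPushout_iff_isPushout (R := R) (S := A) (R' := P) (S' := B)).1 h.flip
  have hb : IsBaseChange P (IsScalarTower.toAlgHom R A B).toLinearMap := this.out
  let b' := hb.basis b
  have e : expansion l (fun i => k (b i)) = b'.repr.symm := by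
    funext c
    rw [Module.Basis.repr_symm_apply, Finsupp.linearCombination_apply, expansion]
    refine Finsupp.sum_congr fun i _ => ?_
    rw [hb.basis_apply, Algebra.smul_def]
    rfl
  rw [e]
  exact b'.repr.symm.bijective

end CoordIdeal

/-! ### Weil restriction of closed subschemes along finite free morphisms -/

namespace AlgebraicGeometry

section WeilRestriction

variable {R A : Type u} [CommRing R] [CommRing A] [Algebra R A]
  {T Y : Scheme.{u}} {π : Y ⟶ T} {ρ : Y ⟶ Spec (.of A)} {t : T ⟶ Spec (.of R)}
  (h : IsPullback π ρ t (Spec.map (CommRingCat.ofHom (algebraMap R A))))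

/-- The functions on an open subscheme induced by a morphism to an affine scheme. -/
def pullbackRingHom (ρ : Y ⟶ Spec (.of A)) (U : Y.Opens) : A →+* Γ(Y, U) :=
  (Y.presheaf.map (homOfLE le_top).op).hom.comp
    (ρ.appTop.hom.comp (Scheme.ΓSpecIso (.of A)).inv.hom)

lemma map_comp_pullbackRingHom (ρ : Y ⟶ Spec (.of A)) {U V : Y.Opens} (i : Opposite.op V ⟶ .op U) :
    (Y.presheaf.map i).hom.comp (pullbackRingHom ρ V) = pullbackRingHom ρ U := by
  rw [pullbackRingHom, ← RingHom.comp_assoc, ← CommRingCat.hom_comp, ← Functor.map_comp]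
  rfl

lemma app_comp_pullbackRingHom {Y' : Scheme.{u}} (q : Y' ⟶ Y) (ρ : Y ⟶ Spec (.of A))
    (U : Y.Opens) :
    (q.app U).hom.comp (pullbackRingHom ρ U) = pullbackRingHom (q ≫ ρ) (q ⁻¹ᵁ U) := by
  rw [pullbackRingHom, pullbackRingHom, ← RingHom.comp_assoc, ← CommRingCat.hom_comp,
    q.naturality, Scheme.Hom.comp_appTop]
  rfl

include h in
-- Over an affine open V, the ring of functions on the preimage is Γ(T, V) ⊗ A, so the basis b stays
-- a basis.
lemma bijective_expansion {ι : Type*} (b : Module.Basis ι R A) {V : T.Opens}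
    (hV : IsAffineOpen V) :
    Function.Bijective (expansion (π.app V).hom fun i => pullbackRingHom ρ (π ⁻¹ᵁ V) (b i)) := by
  have : IsAffine V := hV
  have h2 := isPushout_appTop_of_isPullback
    ((isPullback_morphismRestrict π V).flip.paste_horiz h.flip)
  refine bijective_expansion_of_isPushout b
    (g := ((Scheme.ΓSpecIso (.of R)).inv ≫ (V.ι ≫ t).appTop ≫ V.topIso.hom).hom) ?_
  refine h2.of_iso (Scheme.ΓSpecIso (.of R)) (Scheme.ΓSpecIso (.of A)) V.topIso
    (π ⁻¹ᵁ V).topIso ?_ ?_ ?_ ?_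
  · exact Scheme.ΓSpecIso_naturality _
  · rw [CommRingCat.ofHom_hom, Iso.hom_inv_id_assoc]
  · rw [Scheme.Hom.comp_appTop, Category.assoc, Scheme.Opens.ι_appTop, Scheme.Opens.topIso_hom]
    refine (congrArg (ρ.appTop ≫ ·) (Y.presheaf.map_comp _ _).symm).trans ?_
    have : CommRingCat.ofHom (pullbackRingHom ρ (π ⁻¹ᵁ V)) = (Scheme.ΓSpecIso (.of A)).inv ≫
      ρ.appTop ≫ Y.presheaf.map (homOfLE le_top).op := rfl
    rw [this, Iso.hom_inv_id_assoc]
    rfl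
  · rw [CommRingCat.ofHom_hom, morphismRestrict_appTop, Scheme.Opens.topIso_hom,
      Scheme.Opens.topIso_hom]
    refine (Category.assoc _ _ _).trans
      ((congrArg (π.app _ ≫ ·) (Y.presheaf.map_comp _ _).symm).trans ?_)
    exact (π.naturality _).symm

/-- The ideal sheaf of the Weil restriction of a closed subscheme. -/
def weilIdeal (h : IsPullback π ρ t (Spec.map (CommRingCat.ofHom (algebraMap R A))))
    {ι : Type*} (b : Module.Basis ι R A) [IsAffineHom π] (J : Y.IdealSheafData) :
    T.IdealSheafData where
  ideal V := coordIdeal (π.app V).hom (fun i => pullbackRingHom ρ (π ⁻¹ᵁ V) (b i))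
    (J.ideal ⟨π ⁻¹ᵁ V, V.2.preimage π⟩)
  map_ideal_basicOpen U f := by
    have hk := congrArg CommRingCat.Hom.hom
      (π.naturality (homOfLE (T.basicOpen_le f)).op).symm
    refine (map_coordIdeal (J := J.ideal ⟨π ⁻¹ᵁ U, U.2.preimage π⟩)
      (e' := fun i => pullbackRingHom ρ (π ⁻¹ᵁ T.basicOpen f) (b i)) hk
      (fun i => DFunLike.congr_fun (map_comp_pullbackRingHom ρ _) (b i))
      (bijective_expansion h b U.2).2
      (bijective_expansion h b (T.affineBasicOpen f).2)).trans (congrArg (coordIdeal _ _) ?_)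
    exact J.map_ideal' (U := ⟨_, (T.affineBasicOpen f).2.preimage π⟩)
      (V := ⟨_, U.2.preimage π⟩) _

lemma weilIdeal_ideal {ι : Type*} (b : Module.Basis ι R A) [IsAffineHom π] (J : Y.IdealSheafData)
    (V : T.affineOpens) : (weilIdeal h b J).ideal V =
      coordIdeal (π.app V).hom (fun i => pullbackRingHom ρ (π ⁻¹ᵁ V) (b i))
        (J.ideal ⟨π ⁻¹ᵁ V, V.2.preimage π⟩) := rfl

/-- First half of the universal property: if the base change q of m factors through the closed
subscheme of J, then m factors through the Weil restriction. -/
lemma weilIdeal_le_ker {ι : Type*} (b : Module.Basis ι R A) [IsAffineHom π]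
    (J : Y.IdealSheafData) {T' Y' : Scheme.{u}} {π' : Y' ⟶ T'} {q : Y' ⟶ Y} {m : T' ⟶ T}
    (hq : IsPullback q π' π m) (hJ : J ≤ q.ker) : weilIdeal h b J ≤ m.ker := by
  rw [Scheme.Hom.ker, Scheme.IdealSheafData.le_ofIdeals_iff]
  intro V p hp
  rw [RingHom.mem_ker]
  refine TopCat.Presheaf.section_ext T'.sheaf _ _ _ fun x hx => ?_
  obtain ⟨_, ⟨V', hV', rfl⟩, hxV', hle⟩ :=
    T'.isBasis_affineOpens.exists_subset_of_mem_open hx (m ⁻¹ᵁ V.1).2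
  have hle' : V' ≤ m ⁻¹ᵁ V.1 := hle
  have hle'' : π' ⁻¹ᵁ V' ≤ q ⁻¹ᵁ π ⁻¹ᵁ V.1 := by
    rw [← Scheme.Hom.comp_preimage, hq.w, Scheme.Hom.comp_preimage]
    exact π'.preimage_mono hle'
  have hk : (q.appLE (π ⁻¹ᵁ V.1) (π' ⁻¹ᵁ V') hle'').hom.comp (π.app V.1).hom =
      (π'.app V').hom.comp (m.appLE V.1 V' hle').hom := by
    rw [← CommRingCat.hom_comp, ← CommRingCat.hom_comp]
    congr 1
    rw [← Scheme.Hom.appLE_eq_app, ← Scheme.Hom.appLE_eq_app, Scheme.Hom.appLE_comp_appLE,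
      Scheme.Hom.appLE_comp_appLE]
    simp only [hq.w]
  have hb := bijective_expansion (hq.paste_horiz h.flip).flip b hV'
  have he (i) : (q.appLE (π ⁻¹ᵁ V.1) (π' ⁻¹ᵁ V') hle'').hom (pullbackRingHom ρ (π ⁻¹ᵁ V.1) (b i)) =
      pullbackRingHom (q ≫ ρ) (π' ⁻¹ᵁ V') (b i) := by
    have h1 := DFunLike.congr_fun (app_comp_pullbackRingHom q ρ (π ⁻¹ᵁ V.1)) (b i)
    have h2 := DFunLike.congr_fun (map_comp_pullbackRingHom (q ≫ ρ) (homOfLE hle'').op) (b i)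
    rw [← h2, RingHom.comp_apply, ← h1]
    rfl
  -- Over V' the ideal J extends to zero, and an element that is zero has zero coordinates because
  -- the pulled back family is still a basis.
  have hzero : (m.appLE V.1 V' hle').hom p = 0 := by
    have h1 := map_coordIdeal_le hk he (J.ideal ⟨π ⁻¹ᵁ V.1, V.2.preimage π⟩)
      (Ideal.mem_map_of_mem _ hp)
    have h2 : coordIdeal (π'.app V').hom (fun i => pullbackRingHom (q ≫ ρ) (π' ⁻¹ᵁ V') (b i))
        ((J.ideal ⟨π ⁻¹ᵁ V.1, V.2.preimage π⟩).map
          (q.appLE (π ⁻¹ᵁ V.1) (π' ⁻¹ᵁ V') hle'').hom) ≤ ⊥ := by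
      refine coordIdeal_le hb ?_
      rw [Ideal.map_bot, Ideal.map_le_iff_le_comap]
      intro y hy
      have h3 := q.ideal_ker_le _ (hJ ⟨π ⁻¹ᵁ V.1, V.2.preimage π⟩ hy)
      rw [RingHom.mem_ker] at h3
      change (Y'.presheaf.map _).hom ((q.app (π ⁻¹ᵁ V.1)).hom y) = 0
      rw [h3, map_zero]
    exact h2 h1
  have h3 : T'.presheaf.map (homOfLE hle').op ((m.app V.1).hom p) = 0 := hzero
  have h4 := T'.presheaf.germ_res_apply (homOfLE hle') x hxV' ((m.app V.1).hom p)
  refine h4.symm.trans ?_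
  rw [h3, map_zero]
  exact (map_zero _).symm

/-- Second half: J lies in the extension of its coordinate ideal, so it vanishes wherever the
coordinates vanish. A commutative square suffices. -/
lemma le_ker_of_weilIdeal_le_ker {ι : Type*} (b : Module.Basis ι R A) [IsAffineHom π]
    (J : Y.IdealSheafData) {T' Y' : Scheme.{u}} {π' : Y' ⟶ T'} {q : Y' ⟶ Y} {m : T' ⟶ T}
    [QuasiCompact q] (hq : q ≫ π = π' ≫ m) (hm : weilIdeal h b J ≤ m.ker) : J ≤ q.ker := by
  have : ⨆ V : T.affineOpens, π ⁻¹ᵁ V.1 = ⊤ := by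
    rw [← Scheme.Hom.preimage_iSup, iSup_affineOpens_eq_top]
    rfl
  refine Scheme.IdealSheafData.le_of_iSup_eq_top
    (fun V : T.affineOpens => ⟨π ⁻¹ᵁ V, V.2.preimage π⟩) this fun V => ?_
  rw [q.ker_apply]
  refine (le_map_coordIdeal (bijective_expansion h b V.2).2 _).trans ?_
  rw [Ideal.map_le_iff_le_comap, ← weilIdeal_ideal h b J]
  refine (hm V).trans ((m.ideal_ker_le V).trans ?_)
  intro x hx
  rw [RingHom.mem_ker] at hx
  have hle : q ⁻¹ᵁ π ⁻¹ᵁ V.1 ≤ π' ⁻¹ᵁ m ⁻¹ᵁ V.1 := by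
    rw [← Scheme.Hom.comp_preimage, hq, Scheme.Hom.comp_preimage]
  have hk : π.app V.1 ≫ q.app (π ⁻¹ᵁ V.1) = m.app V.1 ≫ π'.appLE _ _ hle := by
    rw [← Scheme.Hom.appLE_eq_app, ← Scheme.Hom.appLE_eq_app, ← Scheme.Hom.appLE_eq_app,
      Scheme.Hom.appLE_comp_appLE, Scheme.Hom.appLE_comp_appLE]
    simp only [hq]
  have h1 := DFunLike.congr_fun (congrArg CommRingCat.Hom.hom hk) x
  rw [CommRingCat.hom_comp, CommRingCat.hom_comp, RingHom.comp_apply, RingHom.comp_apply, hx,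
    map_zero] at h1
  exact h1

end WeilRestriction

end AlgebraicGeometry

/-! ### The closed locus where two morphisms to a separated scheme agree -/

section Equalizer

variable {S X Y Y' : Scheme.{u}} {f : X ⟶ S} [IsSeparated f] {u v : Y ⟶ X} (h : u ≫ f = v ≫ f)

/-- The ideal sheaf of the closed subscheme on which two morphisms over a base agree. -/
def equalizerIdeal : Y.IdealSheafData :=
  (equalizer.ι (C := Over S) (X := Over.mk (u ≫ f)) (Y := Over.mk f) (Over.homMk u)
    (Over.homMk v h.symm)).left.ker

/-- By separatedness the equalizer is a closed immersion, so factoring through it is an inclusion of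
ideals. -/
lemma comp_eq_iff_equalizerIdeal_le_ker (q : Y' ⟶ Y) :
    q ≫ u = q ≫ v ↔ equalizerIdeal h ≤ q.ker := by
  have : IsSeparated (Over.mk f).hom := ‹IsSeparated f›
  constructor
  · intro hq
    let u' : Over.mk (u ≫ f) ⟶ Over.mk f := Over.homMk u
    let v' : Over.mk (u ≫ f) ⟶ Over.mk f := Over.homMk v h.symm
    let q' : Over.mk (q ≫ u ≫ f) ⟶ Over.mk (u ≫ f) := Over.homMk q
    have hq' : q' ≫ u' = q' ≫ v' := Over.OverMorphism.ext hq
    have hl' : Over.Hom.left (equalizer.lift q' hq') ≫ Over.Hom.left (equalizer.ι u' v') = q :=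
      congrArg Over.Hom.left (equalizer.lift_ι q' hq')
    rw [← hl']
    exact Scheme.Hom.le_ker_comp _ _
  · intro hq
    have hc : Over.Hom.left (equalizer.ι (C := Over S) (X := Over.mk (u ≫ f)) (Y := Over.mk f)
        (Over.homMk u) (Over.homMk v h.symm)) ≫ u = Over.Hom.left (equalizer.ι (C := Over S)
        (X := Over.mk (u ≫ f)) (Y := Over.mk f) (Over.homMk u) (Over.homMk v h.symm)) ≫ v :=
      congrArg Over.Hom.left (equalizer.condition (C := Over S)
        (X := Over.mk (u ≫ f)) (Y := Over.mk f) (Over.homMk u) (Over.homMk v h.symm))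
    rw [← IsClosedImmersion.lift_fac _ q hq, Category.assoc, Category.assoc]
    exact congrArg _ hc

end Equalizer

/-! ### Automorphisms fixing a point with values in a free algebra -/

section FixingFamily

variable {R A : Type u} [CommRing R] [CommRing A] [Algebra R A] {X : Scheme.{u}}

section Translate

variable {S Y T T' : Scheme.{u}} {f : X ⟶ S} {s : Y ⟶ S} {t : T ⟶ S}

/-- The translate of a point `a : Y ⟶ X`, after base change to `T`, by an automorphism. -/
def RelAut.translate (g : RelAut f t) (a : Y ⟶ X) (ha : a ≫ f = s) : pullback s t ⟶ X :=
  pullback.lift (pullback.fst s t ≫ a) (pullback.snd s t)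
    (by rw [Category.assoc, ha, pullback.condition]) ≫ g.iso.hom ≫ pullback.fst f t

lemma RelAut.translate_comp (g : RelAut f t) (a : Y ⟶ X) (ha : a ≫ f = s) :
    g.translate a ha ≫ f = (pullback.fst s t ≫ a) ≫ f := by
  rw [translate, Category.assoc, Category.assoc, pullback.condition, reassoc_of% g.hom_snd,
    pullback.lift_snd_assoc, Category.assoc, ha, pullback.condition]

lemma RelAut.translate_baseChange (g : RelAut f t) (a : Y ⟶ X) (ha : a ≫ f = s) (h : T' ⟶ T) :
    (g.baseChange h).translate a ha = RelAut.proj s t h ≫ g.translate a ha := by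
  have e : pullback.lift (pullback.fst s (h ≫ t) ≫ a) (pullback.snd s (h ≫ t))
      (by rw [Category.assoc, ha, pullback.condition]) ≫ proj f t h =
      proj s t h ≫ pullback.lift (pullback.fst s t ≫ a) (pullback.snd s t)
      (by rw [Category.assoc, ha, pullback.condition]) := by
    apply pullback.hom_ext
    · refine (Category.assoc _ _ _).trans ((congrArg _ (proj_fst h)).trans ?_)
      refine (pullback.lift_fst _ _ _).trans (Eq.trans ?_ (Category.assoc _ _ _).symm)
      refine Eq.trans ?_ (congrArg _ (pullback.lift_fst _ _ _)).symm
      rw [← Category.assoc, proj_fst]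
    · refine (Category.assoc _ _ _).trans ((congrArg _ (proj_snd h)).trans ?_)
      refine (pullback.lift_snd_assoc _ _ _ _).trans (Eq.trans ?_ (Category.assoc _ _ _).symm)
      exact (proj_snd h).symm.trans (congrArg _ (pullback.lift_snd _ _ _)).symm
  rw [translate, translate, baseChange, baseChangeHom_fst, reassoc_of% e]

lemma isPullback_proj (s : Y ⟶ S) (t : T ⟶ S) (h : T' ⟶ T) :
    IsPullback (RelAut.proj s t h) (pullback.snd s (h ≫ t)) (pullback.snd s t) h := by
  refine IsPullback.of_right (h₁₂ := pullback.fst s t) (v₁₃ := s) (h₂₂ := t) ?_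
    (RelAut.proj_snd h) (IsPullback.of_hasPullback s t)
  rw [RelAut.proj_fst]
  exact IsPullback.of_hasPullback s (h ≫ t)

end Translate

/-- The automorphisms of a family of schemes that fix a given point with values in a scheme over
the base. -/
def fixingFamily {S Y : Scheme.{u}} (f : X ⟶ S) (a : Y ⟶ X) : AutSubfamily f :=
  fun _ t => {g | g.translate a rfl = pullback.fst (a ≫ f) t ≫ a}

lemma mem_fixingFamily {S Y T : Scheme.{u}} {f : X ⟶ S} {a : Y ⟶ X} {s : Y ⟶ S} (ha : a ≫ f = s)
    {t : T ⟶ S} {g : RelAut f t} :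
    g ∈ fixingFamily f a t ↔ g.translate a ha = pullback.fst s t ≫ a := by
  subst ha
  rfl

/-- The restriction of g to T' fixes a precisely when Spec A × T' maps into the closed locus of Spec
A × T on which a and its translate agree. The Weil restriction of that locus to T is the closed
subscheme sought. -/
theorem isClosed_fixingFamily {f : X ⟶ Spec (.of R)} [IsSeparated f] [Module.Free R A]
    {a : Spec (.of A) ⟶ X} (ha : a ≫ f = Spec.map (CommRingCat.ofHom (algebraMap R A))) :
    (fixingFamily f a).IsClosed := by
  intro T t g
  obtain ⟨s, hs⟩ : ∃ s, s = Spec.map (CommRingCat.ofHom (algebraMap R A)) := ⟨_, rfl⟩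
  rw [← hs] at ha
  have huv := g.translate_comp a ha
  have hP : IsPullback (pullback.snd s t) (pullback.fst s t) t
      (Spec.map (CommRingCat.ofHom (algebraMap R A))) :=
    hs ▸ (IsPullback.of_hasPullback s t).flip
  have : IsAffineHom s := hs ▸ inferInstance
  have : IsAffineHom (pullback.snd s t) := 
    MorphismProperty.of_isPullback (P := @IsAffineHom) (IsPullback.of_hasPullback s t) ‹_›
  let I := weilIdeal hP (Module.Free.chooseBasis R A) (equalizerIdeal huv)
  refine ⟨I.subscheme, I.subschemeι, inferInstance, fun T' h => ?_⟩
  have key {T' : Scheme.{u}} (h : T' ⟶ T) := isPullback_proj s t h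
  rw [mem_fixingFamily ha, g.translate_baseChange a ha, ← RelAut.proj_fst, Category.assoc,
    comp_eq_iff_equalizerIdeal_le_ker huv]
  constructor
  · intro hJ
    have hI : I ≤ h.ker := weilIdeal_le_ker hP (Module.Free.chooseBasis R A)
      (equalizerIdeal huv) (key h) hJ
    have hI' : I.subschemeι.ker ≤ h.ker := by rwa [Scheme.IdealSheafData.ker_subschemeι]
    exact ⟨IsClosedImmersion.lift _ h hI', IsClosedImmersion.lift_fac _ _ _⟩
  · rintro ⟨h₀, rfl⟩
    have : IsClosedImmersion (RelAut.proj s t I.subschemeι) :=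
      MorphismProperty.of_isPullback (key I.subschemeι).flip inferInstance
    have h1 := le_ker_of_weilIdeal_le_ker hP (Module.Free.chooseBasis R A)
      (equalizerIdeal huv) (key I.subschemeι).w (Scheme.IdealSheafData.ker_subschemeι I).ge
    refine h1.trans ?_
    have h2 : RelAut.proj s t (h₀ ≫ I.subschemeι) =
        pullback.lift (pullback.fst _ _) (pullback.snd _ _ ≫ h₀)
          (by rw [pullback.condition, Category.assoc, Category.assoc]) ≫
          RelAut.proj s t I.subschemeι := by
      apply pullback.hom_ext
      · exact (RelAut.proj_fst _).trans ((Category.assoc _ _ _).trans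
          ((congrArg _ (RelAut.proj_fst _)).trans (pullback.lift_fst _ _ _))).symm
      · exact ((RelAut.proj_snd _).trans (Category.assoc _ _ _).symm).trans
          ((Category.assoc _ _ _).trans ((congrArg _ (RelAut.proj_snd _)).trans
            (pullback.lift_snd_assoc _ _ _ _))).symm
    rw [h2]
    exact Scheme.Hom.le_ker_comp _ _

end FixingFamily

/-! ### Points fixed by the effective model of the sign involution -/

lemma RelAut.act_comp_of_mem_fixingFamily {S X Y T : Scheme.{u}} {f : X ⟶ S} {a : Y ⟶ X}
    {t : T ⟶ S} {g : RelAut f t} (hg : g ∈ fixingFamily f a t) {x : T ⟶ X} (hx : x ≫ f = t)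
    {b : T ⟶ Y} (hb : x = b ≫ a) : g.act x hx = x := by
  subst hb
  have h1 : pullback.lift (b ≫ a) (𝟙 T) (by rw [hx, Category.id_comp]) =
      pullback.lift b (𝟙 T) (by rw [Category.id_comp, ← hx, Category.assoc]) ≫
        pullback.lift (pullback.fst (a ≫ f) t ≫ a) (pullback.snd (a ≫ f) t)
          (by rw [Category.assoc, pullback.condition]) := by
    apply pullback.hom_ext
    · refine (pullback.lift_fst _ _ _).trans (Eq.trans ?_ (Category.assoc _ _ _).symm)
      exact ((congrArg _ (pullback.lift_fst _ _ _)).trans (pullback.lift_fst_assoc _ _ _ _)).symm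
    · refine (pullback.lift_snd _ _ _).trans (Eq.trans ?_ (Category.assoc _ _ _).symm)
      exact ((congrArg _ (pullback.lift_snd _ _ _)).trans (pullback.lift_snd _ _ _)).symm
  have h2 : g.translate a rfl = pullback.fst (a ≫ f) t ≫ a := hg
  rw [RelAut.translate] at h2
  rw [RelAut.act, h1, Category.assoc, h2, pullback.lift_fst_assoc]

lemma RelAut.refl_mem_fixingFamily {S X Y T : Scheme.{u}} (f : X ⟶ S) (a : Y ⟶ X) (t : T ⟶ S) :
    RelAut.refl f t ∈ fixingFamily f a t := by
  refine (congrArg _ (Category.id_comp _)).trans ?_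
  exact pullback.lift_fst _ _ _

lemma RelAut.ofIso_mem_fixingFamily {S X Y T : Scheme.{u}} {f : X ⟶ S} {e : X ≅ X}
    (he : e.hom ≫ f = f) {a : Y ⟶ X} (ha : a ≫ e.hom = a) (t : T ⟶ S) :
    RelAut.ofIso e he t ∈ fixingFamily f a t := by
  have h1 : (RelAut.ofIso e he t).iso.hom ≫ pullback.fst f t = pullback.fst f t ≫ e.hom :=
    pullback.lift_fst _ _ _
  refine (congrArg _ h1).trans ?_
  rw [pullback.lift_fst_assoc, Category.assoc, ha]

namespace WeierstrassCurve

instance isSeparated_modelHom {R : Type u} [CommRing R] (W : WeierstrassCurve R) :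
    IsSeparated W.modelHom := by
  unfold modelHom
  infer_instance

section

variable {R A : Type u} [CommRing R] [CommRing A] [Algebra R A] (W : WeierstrassCurve R)

lemma signRingHom_coord_zero : W.signRingHom (W.coord 0) = W.coord 0 := by
  change Ideal.Quotient.mk _ (W.signPoly _) = _
  simp [signPoly]
  rfl

lemma signRingHom_coord_one : W.signRingHom (W.coord 1) =
    -(W.coord 1 + W.a₁ • W.coord 0 + W.a₃ • W.coord 2) := by
  change Ideal.Quotient.mk _ (W.signPoly _) = _
  simp [signPoly, ← MvPolynomial.smul_eq_C_mul]
  rfl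

lemma signRingHom_coord_two : W.signRingHom (W.coord 2) = W.coord 2 := by
  change Ideal.Quotient.mk _ (W.signPoly _) = _
  simp [signPoly]
  rfl

lemma eq_pow_mul_of_mem_grading {φ ψ : W.HomogCoordRing →ₐ[R] A} {c : A}
    (h : ∀ j, φ (W.coord j) = c * ψ (W.coord j)) {n : ℕ} {x : W.HomogCoordRing}
    (hx : x ∈ W.grading n) : φ x = c ^ n * ψ x := by
  obtain ⟨p, hp, rfl⟩ := hx
  have key : ∀ χ : W.HomogCoordRing →ₐ[R] A, χ ((Ideal.Quotient.mkₐ R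
      (Ideal.span {W.toProjective.polynomial})).toLinearMap p) =
      MvPolynomial.aeval (fun i => χ (W.coord i)) p := by
    intro χ
    have : χ.comp (Ideal.Quotient.mkₐ R (Ideal.span {W.toProjective.polynomial})) =
        MvPolynomial.aeval (fun i => χ (W.coord i)) := by
      apply MvPolynomial.algHom_ext
      intro i
      rw [MvPolynomial.aeval_X]
      rfl
    exact DFunLike.congr_fun this p
  rw [key, key, MvPolynomial.aeval_def, MvPolynomial.aeval_def, MvPolynomial.eval₂_eq',
    MvPolynomial.eval₂_eq', Finset.mul_sum]
  refine Finset.sum_congr rfl fun d hd => ?_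
  have hd' := hp (MvPolynomial.mem_support_iff.1 hd)
  rw [Finsupp.weight_apply, Finsupp.sum_fintype _ _ (by simp)] at hd'
  simp only [h, mul_pow, Finset.prod_mul_distrib, Finset.prod_pow_eq_pow_sum]
  simp only [Pi.one_apply, smul_eq_mul, mul_one] at hd'
  rw [hd']
  ring

/-- Forms of degree n scale by cⁿ, so quotients of forms of equal degree do not change. -/
lemma point_eq_of_smul {φ ψ : W.HomogCoordRing →ₐ[R] A} {c : A}
    (h : ∀ j, φ (W.coord j) = c * ψ (W.coord j)) {s : W.HomogCoordRing} {d : ℕ}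
    (hs : s ∈ W.grading d) (hd : 0 < d) (hφ : IsUnit (φ s)) (hψ : IsUnit (ψ s)) :
    ProjPoint.point W.grading φ.toRingHom s hs hd hφ =
      ProjPoint.point W.grading ψ.toRingHom s hs hd hψ := by
  rw [ProjPoint.point, ProjPoint.point]
  congr 3
  symm
  apply ProjPoint.lift_eq_iff φ.toRingHom hs hφ
  intro n x hx
  have h1 := ProjPoint.lift_mk_mul (𝒜 := W.grading) ψ.toRingHom hs hψ n x hx
  have h2 := W.eq_pow_mul_of_mem_grading h hx
  have h3 := W.eq_pow_mul_of_mem_grading h hs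
  change _ * φ s ^ n = φ x
  rw [h2, h3, mul_pow, ← pow_mul, smul_eq_mul, mul_comm d n, mul_left_comm]
  exact congrArg _ h1

section Point

variable (φ : W.HomogCoordRing →ₐ[R] A) {s : W.HomogCoordRing} {d : ℕ} (hs : s ∈ W.grading d)
  (hd : 0 < d) (h : IsUnit (φ s)) (hφ : 2 * φ (W.coord 1) + algebraMap R A W.a₁ * φ (W.coord 0) +
    algebraMap R A W.a₃ * φ (W.coord 2) = 0)

include hφ

/-- The involution changes Y by -(2Y + a₁X + a₃Z), which vanishes at φ. -/
lemma point_signHom :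
    ProjPoint.point W.grading φ.toRingHom s hs hd h ≫ W.signHom =
      ProjPoint.point W.grading φ.toRingHom s hs hd h := by
  have hφ : φ.comp W.signRingHom = φ := by
    apply algHom_ext
    intro j
    rw [AlgHom.comp_apply]
    fin_cases j
    · exact congrArg φ W.signRingHom_coord_zero
    · refine (congrArg φ W.signRingHom_coord_one).trans ?_
      change _ = φ (W.coord 1)
      simp only [map_neg, map_add, map_smul, Algebra.smul_def]
      linear_combination -hφ
    · exact congrArg φ W.signRingHom_coord_two
  have hu : IsUnit (φ.toRingHom (W.signGraded s)) := by
    have : φ.toRingHom (W.signGraded s) = φ s := DFunLike.congr_fun hφ _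
    rw [this]
    exact h
  rw [ProjPoint.point_congr (𝒜 := W.grading) φ.toRingHom hs hd _
    (W.signGraded.map_mem hs) hd hu]
  refine (ProjPoint.point_map W.signGraded W.irrelevant_le_map_signGraded φ.toRingHom
    hs hd hu).trans ?_
  rw [ProjPoint.point_congr (𝒜 := W.grading) φ.toRingHom
    (W.signGraded.map_mem hs) hd hu hs hd h]
  congr 1
  exact congrArg AlgHom.toRingHom hφ

variable [IsDomain R] [Module.Free R A]

/-- The automorphisms fixing the point form a closed subfunctor containing id and N, and the
schematic closure is the least such. -/
lemma effectiveModel_subset_fixingFamily {T : Scheme.{u}} (t : T ⟶ Spec (.of R)) :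
    W.effectiveModel t ⊆
      fixingFamily W.modelHom (ProjPoint.point W.grading φ.toRingHom s hs hd h) t := by
  intro g hg
  refine hg _ (isClosed_fixingFamily (W.point_modelHom φ hs hd h)) ?_
  rintro _ (rfl | rfl)
  · exact RelAut.refl_mem_fixingFamily _ _ _
  · exact RelAut.ofIso_mem_fixingFamily _ (W.point_signHom φ hs hd h hφ) _

lemma mem_fixLocus_of_fromSpecResidueField_eq {z : W.model}
    (b : Spec (W.model.residueField z) ⟶ Spec (.of A))
    (hb : W.model.fromSpecResidueField z =
      b ≫ ProjPoint.point W.grading φ.toRingHom s hs hd h) : z ∈ W.fixLocus := by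
  intro T' m t' ht' g hg
  exact RelAut.act_comp_of_mem_fixingFamily
    (W.effectiveModel_subset_fixingFamily φ hs hd h hφ t' hg) ht'
    (b := m ≫ b) (by rw [hb, Category.assoc])

end Point

end

end WeierstrassCurve

/-! ### Points of the line `2Y + a₁X + a₃Z = 0`, after division by the common factor -/

section

open Polynomial in
lemma exists_free_root_of_monic_cubic {R : Type u} [CommRing R] (p q r : R) :
    ∃ (A : Type u) (_ : CommRing A) (_ : Algebra R A) (_ : Module.Free R A) (x : A),
      x ^ 3 + algebraMap R A p * x ^ 2 + algebraMap R A q * x + algebraMap R A r = 0 ∧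
      ∀ {K : Type u} [CommRing K] [Algebra R K] (k : K),
        k ^ 3 + algebraMap R K p * k ^ 2 + algebraMap R K q * k + algebraMap R K r = 0 →
        ∃ b : A →ₐ[R] K, b x = k := by
  let f : R[X] := X ^ 3 + C p * X ^ 2 + C q * X + C r
  have hf : f.Monic := by
    nontriviality R
    simp only [f]
    monicity!
  refine ⟨AdjoinRoot f, inferInstance, inferInstance, hf.free_adjoinRoot, AdjoinRoot.root f, ?_, ?_⟩
  · have h := AdjoinRoot.eval₂_root f
    simpa [f, eval₂_add, eval₂_mul] using h
  · intro K _ _ k hk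
    refine ⟨AdjoinRoot.liftAlgHom f (Algebra.ofId R K) k ?_, AdjoinRoot.liftAlgHom_root _ _ _ _⟩
    simpa [f, eval₂_add, eval₂_mul, Algebra.ofId_apply] using hk

end

namespace WeierstrassCurve

variable {R K : Type u} [CommRing R] [Field K] [Algebra R K]
  (W : WeierstrassCurve R)

/-- The data of a point of the plane cubic, with values in a free algebra, on the line
`2Y + a₁X + a₃Z = 0`, that specializes to a given point. -/
def HasFixedLift (x y : K) : Prop :=
  ∃ (A : Type u) (_ : CommRing A) (_ : Algebra R A) (_ : Module.Free R A)
    (φ : W.HomogCoordRing →ₐ[R] A) (s : W.HomogCoordRing) (_ : s ∈ W.grading 1)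
    (b : A →ₐ[R] K) (c : K),
    IsUnit (φ s) ∧ 2 * φ (W.coord 1) + algebraMap R A W.a₁ * φ (W.coord 0) +
      algebraMap R A W.a₃ * φ (W.coord 2) = 0 ∧ ∀ j, b (φ (W.coord j)) = c * ![x, y, 1] j

variable {W} {x y : K} (h : W.Eqn ![x, y, 1]) {d α β γ : R} (h2 : (2 : R) = d * α)
  (h1 : W.a₁ = d * β) (h3 : W.a₃ = d * γ)
  (hε : algebraMap R K α * y + algebraMap R K β * x + algebraMap R K γ = 0)

include h h2 h1 h3 hε

/-- Since α is a unit, L = 0 can be solved for Y. Substitution in the Weierstrass equation leaves a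
monic cubic in X, whose root generates the free algebra. -/
lemma hasFixedLift_of_isUnit_left (hα : IsUnit α) : W.HasFixedLift x y := by
  obtain ⟨α', hα'⟩ := hα.exists_left_inv
  have hm : (2 : R) * (α' * β) = W.a₁ := by
    rw [h1, h2]; linear_combination d * β * hα'
  have hn : (2 : R) * (α' * γ) = W.a₃ := by
    rw [h3, h2]; linear_combination d * γ * hα'
  have hy : y = -(algebraMap R K (α' * β) * x + algebraMap R K (α' * γ)) := by
    have := congrArg (algebraMap R K) hα'
    simp only [map_mul, map_one] at this ⊢
    linear_combination algebraMap R K α' * hε - y * this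
  generalize α' * β = m at *
  generalize α' * γ = n at *
  obtain ⟨A, _, _, hfree, t, ht, hA⟩ := exists_free_root_of_monic_cubic
    (W.a₂ - m ^ 2 + W.a₁ * m) (W.a₄ - 2 * m * n + W.a₁ * n + W.a₃ * m) (W.a₆ - n ^ 2 + W.a₃ * n)
  simp only [Eqn, Matrix.cons_val_zero, Matrix.cons_val_one, Matrix.cons_val, mul_one,
    one_pow] at h
  have he : W.Eqn ![t, -(algebraMap R A m * t + algebraMap R A n), 1] := by
    simp only [map_add, map_sub, map_mul, map_pow, map_ofNat] at ht
    simp only [Eqn, Matrix.cons_val_zero, Matrix.cons_val_one, Matrix.cons_val]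
    linear_combination -ht
  obtain ⟨b, hb⟩ := hA x (by
    simp only [map_add, map_sub, map_mul, map_pow, map_ofNat]
    rw [hy] at h
    linear_combination -h)
  refine ⟨A, _, _, hfree, W.coordHom _ he, W.coord 2, W.coord_mem 2, b, 1, by simp, ?_, ?_⟩
  · have e1 := congrArg (algebraMap R A) hm
    have e2 := congrArg (algebraMap R A) hn
    simp only [map_mul, map_ofNat] at e1 e2
    simp only [coordHom_coord, Matrix.cons_val_zero, Matrix.cons_val_one, Matrix.cons_val]
    linear_combination -t * e1 - e2
  · intro j
    fin_cases j
    · simp [hb]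
    · simp [hb, hy]
    · simp

/-- Now L = 0 is solved for X = -(mY + nZ), but the resulting cubic in Y/Z has the nonunit leading
coefficient m³. A projective change of coordinate t = 1/(y - s), where the cubic has a unit value at
s, makes it monic up to that unit. -/
lemma hasFixedLift_of_isUnit_middle [IsLocalRing R] (hK : ∀ r : R, ¬ IsUnit r → algebraMap R K r = 0)
    (hα : ¬ IsUnit α) (hβ : IsUnit β) : W.HasFixedLift x y := by
  obtain ⟨β', hβ'⟩ := hβ.exists_left_inv
  have hm : W.a₁ * (β' * α) = 2 := by
    rw [h1, h2]; linear_combination d * α * hβ'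
  have hn : W.a₁ * (β' * γ) = W.a₃ := by
    rw [h1, h3]; linear_combination d * γ * hβ'
  have hx : x = -(algebraMap R K (β' * α) * y + algebraMap R K (β' * γ)) := by
    have := congrArg (algebraMap R K) hβ'
    simp only [map_mul, map_one] at this ⊢
    linear_combination algebraMap R K β' * hε - x * this
  have hm' : ¬ IsUnit (β' * α) := fun hu => hα (isUnit_of_mul_isUnit_right hu)
  generalize β' * α = m at *
  generalize β' * γ = n at *
  -- The substitution x = -(my + n) turns the equation into c₃y³ + c₂y² + c₁y + c₀ = 0, which
  -- reduces to y² + c₀ modulo the maximal ideal.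
  obtain ⟨c₃, hc₃⟩ : ∃ c, c = m ^ 3 := ⟨_, rfl⟩
  obtain ⟨c₂, hc₂⟩ : ∃ c, c = 1 - W.a₁ * m + 3 * m ^ 2 * n - W.a₂ * m ^ 2 := ⟨_, rfl⟩
  obtain ⟨c₁, hc₁⟩ : ∃ c, c = 3 * m * n ^ 2 - 2 * W.a₂ * m * n + W.a₄ * m := ⟨_, rfl⟩
  obtain ⟨c₀, hc₀⟩ : ∃ c, c = n ^ 3 - W.a₂ * n ^ 2 + W.a₄ * n - W.a₆ := ⟨_, rfl⟩
  have hmem : ∀ r, m * r ∈ IsLocalRing.maximalIdeal R := fun r => Ideal.mul_mem_right _ _ hm'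
  have hc₃' : c₃ ∈ IsLocalRing.maximalIdeal R := by
    convert hmem (m ^ 2) using 1; rw [hc₃]; ring
  have hc₁' : c₁ ∈ IsLocalRing.maximalIdeal R := by
    convert hmem (3 * n ^ 2 - 2 * W.a₂ * n + W.a₄) using 1; rw [hc₁]; ring
  have hc₂' : 1 - c₂ ∈ IsLocalRing.maximalIdeal R := by
    convert hmem (W.a₁ - 3 * m * n + W.a₂ * m) using 1; rw [hc₂]; ring
  simp only [Eqn, Matrix.cons_val_zero, Matrix.cons_val_one, Matrix.cons_val, mul_one,
    one_pow] at h
  have hf : algebraMap R K c₃ * y ^ 3 + algebraMap R K c₂ * y ^ 2 + algebraMap R K c₁ * y +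
      algebraMap R K c₀ = 0 := by
    rw [hc₃, hc₂, hc₁, hc₀, ← sub_eq_zero.2 h, hx, ← hn]
    simp only [map_add, map_sub, map_mul, map_pow, map_ofNat, map_one]
    ring
  -- The Taylor coefficients at s, divided by the value there, form the monic cubic satisfied by t.
  -- The lifted point has Z = t and Y = 1 + st, so Y - sZ = 1 is a unit.
  have key (s : R) (hs : IsUnit (c₃ * s ^ 3 + c₂ * s ^ 2 + c₁ * s + c₀))
      (hys : y - algebraMap R K s ≠ 0) : W.HasFixedLift x y := by
    obtain ⟨w, hw⟩ := hs.exists_left_inv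
    obtain ⟨A, _, _, hfree, t, ht, hA⟩ := exists_free_root_of_monic_cubic
      (w * (3 * c₃ * s ^ 2 + 2 * c₂ * s + c₁)) (w * (3 * c₃ * s + c₂)) (w * c₃)
    have hs' : IsUnit (algebraMap R A w) :=
      (IsUnit.of_mul_eq_one _ hw).map _
    have hwA := congrArg (algebraMap R A) hw
    have hwK := congrArg (algebraMap R K) hw
    obtain ⟨b, hb⟩ := hA (y - algebraMap R K s)⁻¹ (by
      have e : (y - algebraMap R K s) * (y - algebraMap R K s)⁻¹ = 1 := mul_inv_cancel₀ hys
      have e' : y * (y - algebraMap R K s)⁻¹ = 1 + algebraMap R K s * (y - algebraMap R K s)⁻¹ := by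
        linear_combination e
      generalize (y - algebraMap R K s)⁻¹ = v at *
      have hf' : algebraMap R K c₃ * (y * v) ^ 3 + algebraMap R K c₂ * (y * v) ^ 2 * v +
          algebraMap R K c₁ * (y * v) * v ^ 2 + algebraMap R K c₀ * v ^ 3 = 0 := by
        linear_combination v ^ 3 * hf
      rw [e'] at hf'
      simp only [map_add, map_mul, map_pow, map_ofNat, map_one] at hwK ⊢
      linear_combination algebraMap R K w * hf' - v ^ 3 * hwK)
    have he : W.Eqn ![-(algebraMap R A m * (1 + algebraMap R A s * t) + algebraMap R A n * t),
        1 + algebraMap R A s * t, t] := by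
      rw [hc₃, hc₂, hc₁] at ht
      rw [hc₃, hc₂, hc₁, hc₀] at hwA
      simp only [Eqn, Matrix.cons_val_zero, Matrix.cons_val_one, Matrix.cons_val]
      have e2 := congrArg (algebraMap R A) hn
      apply hs'.mul_left_injective
      simp only [map_add, map_sub, map_mul, map_pow, map_ofNat, map_one] at ht hwA e2 ⊢
      rw [← e2]
      linear_combination ht + t ^ 3 * hwA
    refine ⟨A, _, _, hfree, W.coordHom _ he, W.coord 1 - s • W.coord 2,
      sub_mem (W.coord_mem 1) (Submodule.smul_mem _ _ (W.coord_mem 2)), b,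
      (y - algebraMap R K s)⁻¹, ?_, ?_, ?_⟩
    · have : W.coordHom _ he (W.coord 1 - s • W.coord 2) = 1 := by
        simp [Algebra.smul_def]
      rw [this]
      exact isUnit_one
    · have e1 := congrArg (algebraMap R A) hm
      have e2 := congrArg (algebraMap R A) hn
      simp only [map_mul, map_ofNat] at e1 e2
      simp only [coordHom_coord, Matrix.cons_val_zero, Matrix.cons_val_one, Matrix.cons_val]
      linear_combination -(1 + algebraMap R A s * t) * e1 - t * e2
    · have e : (y - algebraMap R K s)⁻¹ * (y - algebraMap R K s) = 1 := inv_mul_cancel₀ hys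
      have e' : 1 + algebraMap R K s * (y - algebraMap R K s)⁻¹ = (y - algebraMap R K s)⁻¹ * y := by
        linear_combination -e
      intro j
      fin_cases j
      · simp only [Fin.zero_eta, coordHom_coord, Matrix.cons_val_zero, map_neg, map_add, map_mul,
          map_one, AlgHom.commutes, hb]
        rw [e', hx]
        ring
      · simp only [Fin.mk_one, coordHom_coord, Matrix.cons_val_one, Matrix.cons_val_zero, map_add,
          map_mul, map_one, AlgHom.commutes, hb]
        exact e'
      · simp [hb]
  have hy : y ^ 2 = - algebraMap R K c₀ := by
    have e2 := hK _ hc₂'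
    rw [map_sub, map_one] at e2
    rw [hK _ hc₃', hK _ hc₁'] at hf
    linear_combination hf + y ^ 2 * e2
  -- One of s = 0, 1 works for every residue field. If c₀ is a unit, it is the value at 0, and y ≠
  -- 0. Otherwise y = 0, and the value at 1 is congruent to 1.
  by_cases h0 : IsUnit c₀
  · refine key 0 (by simpa using h0) ?_
    rw [map_zero, sub_zero]
    rintro rfl
    exact (h0.map (algebraMap R K)).ne_zero (by linear_combination hy)
  · have hy0 : y = 0 := by
      rw [hK _ h0, neg_zero] at hy
      exact pow_eq_zero_iff two_ne_zero |>.1 hy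
    refine key 1 ?_ (by simp [hy0])
    have : (c₃ * 1 ^ 3 + c₂ * 1 ^ 2 + c₁ * 1 + c₀) = 1 - ((1 - c₂) - c₃ - c₁ - c₀) := by ring
    rw [this]
    exact IsLocalRing.isUnit_one_sub_self_of_mem_nonunits _
      (sub_mem (sub_mem (sub_mem hc₂' hc₃') hc₁') h0)

/-- If only γ is a unit, L specializes to the nonzero constant γ, contrary to L(z) = 0. -/
lemma hasFixedLift [IsLocalRing R] (hK : ∀ r : R, ¬ IsUnit r → algebraMap R K r = 0)
    (hu : IsUnit α ∨ IsUnit β ∨ IsUnit γ) : W.HasFixedLift x y := by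
  by_cases hα : IsUnit α
  · exact hasFixedLift_of_isUnit_left h h2 h1 h3 hε hα
  by_cases hβ : IsUnit β
  · exact hasFixedLift_of_isUnit_middle h h2 h1 h3 hε hK hα hβ
  have hγ : IsUnit γ := by tauto
  rw [hK _ hα, hK _ hβ, zero_mul, zero_mul, zero_add, zero_add] at hε
  exact absurd hε (hγ.map (algebraMap R K)).ne_zero

end WeierstrassCurve

/-! ### Residue fields of points of the plane cubic -/

namespace WeierstrassCurve

variable {R : Type u} [CommRing R] (W : WeierstrassCurve R) (z : W.model)

/-- The residue field of a point of the plane cubic as an algebra over the base ring. -/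
abbrev residueAlgebra : Algebra R (W.model.residueField z) :=
  (Spec.preimage (W.model.fromSpecResidueField z ≫ W.modelHom)).hom.toAlgebra

lemma specMap_residueAlgebra :
    letI := W.residueAlgebra z
    W.model.fromSpecResidueField z ≫ W.modelHom =
      Spec.map (CommRingCat.ofHom (algebraMap R (W.model.residueField z))) := by
  exact (Spec.map_preimage _).symm

variable {z}

lemma exists_pt_fromSpecResidueField (hz : z ∈ singLocus W.modelHom) :
    letI := W.residueAlgebra z
    ∃ (φ : W.HomogCoordRing →ₐ[R] W.model.residueField z) (h : φ (W.coord 2) = 1),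
      W.model.fromSpecResidueField z = W.pt φ 2 h ∧
      2 * φ (W.coord 1) + algebraMap R _ W.a₁ * φ (W.coord 0) + algebraMap R _ W.a₃ = 0 ∧
      algebraMap R _ W.a₁ * φ (W.coord 1) = 3 * φ (W.coord 0) ^ 2 +
        2 * algebraMap R _ W.a₂ * φ (W.coord 0) + algebraMap R _ W.a₄ := by
  let := W.residueAlgebra z
  refine W.exists_pt_of_mem_singLocus (K := W.model.residueField z)
    (W.model.fromSpecResidueField z) (W.specMap_residueAlgebra z) ?_
  exact (W.model.fromSpecResidueField_apply z _).symm ▸ hz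

variable [IsDomain R]

/-- The canonical point of z has coordinates proportional to the specialized lift, so it factors
through an A-valued point fixed by G. -/
lemma mem_fixLocus_of_hasFixedLift [Algebra R (W.model.residueField z)]
    {φ : W.HomogCoordRing →ₐ[R] W.model.residueField z} {h : φ (W.coord 2) = 1}
    (hφ : W.model.fromSpecResidueField z = W.pt φ 2 h)
    (hl : W.HasFixedLift (φ (W.coord 0)) (φ (W.coord 1))) : z ∈ W.fixLocus := by
  obtain ⟨A, _, _, _, φ', s, hs, b, c, hu, hline, hb⟩ := hl
  have hb' : ∀ j, (b.comp φ') (W.coord j) = c * φ (W.coord j) := by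
    intro j
    refine (hb j).trans ?_
    fin_cases j
    · rfl
    · rfl
    · exact congrArg _ h.symm
  have hs1 : IsUnit ((b.comp φ') s) := hu.map b
  have hs2 : IsUnit (φ s) := by
    rw [W.eq_pow_mul_of_mem_grading hb' hs] at hs1
    exact isUnit_of_mul_isUnit_right hs1
  refine W.mem_fixLocus_of_fromSpecResidueField_eq φ' hs one_pos hu hline
    (Spec.map (CommRingCat.ofHom b.toRingHom)) ?_
  refine hφ.trans ((ProjPoint.point_congr (𝒜 := W.grading) φ.toRingHom (W.coord_mem 2) one_pos _
    hs one_pos hs2).trans ((W.point_eq_of_smul hb' hs one_pos hs1 hs2).symm.trans ?_))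
  exact (ProjPoint.specMap_point (𝒜 := W.grading) φ'.toRingHom hs one_pos hu b.toRingHom).symm

end WeierstrassCurve

/-! ### Linear substitutions as morphisms over the base -/

namespace WeierstrassCurve

variable {R R' : Type u} [CommRing R] [CommRing R'] [Algebra R R'] (W : WeierstrassCurve R)
  (W' : WeierstrassCurve R') (l : Fin 3 → W'.HomogCoordRing) (hl : W.Eqn l)
  (hd : ∀ i, l i ∈ W'.grading 1) (hspan : ∀ i, W'.coord i ∈ Ideal.span (Set.range l))

lemma awayMap_substGraded_comp_awayStr (s : W.HomogCoordRing) :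
    (HomogeneousLocalization.Away.map (W.substGraded W' l hl hd) s).comp (W.awayStr s) =
      (W'.awayStr (W.substGraded W' l hl hd s)).comp (algebraMap R R') := by
  ext1 r
  ext
  have h1 : W.substGraded W' l hl hd 1 = 1 := map_one (W.substGraded W' l hl hd).toRingHom
  have h2 : W.substGraded W' l hl hd (algebraMap R _ r) =
      algebraMap R' _ (algebraMap R R' r) :=
    ((W.coordHom l hl).commutes r).trans (IsScalarTower.algebraMap_apply R R' _ r)
  change Localization.mk _ _ = Localization.mk _ _
  exact congrArg₂ _ h2 (Subtype.ext h1)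

lemma awayι_substHom_modelHom {i : ℕ} (hi : 0 < i) (s : W.HomogCoordRing) (hs : s ∈ W.grading i) :
    Proj.awayι W'.grading (W.substGraded W' l hl hd s) ((W.substGraded W' l hl hd).map_mem hs) hi ≫
        W.substHom W' l hl hd hspan ≫ W.modelHom =
      Proj.awayι W'.grading (W.substGraded W' l hl hd s)
          ((W.substGraded W' l hl hd).map_mem hs) hi ≫
        W'.modelHom ≫ Spec.map (CommRingCat.ofHom (algebraMap R R')) := by
  rw [substHom, Proj.awayι_comp_map_assoc _ _ hi _ hs, awayι_modelHom,
    ← Category.assoc, awayι_modelHom, ← Spec.map_comp, ← Spec.map_comp, ← CommRingCat.ofHom_comp,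
    ← CommRingCat.ofHom_comp, awayMap_substGraded_comp_awayStr]

lemma substHom_modelHom :
    W.substHom W' l hl hd hspan ≫ W.modelHom =
      W'.modelHom ≫ Spec.map (CommRingCat.ofHom (algebraMap R R')) := by
  refine (Proj.mapAffineOpenCover (W.substGraded W' l hl hd)
    (W.irrelevant_le_map_substGraded W' l hl hd hspan)).openCover.hom_ext _ _
    fun s => W.awayι_substHom_modelHom W' l hl hd hspan s.1.2 _ s.2.2

end WeierstrassCurve

/-! ### Invertible linear substitutions and the isomorphisms they induce -/

namespace WeierstrassCurve

variable {R : Type u} [CommRing R] {W W' : WeierstrassCurve R}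

/-- Two linear substitutions, inverse to each other. -/
structure SubstEquiv (W W' : WeierstrassCurve R) where
  /-- the linear forms of the substitution -/
  hom : Fin 3 → W'.HomogCoordRing
  /-- the linear forms of the inverse substitution -/
  inv : Fin 3 → W.HomogCoordRing
  eqn_hom : W.Eqn hom
  eqn_inv : W'.Eqn inv
  hom_mem : ∀ i, hom i ∈ W'.grading 1
  inv_mem : ∀ i, inv i ∈ W.grading 1
  coordHom_inv_hom : ∀ i, W'.coordHom inv eqn_inv (hom i) = W.coord i
  coordHom_hom_inv : ∀ i, W.coordHom hom eqn_hom (inv i) = W'.coord i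

namespace SubstEquiv

/-- The inverse substitution. -/
def symm (e : SubstEquiv W W') : SubstEquiv W' W :=
  ⟨e.inv, e.hom, e.eqn_inv, e.eqn_hom, e.inv_mem, e.hom_mem, e.coordHom_hom_inv,
    e.coordHom_inv_hom⟩

variable (e : SubstEquiv W W')

lemma coord_mem_span (i : Fin 3) : W'.coord i ∈ Ideal.span (Set.range e.hom) := by
  have h := Ideal.mem_map_of_mem (W.coordHom e.hom e.eqn_hom) (W.irrelevant_le_span_coord
    (HomogeneousIdeal.mem_irrelevant_of_mem W.grading one_pos (e.inv_mem i)))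
  rw [e.coordHom_hom_inv, Ideal.map_span, ← Set.range_comp] at h
  convert h using 3
  ext i
  simp

/-- The morphism of plane cubics given by an invertible linear substitution. -/
def map : W'.model ⟶ W.model :=
  W.substHom W' e.hom e.eqn_hom e.hom_mem e.coord_mem_span

lemma map_modelHom : e.map ≫ W.modelHom = W'.modelHom := by
  refine (W.substHom_modelHom W' _ e.eqn_hom e.hom_mem e.coord_mem_span).trans ?_
  change _ ≫ Spec.map (𝟙 _) = _
  rw [Spec.map_id, Category.comp_id]

lemma map_symm_comp_map : e.symm.map ≫ e.map = 𝟙 W.model := by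
  have h := Proj.map_comp (W.substGraded W' e.hom e.eqn_hom e.hom_mem)
    (W'.substGraded W e.inv e.eqn_inv e.inv_mem)
    (W.irrelevant_le_map_substGraded W' _ e.eqn_hom e.hom_mem e.coord_mem_span)
    (W'.irrelevant_le_map_substGraded W _ e.eqn_inv e.inv_mem e.symm.coord_mem_span)
  have h' := Proj.map_id (𝒜 := W.grading)
  have h1 : (W'.substGraded W e.inv e.eqn_inv e.inv_mem).comp
      (W.substGraded W' e.hom e.eqn_hom e.hom_mem) = GradedRingHom.id W.grading := by
    refine GradedRingHom.ext fun x => ?_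
    have h2 : (W'.coordHom e.inv e.eqn_inv).comp (W.coordHom e.hom e.eqn_hom) =
        AlgHom.id R _ := by
      apply algHom_ext
      intro i
      rw [AlgHom.comp_apply, coordHom_coord, e.coordHom_inv_hom]
      rfl
    exact DFunLike.congr_fun h2 x
  simp only [h1] at h
  exact h.symm.trans h'

/-- The isomorphism of plane cubics given by an invertible linear substitution. -/
def iso : W'.model ≅ W.model := ⟨e.map, e.symm.map, e.symm.map_symm_comp_map, e.map_symm_comp_map⟩

lemma pt_map {A : Type u} [CommRing A] [Algebra R A] (φ : W'.HomogCoordRing →ₐ[R] A) (i j : Fin 3)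
    (hi : φ (W'.coord i) = 1) (hj : φ (e.hom j) = 1) :
    W'.pt φ i hi ≫ e.map = W.pt (W.substComp W' e.hom e.eqn_hom φ) j (by simpa using hj) :=
  W.pt_substHom W' e.hom e.eqn_hom e.hom_mem e.coord_mem_span φ i j hi hj

end SubstEquiv

end WeierstrassCurve

/-! ### Relative automorphisms given on a fiber product -/

namespace RelAut

variable {X S T T' P : Scheme.{u}} {f : X ⟶ S} {t : T ⟶ S}

lemma ext_of_fst {g g' : RelAut f t}
    (h : g.iso.hom ≫ pullback.fst f t = g'.iso.hom ≫ pullback.fst f t) : g = g' := by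
  obtain ⟨i, hi⟩ := g
  obtain ⟨i', hi'⟩ := g'
  have : i = i' := by
    ext1
    exact pullback.hom_ext h (hi.trans hi'.symm)
  subst this
  rfl

variable {p : P ⟶ X} {q : P ⟶ T} (h : IsPullback p q f t) (σ : P ≅ P) (hσ : σ.hom ≫ q = q)

/-- The relative automorphism given by an automorphism of a fiber product. -/
def ofIsPullback : RelAut f t where
  iso := h.isoPullback.symm ≪≫ σ ≪≫ h.isoPullback
  hom_snd := by
    rw [Iso.trans_hom, Iso.trans_hom, Iso.symm_hom, Category.assoc, Category.assoc,
      h.isoPullback_hom_snd, hσ, h.isoPullback_inv_snd]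

lemma lift_baseChange_ofIsPullback {Z : Scheme.{u}} {m : T' ⟶ T} {y : Z ⟶ P} {x : Z ⟶ X}
    {n : Z ⟶ T'} (hx : y ≫ p = x) (hn : y ≫ q = n ≫ m) (w : x ≫ f = n ≫ m ≫ t) :
    pullback.lift x n w ≫ ((ofIsPullback h σ hσ).baseChange m).iso.hom ≫
      pullback.fst f (m ≫ t) = y ≫ σ.hom ≫ p := by
  subst hx
  have h1 : pullback.lift (y ≫ p) n w ≫ proj f t m = y ≫ h.isoPullback.hom := by
    apply pullback.hom_ext
    · rw [Category.assoc, Category.assoc, proj_fst, pullback.lift_fst, h.isoPullback_hom_fst]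
    · rw [Category.assoc, Category.assoc, proj_snd, pullback.lift_snd_assoc,
        h.isoPullback_hom_snd, hn]
  have h2 : ((ofIsPullback h σ hσ).baseChange m).iso.hom ≫ pullback.fst f (m ≫ t) =
      proj f t m ≫ h.isoPullback.inv ≫ σ.hom ≫ p := by
    refine (baseChangeHom_fst _ (hom_snd _) m).trans ?_
    simp only [ofIsPullback, Iso.trans_hom, Iso.symm_hom, Category.assoc, h.isoPullback_hom_fst]
  rw [h2, reassoc_of% h1, Iso.hom_inv_id_assoc]

lemma act_baseChange_ofIsPullback {m : T' ⟶ T} {y : T' ⟶ P} {x : T' ⟶ X}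
    (hx : y ≫ p = x) (hn : y ≫ q = m) (w : x ≫ f = m ≫ t) :
    ((ofIsPullback h σ hσ).baseChange m).act x w = y ≫ σ.hom ≫ p :=
  lift_baseChange_ofIsPullback h σ hσ hx (by rw [hn, Category.id_comp]) _

/-- Over a base `m : T' ⟶ T`, the automorphism `σ` becomes the automorphism `τ` of `X`. -/
lemma baseChange_ofIsPullback_eq {m : T' ⟶ T} {Z : Scheme.{u}} {y : Z ⟶ P} {n : Z ⟶ T'}
    (hP : IsPullback y n q m) (τ : X ≅ X) (hτ : τ.hom ≫ f = f)
    (hστ : y ≫ σ.hom ≫ p = y ≫ p ≫ τ.hom) :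
    (ofIsPullback h σ hσ).baseChange m = ofIso τ hτ (m ≫ t) := by
  have hZ : IsPullback (y ≫ p) n f (m ≫ t) := hP.paste_horiz h
  apply ext_of_fst
  rw [← cancel_epi hZ.isoPullback.hom]
  have e : hZ.isoPullback.hom = pullback.lift (y ≫ p) n hZ.w :=
    pullback.hom_ext
      (hZ.isoPullback_hom_fst.trans (pullback.lift_fst _ _ _).symm)
      (hZ.isoPullback_hom_snd.trans (pullback.lift_snd _ _ _).symm)
  have e1 : (ofIso τ hτ (m ≫ t)).iso.hom ≫ pullback.fst f (m ≫ t) =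
    pullback.fst f (m ≫ t) ≫ τ.hom := pullback.lift_fst _ _ _
  rw [e1, e, lift_baseChange_ofIsPullback h σ hσ rfl hP.w, hστ, pullback.lift_fst_assoc,
    Category.assoc]

lemma ofIso_refl (f : X ⟶ S) (t : T ⟶ S) :
    ofIso (Iso.refl X) (Category.id_comp f) t = refl f t := by
  apply ext_of_fst
  refine (pullback.lift_fst _ _ _).trans ?_
  exact (Category.comp_id _).trans (Category.id_comp _).symm

end RelAut

/-! ### Membership in the schematic closure of a finite family -/

/-- For a closed H containing P, the points u and v factor through the closed subscheme of Spec D on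
which g belongs to H. No nonzero element of D vanishes at both, so this subscheme is all of Spec D.
-/
lemma baseChange_mem_schematicClosure {R : Type u} [CommRing R] {X : Scheme.{u}}
    {f : X ⟶ Spec (.of R)} {D : Type u} [CommRing D] [Algebra R D]
    {U : Scheme.{u}} {r : U ⟶ Spec (.of R)} {P : Set (RelAut f r)}
    (g : RelAut f (Spec.map (CommRingCat.ofHom (algebraMap R D))))
    {u v : U ⟶ Spec (.of D)}
    (huv : ∀ x : D, u.appTop ((Scheme.ΓSpecIso (.of D)).inv x) = 0 →
      v.appTop ((Scheme.ΓSpecIso (.of D)).inv x) = 0 → x = 0)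
    (hg : ∀ w : U ⟶ Spec (.of D), w = u ∨ w = v →
      ∀ H : AutSubfamily f, P ⊆ H r → g.baseChange w ∈ H (w ≫ _))
    {T : Scheme.{u}} (m : T ⟶ Spec (.of D)) : g.baseChange m ∈ schematicClosure P (m ≫ _) := by
  intro H hH hP
  obtain ⟨T₀, i, hi, h⟩ := hH _ g
  obtain ⟨u₀, hu⟩ := (h u).1 (hg u (.inl rfl) H hP)
  obtain ⟨v₀, hv⟩ := (h v).1 (hg v (.inr rfl) H hP)
  have hinj : Function.Injective i.appTop := by
    rw [injective_iff_map_eq_zero]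
    intro a ha
    obtain ⟨x, rfl⟩ : ∃ x, (Scheme.ΓSpecIso (.of D)).inv x = a :=
      ⟨(Scheme.ΓSpecIso (.of D)).hom a, by simp⟩
    rw [huv x, map_zero]
    · rw [← hu, Scheme.Hom.comp_appTop]
      exact (congrArg _ ha).trans (map_zero (Scheme.Hom.appTop _).hom)
    · rw [← hv, Scheme.Hom.comp_appTop]
      exact (congrArg _ ha).trans (map_zero (Scheme.Hom.appTop _).hom)
  have : IsIso i := IsClosedImmersion.isIso_of_injective_of_isAffine hinj
  exact (h m).2 ⟨m ≫ inv i, by simp⟩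

/-! ### The deformation of the sign involution -/

namespace WeierstrassCurve

section

variable {D : Type u} [CommRing D] (W : WeierstrassCurve D) {d t α β γ : D}

/-- The substitution `Y ↦ Y - t(αY + βX + γZ)`, which interpolates between the identity and the
sign involution. -/
def deformCoord (t α β γ : D) : Fin 3 → W.HomogCoordRing :=
  ![W.coord 0, W.coord 1 - algebraMap D _ t * (algebraMap D _ α * W.coord 1 +
    algebraMap D _ β * W.coord 0 + algebraMap D _ γ * W.coord 2), W.coord 2]

/-- For `2 = dα`, `a₁ = dβ`, `a₃ = dγ` and `t² = dt`, the substitution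
`Y ↦ Y - t(αY + βX + γZ)` is an involution of the plane cubic. -/
def deformSubst (h2 : (2 : D) = d * α) (h1 : W.a₁ = d * β) (h3 : W.a₃ = d * γ)
    (ht : t ^ 2 = d * t) : SubstEquiv W W := by
  have he : W.Eqn (W.deformCoord t α β γ) := by
    have h := W.eqn_coord
    simp only [Eqn, h1, h3, deformCoord, Matrix.cons_val_zero, Matrix.cons_val_one,
      Matrix.cons_val] at h ⊢
    replace ht := congrArg (algebraMap D W.HomogCoordRing) ht
    replace h2 := congrArg (algebraMap D W.HomogCoordRing) h2
    simp only [map_mul, map_pow, map_ofNat] at ht h2 h ⊢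
    generalize algebraMap D W.HomogCoordRing t = t' at *
    generalize algebraMap D W.HomogCoordRing d = d' at *
    generalize algebraMap D W.HomogCoordRing α = α' at *
    generalize algebraMap D W.HomogCoordRing β = β' at *
    generalize algebraMap D W.HomogCoordRing γ = γ' at *
    generalize W.coord 0 = X at *
    generalize W.coord 1 = Y at *
    generalize W.coord 2 = Z at *
    -- Because 2Y + a₁X + a₃Z = dL, the equation changes by (t² - dt)ZL², where L = αY + βX + γZ.
    linear_combination h + Z * (α' * Y + β' * X + γ' * Z) ^ 2 * ht -
      Z * Y * t' * (α' * Y + β' * X + γ' * Z) * h2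
  have hm : ∀ i, W.deformCoord t α β γ i ∈ W.grading 1 := by
    intro i
    have hs (a : D) (j : Fin 3) : algebraMap D _ a * W.coord j ∈ W.grading 1 := by
      rw [← Algebra.smul_def]
      exact Submodule.smul_mem _ _ (W.coord_mem j)
    fin_cases i
    · exact W.coord_mem 0
    · refine sub_mem (W.coord_mem 1) ?_
      rw [← Algebra.smul_def]
      exact Submodule.smul_mem _ _ (add_mem (add_mem (hs _ _) (hs _ _)) (hs _ _))
    · exact W.coord_mem 2
  have hi : ∀ i, W.coordHom _ he (W.deformCoord t α β γ i) = W.coord i := by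
    intro i
    fin_cases i
    · exact W.coordHom_coord _ he 0
    · change W.coordHom _ he (W.coord 1 - algebraMap D _ t * (algebraMap D _ α * W.coord 1 +
        algebraMap D _ β * W.coord 0 + algebraMap D _ γ * W.coord 2)) = W.coord 1
      simp only [map_sub, map_add, map_mul, AlgHom.commutes, coordHom_coord]
      simp only [deformCoord, Matrix.cons_val_zero, Matrix.cons_val_one, Matrix.cons_val]
      replace ht := congrArg (algebraMap D W.HomogCoordRing) ht
      replace h2 := congrArg (algebraMap D W.HomogCoordRing) h2
      simp only [map_mul, map_pow, map_ofNat] at ht h2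
      -- Applied twice, the substitution is Y ↦ Y - (2t - αt²)L, and 2t = αdt = αt².
      linear_combination (algebraMap D W.HomogCoordRing α * W.coord 1 +
        algebraMap D _ β * W.coord 0 + algebraMap D _ γ * W.coord 2) *
        (algebraMap D W.HomogCoordRing α * ht - algebraMap D W.HomogCoordRing t * h2)
    · exact W.coordHom_coord _ he 2
  exact ⟨_, _, he, he, hm, hm, hi, hi⟩

end

section

variable {R D F : Type u} [CommRing R] [CommRing D] [CommRing F] [Algebra R D] [Algebra D F]
  (W : WeierstrassCurve R) {d α β γ : R} {t : D}
  (h2 : (2 : R) = d * α) (h1 : W.a₁ = d * β) (h3 : W.a₃ = d * γ)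
  (ht : t ^ 2 = algebraMap R D d * t)

/-- The deformation of the sign involution over `R[t] / (t² - dt)`. -/
def deformBase : SubstEquiv (W.map (algebraMap R D)) (W.map (algebraMap R D)) :=
  (W.map (algebraMap R D)).deformSubst (d := algebraMap R D d) (α := algebraMap R D α)
    (β := algebraMap R D β) (γ := algebraMap R D γ)
    (by rw [← map_mul, ← h2, map_ofNat]) (by rw [← map_mul, ← h1]; rfl)
    (by rw [← map_mul, ← h3]; rfl) ht

/-- The relative automorphism over `R[t] / (t² - dt)` that deforms the sign involution. -/
def deformAut : RelAut W.modelHom (Spec.map (CommRingCat.ofHom (algebraMap R D))) :=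
  RelAut.ofIsPullback (W.isPullback_baseHom D) (W.deformBase h2 h1 h3 ht).iso
    (W.deformBase h2 h1 h3 ht).map_modelHom

omit [CommRing D] [CommRing F] [Algebra R D] [Algebra D F] in
lemma gradedRingHom_ext {R' : Type u} [CommRing R'] {V : WeierstrassCurve R'}
    {θ θ' : GradedRingHom W.grading V.grading}
    (h : ∀ r, θ (algebraMap R _ r) = θ' (algebraMap R _ r))
    (h' : ∀ i, θ (W.coord i) = θ' (W.coord i)) : θ = θ' := by
  have : θ.toRingHom = θ'.toRingHom := by
    apply Ideal.Quotient.ringHom_ext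
    apply MvPolynomial.ringHom_ext
    · exact h
    · exact h'
  exact GradedRingHom.ext fun x => DFunLike.congr_fun this x

/-- Both automorphisms come from graded homomorphisms, so it suffices to compare the images of the
three coordinates over F. -/
lemma baseChange_deformAut (θ : GradedRingHom W.grading W.grading)
    (hθ : HomogeneousIdeal.irrelevant W.grading ≤ (HomogeneousIdeal.irrelevant W.grading).map θ)
    (τ : W.model ≅ W.model) (hτ : τ.hom ≫ W.modelHom = W.modelHom) (hτ' : τ.hom = Proj.map θ hθ)
    (hθR : ∀ r, θ (algebraMap R _ r) = algebraMap R _ r)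
    (h : ∀ i, (W.map (algebraMap R D)).baseGraded F ((W.deformBase h2 h1 h3 ht).hom i) =
      (W.map (algebraMap R D)).baseGraded F (W.baseGraded D (θ (W.coord i)))) :
    (W.deformAut h2 h1 h3 ht).baseChange (Spec.map (CommRingCat.ofHom (algebraMap D F))) =
      RelAut.ofIso τ hτ _ := by
  refine RelAut.baseChange_ofIsPullback_eq _ _ _
    ((W.map (algebraMap R D)).isPullback_baseHom F) τ hτ ?_
  rw [hτ']
  change Proj.map _ _ ≫ Proj.map _ _ ≫ Proj.map _ _ = Proj.map _ _ ≫ Proj.map _ _ ≫ Proj.map _ _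
  rw [← Proj.map_comp, ← Proj.map_comp, ← Proj.map_comp, ← Proj.map_comp]
  congr 1
  apply gradedRingHom_ext
  · intro r
    have e1 := W.baseGraded_algebraMap D r
    refine (congrArg (fun x => (W.map (algebraMap R D)).baseGraded F
      ((W.map (algebraMap R D)).coordHom _ (W.deformBase h2 h1 h3 ht).eqn_hom x)) e1).trans ?_
    refine (congrArg ((W.map (algebraMap R D)).baseGraded F) (AlgHom.commutes _ _)).trans ?_
    exact (congrArg (fun x => (W.map (algebraMap R D)).baseGraded F (W.baseGraded D x))
      (hθR r) |>.trans (congrArg _ e1)).symm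
  · intro i
    have e1 := W.baseGraded_coord D i
    refine (congrArg (fun x => (W.map (algebraMap R D)).baseGraded F
      ((W.map (algebraMap R D)).coordHom _ (W.deformBase h2 h1 h3 ht).eqn_hom x)) e1).trans ?_
    exact (congrArg ((W.map (algebraMap R D)).baseGraded F) (coordHom_coord _ _ _ _)).trans (h i)

lemma baseGraded_deformBase_hom_zero : (W.map (algebraMap R D)).baseGraded F
    ((W.deformBase h2 h1 h3 ht).hom 0) = ((W.map (algebraMap R D)).map (algebraMap D F)).coord 0 :=
  baseGraded_coord _ _ _

lemma baseGraded_deformBase_hom_two : (W.map (algebraMap R D)).baseGraded F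
    ((W.deformBase h2 h1 h3 ht).hom 2) = ((W.map (algebraMap R D)).map (algebraMap D F)).coord 2 :=
  baseGraded_coord _ _ _

lemma baseGraded_deformBase_hom_one : (W.map (algebraMap R D)).baseGraded F
    ((W.deformBase h2 h1 h3 ht).hom 1) =
      ((W.map (algebraMap R D)).map (algebraMap D F)).coord 1 -
      algebraMap F _ (algebraMap D F t) *
        (algebraMap F _ (algebraMap D F (algebraMap R D α)) *
          ((W.map (algebraMap R D)).map (algebraMap D F)).coord 1 +
        algebraMap F _ (algebraMap D F (algebraMap R D β)) *
          ((W.map (algebraMap R D)).map (algebraMap D F)).coord 0 +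
        algebraMap F _ (algebraMap D F (algebraMap R D γ)) *
          ((W.map (algebraMap R D)).map (algebraMap D F)).coord 2) := by
  change (W.map (algebraMap R D)).coordHom _
    (((W.map (algebraMap R D)).eqn_map_iff F _).1 (eqn_coord _))
    (_ - _ * (_ * _ + _ * _ + _ * _)) = _
  simp only [map_sub, map_add, map_mul, AlgHom.commutes, coordHom_coord]
  rfl

lemma baseChange_deformAut_of_eq_zero (h0 : algebraMap D F t = 0) :
    (W.deformAut h2 h1 h3 ht).baseChange (Spec.map (CommRingCat.ofHom (algebraMap D F))) =
      RelAut.refl W.modelHom _ := by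
  rw [← RelAut.ofIso_refl]
  refine W.baseChange_deformAut h2 h1 h3 ht (GradedRingHom.id _) (by simp) (Iso.refl _) _
    Proj.map_id.symm (fun _ => rfl) fun i => ?_
  refine Eq.trans ?_ ((congrArg ((W.map (algebraMap R D)).baseGraded F)
    (W.baseGraded_coord D i)).trans (baseGraded_coord _ _ _)).symm
  fin_cases i
  · exact W.baseGraded_deformBase_hom_zero h2 h1 h3 ht
  · refine (W.baseGraded_deformBase_hom_one h2 h1 h3 ht).trans ?_
    rw [h0, map_zero, zero_mul, sub_zero]
    rfl
  · exact W.baseGraded_deformBase_hom_two h2 h1 h3 ht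

lemma baseChange_deformAut_of_eq (hd : algebraMap D F t = algebraMap D F (algebraMap R D d)) :
    (W.deformAut h2 h1 h3 ht).baseChange (Spec.map (CommRingCat.ofHom (algebraMap D F))) =
      RelAut.ofIso W.signIso W.signHom_modelHom _ := by
  refine W.baseChange_deformAut h2 h1 h3 ht W.signGraded W.irrelevant_le_map_signGraded
    W.signIso _ rfl W.signRingHom.commutes fun i => ?_
  fin_cases i
  · refine (W.baseGraded_deformBase_hom_zero h2 h1 h3 ht).trans ?_
    refine ((congrArg (fun x => (W.map (algebraMap R D)).baseGraded F (W.baseGraded D x))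
      W.signRingHom_coord_zero).trans ?_).symm
    exact (congrArg ((W.map (algebraMap R D)).baseGraded F)
      (W.baseGraded_coord D _)).trans (baseGraded_coord _ _ _)
  · refine (W.baseGraded_deformBase_hom_one h2 h1 h3 ht).trans ?_
    refine ((congrArg (fun x => (W.map (algebraMap R D)).baseGraded F (W.baseGraded D x))
      W.signRingHom_coord_one).trans ?_).symm
    change (W.map (algebraMap R D)).coordHom _
      (((W.map (algebraMap R D)).eqn_map_iff F _).1 (eqn_coord _))
      (W.coordHom _ ((W.eqn_map_iff D _).1 (eqn_coord _)) _) = _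
    have e (r : R) (j : Fin 3) : (W.map (algebraMap R D)).coordHom _
        (((W.map (algebraMap R D)).eqn_map_iff F _).1 (eqn_coord _))
        (W.coordHom _ ((W.eqn_map_iff D _).1 (eqn_coord _)) (r • W.coord j)) =
        algebraMap F _ (algebraMap D F (algebraMap R D r)) *
          ((W.map (algebraMap R D)).map (algebraMap D F)).coord j := by
      refine (congrArg (fun x => (W.map (algebraMap R D)).coordHom _
        (((W.map (algebraMap R D)).eqn_map_iff F _).1 (eqn_coord _))
        (W.coordHom _ ((W.eqn_map_iff D _).1 (eqn_coord _)) x))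
        (Algebra.smul_def r (W.coord j))).trans ?_
      simp only [map_mul, coordHom_coord, AlgHom.commutes]
      congr 1
      exact AlgHom.commutes _ _
    simp only [map_neg, map_add, coordHom_coord, e]
    rw [hd, h1, h3]
    have e2 := congrArg (fun r => algebraMap F
      ((W.map (algebraMap R D)).map (algebraMap D F)).HomogCoordRing
      (algebraMap D F (algebraMap R D r))) h2
    simp only [map_mul, map_ofNat] at e2 ⊢
    linear_combination -((W.map (algebraMap R D)).map (algebraMap D F)).coord 1 * e2
  · refine (W.baseGraded_deformBase_hom_two h2 h1 h3 ht).trans ?_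
    refine ((congrArg (fun x => (W.map (algebraMap R D)).baseGraded F (W.baseGraded D x))
      W.signRingHom_coord_two).trans ?_).symm
    exact (congrArg ((W.map (algebraMap R D)).baseGraded F)
      (W.baseGraded_coord D _)).trans (baseGraded_coord _ _ _)

end

end WeierstrassCurve

/-! ### The deformation belongs to the effective model and moves points off the line L = 0 -/

namespace WeierstrassCurve

variable {R D : Type u} [CommRing R] [IsDomain R] [CommRing D] [Algebra R D]
  (W : WeierstrassCurve R) {d α β γ : R} {t : D}
  (h2 : (2 : R) = d * α) (h1 : W.a₁ = d * β) (h3 : W.a₃ = d * γ)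
  (ht : t ^ 2 = algebraMap R D d * t)

lemma baseChange_deformAut_mem_effectiveModel {u v : D →ₐ[R] FractionRing R} (hu : u t = 0)
    (hv : v t = algebraMap R (FractionRing R) d) (huv : ∀ x, u x = 0 → v x = 0 → x = 0)
    {T : Scheme.{u}} (m : T ⟶ Spec (.of D)) :
    (W.deformAut h2 h1 h3 ht).baseChange m ∈ W.effectiveModel (m ≫ _) := by
  have key (w : D →ₐ[R] FractionRing R) (x : D)
      (hx : (Spec.map (CommRingCat.ofHom w.toRingHom)).appTop
        ((Scheme.ΓSpecIso (.of D)).inv x) = 0) : w x = 0 := by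
    have h := Scheme.ΓSpecIso_inv_naturality (CommRingCat.ofHom w.toRingHom)
    have h' := (congrArg (fun f => f.hom x) h).trans hx
    have h4 := congrArg (Scheme.ΓSpecIso (.of (FractionRing R))).hom.hom h'
    rw [map_zero] at h4
    refine Eq.trans ?_ h4
    exact (congrArg (fun f => f.hom (w x)) (Scheme.ΓSpecIso (.of (FractionRing R))).inv_hom_id).symm
  have hgen (w : D →ₐ[R] FractionRing R) : Spec.map (CommRingCat.ofHom w.toRingHom) ≫
      Spec.map (CommRingCat.ofHom (algebraMap R D)) = genericPoint R := by
    rw [← Spec.map_comp, ← CommRingCat.ofHom_comp]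
    exact congrArg (fun f : R →+* FractionRing R => Spec.map (CommRingCat.ofHom f))
      w.comp_algebraMap
  refine baseChange_mem_schematicClosure (D := D) (W.deformAut h2 h1 h3 ht) (u := Spec.map (CommRingCat.ofHom u.toRingHom))
    (v := Spec.map (CommRingCat.ofHom v.toRingHom))
    (fun x hx hx' => huv x (key u x hx) (key v x hx')) ?_ m
  rintro _ (rfl | rfl) H hH
  · let := u.toRingHom.toAlgebra
    refine (W.baseChange_deformAut_of_eq_zero (F := FractionRing R) h2 h1 h3 ht hu).symm ▸ ?_
    -- The composite to Spec R is only propositionally the generic point, and the type of the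
    -- automorphism depends on it.
    have h : ∀ t', t' = genericPoint R → RelAut.refl W.modelHom t' ∈ H t' := by
      rintro _ rfl
      exact hH (.inl rfl)
    exact h _ (hgen u)
  · let := v.toRingHom.toAlgebra
    refine (W.baseChange_deformAut_of_eq (F := FractionRing R) h2 h1 h3 ht
      (hv.trans (v.commutes d).symm)).symm ▸ ?_
    have h : ∀ t', t' = genericPoint R → RelAut.ofIso W.signIso W.signHom_modelHom t' ∈ H t' := by
      rintro _ rfl
      exact hH (.inr rfl)
    exact h _ (hgen v)

section

variable {W} {K : Type u} [Field K] [Algebra R K] {φ : W.HomogCoordRing →ₐ[R] K}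
  (h : φ (W.coord 2) = 1)
  (hε : algebraMap R K α * φ (W.coord 1) + algebraMap R K β * φ (W.coord 0) + algebraMap R K γ ≠ 0)

include h hε in
omit [IsDomain R] in
-- For t = ε the y-coordinate becomes y - ε(αy + βx + γ).
lemma deformAut_act_ne {g : D →ₐ[R] TrivSqZeroExt K K} (hg : g t = TrivSqZeroExt.inr 1)
    {x : Spec (.of (TrivSqZeroExt K K)) ⟶ W.model}
    (hx : x = Spec.map (CommRingCat.ofHom (TrivSqZeroExt.inlAlgHom R K K).toRingHom) ≫ W.pt φ 2 h)
    (hw : x ≫ W.modelHom = Spec.map (CommRingCat.ofHom g.toRingHom) ≫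
      Spec.map (CommRingCat.ofHom (algebraMap R D))) :
    ((W.deformAut h2 h1 h3 ht).baseChange (Spec.map (CommRingCat.ofHom g.toRingHom))).act x hw ≠
      x := by
  let := g.toRingHom.toAlgebra
  have : IsScalarTower R D (TrivSqZeroExt K K) :=
    IsScalarTower.of_algebraMap_eq fun r => (g.commutes r).symm
  have he : (W.map (algebraMap R D)).Eqn
      ![TrivSqZeroExt.inlAlgHom R K K (φ (W.coord 0)), TrivSqZeroExt.inlAlgHom R K K
        (φ (W.coord 1)), 1] := by
    rw [eqn_map_iff]
    convert (W.eqn_algHom φ).map (TrivSqZeroExt.inlAlgHom R K K) using 1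
    funext i
    fin_cases i
    · rfl
    · rfl
    · exact ((congrArg _ h).trans (map_one _)).symm
  rw [specMap_pt] at hx
  obtain ⟨ψ, hψ⟩ : ∃ ψ, ψ = (W.map (algebraMap R D)).coordHom _ he := ⟨_, rfl⟩
  have hψ2 : ψ ((W.map (algebraMap R D)).coord 2) = 1 := by simp [hψ]
  have hb : (W.map (algebraMap R D)).pt ψ 2 hψ2 ≫ W.baseHom D = x := by
    rw [hx]
    refine (W.pt_substHom _ _ _ _ _ ψ 2 2 hψ2 hψ2).trans ?_
    congr 1
    apply algHom_ext
    intro i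
    rw [substComp_coord, hψ, coordHom_coord]
    fin_cases i
    · rfl
    · rfl
    · exact ((congrArg (TrivSqZeroExt.inlAlgHom R K K) h).trans (map_one _)).symm
  intro H
  replace H := (RelAut.act_baseChange_ofIsPullback (y := (W.map (algebraMap R D)).pt ψ 2 hψ2)
    (W.isPullback_baseHom D) (W.deformBase h2 h1 h3 ht).iso
    (W.deformBase h2 h1 h3 ht).map_modelHom hb (pt_modelHom _ _ _ _) hw).symm.trans (H.trans hx)
  have H1 := (W.deformBase h2 h1 h3 ht).pt_map ψ 2 2 hψ2 hψ2
  obtain ⟨χ, hχ⟩ : ∃ χ, χ = W.substComp _ _ ((W.eqn_map_iff D _).1 (eqn_coord _))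
    ((W.map (algebraMap R D)).substComp _ _ (W.deformBase h2 h1 h3 ht).eqn_hom ψ) := ⟨_, rfl⟩
  have hχ2 : χ (W.coord 2) = 1 := by
    rw [hχ, substComp_coord, substComp_coord]
    exact hψ2
  have H2 : (W.map (algebraMap R D)).pt ψ 2 hψ2 ≫ (W.deformBase h2 h1 h3 ht).iso.hom ≫ W.baseHom D
      = W.pt χ 2 hχ2 := by
    subst hχ
    exact (Category.assoc _ _ _).symm.trans ((congrArg (· ≫ W.baseHom D) H1).trans
      (W.pt_substHom _ _ _ _ _ _ 2 2 _ (by rw [substComp_coord]; exact hψ2)))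
  have H3 := congrArg (fun χ => χ (W.coord 1)) (pt_injective (H2.symm.trans H))
  simp only [hχ, substComp_coord] at H3
  change ψ (_ - _ * (_ * _ + _ * _ + _ * _)) = TrivSqZeroExt.inl _ at H3
  simp only [map_sub, map_add, map_mul, AlgHom.commutes, hψ, coordHom_coord] at H3
  have e (r : R) : algebraMap D (TrivSqZeroExt K K) (algebraMap R D r) =
    TrivSqZeroExt.inl (algebraMap R K r) := g.commutes r
  have e' : algebraMap D (TrivSqZeroExt K K) t = TrivSqZeroExt.inr 1 := hg
  simp only [e, e', Matrix.cons_val_zero, Matrix.cons_val_one, Matrix.cons_val] at H3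
  apply hε
  have H4 := congrArg TrivSqZeroExt.snd H3
  simp at H4
  linear_combination -H4

end

variable {W} in
-- Where d vanishes, t² = dt becomes t² = 0. So G acquires an infinitesimal deformation of the
-- identity over the dual numbers, and it moves z.
lemma notMem_fixLocus {z : W.model} [Algebra R (W.model.residueField z)]
    {φ : W.HomogCoordRing →ₐ[R] W.model.residueField z} {h : φ (W.coord 2) = 1}
    (hφ : W.model.fromSpecResidueField z = W.pt φ 2 h) (hd0 : d ≠ 0)
    (h2 : (2 : R) = d * α) (h1 : W.a₁ = d * β) (h3 : W.a₃ = d * γ)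
    (hd : algebraMap R (W.model.residueField z) d = 0)
    (hε : algebraMap R (W.model.residueField z) α * φ (W.coord 1) +
      algebraMap R (W.model.residueField z) β * φ (W.coord 0) +
      algebraMap R (W.model.residueField z) γ ≠ 0) : z ∉ W.fixLocus := by
  intro hz
  let K := W.model.residueField z
  -- This algebra is R[ω]/(ω² - dω). Below, u and v are its points ω = 0 and ω = d over the fraction
  -- field, and g sends ω to ε.
  have hω : (QuadraticAlgebra.omega : QuadraticAlgebra R 0 d) ^ 2 =
      algebraMap R _ d * QuadraticAlgebra.omega := by
    rw [pow_two, QuadraticAlgebra.omega_mul_omega_eq_add, zero_smul, zero_add, Algebra.smul_def]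
  let u : QuadraticAlgebra R 0 d →ₐ[R] FractionRing R := QuadraticAlgebra.lift ⟨0, by simp⟩
  let v : QuadraticAlgebra R 0 d →ₐ[R] FractionRing R :=
    QuadraticAlgebra.lift ⟨algebraMap R _ d, by simp [Algebra.smul_def]⟩
  let g : QuadraticAlgebra R 0 d →ₐ[R] TrivSqZeroExt K K :=
    QuadraticAlgebra.lift ⟨TrivSqZeroExt.inr 1, by
      rw [TrivSqZeroExt.inr_mul_inr, zero_smul, zero_add, ← TrivSqZeroExt.inr_smul,
        Algebra.smul_def, hd, zero_mul, TrivSqZeroExt.inr_zero]⟩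
  have hu : u QuadraticAlgebra.omega = 0 := by
    simp [u]
  have hv : v QuadraticAlgebra.omega = algebraMap R (FractionRing R) d := by
    simp [v]
  have hg : g QuadraticAlgebra.omega = TrivSqZeroExt.inr 1 := by
    simp [g]
  -- The element a + bω takes the values a and a + bd, and d ≠ 0.
  have huv : ∀ x, u x = 0 → v x = 0 → x = 0 := by
    intro x hx hx'
    have e1 : x.re = 0 := by simpa [u, Algebra.smul_def] using hx
    have e2 : x.im = 0 := by simpa [v, Algebra.smul_def, e1, hd0] using hx'
    exact QuadraticAlgebra.ext e1 e2
  have hw : (Spec.map (CommRingCat.ofHom (TrivSqZeroExt.inlAlgHom R K K).toRingHom) ≫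
      W.model.fromSpecResidueField z) ≫ W.modelHom = Spec.map (CommRingCat.ofHom g.toRingHom) ≫
      Spec.map (CommRingCat.ofHom (algebraMap R (QuadraticAlgebra R 0 d))) := by
    have e : W.model.fromSpecResidueField z ≫ W.modelHom =
        Spec.map (CommRingCat.ofHom (algebraMap R K)) :=
      (congrArg (· ≫ W.modelHom) hφ).trans (W.pt_modelHom φ 2 h)
    rw [Category.assoc, e, ← Spec.map_comp, ← Spec.map_comp, ← CommRingCat.ofHom_comp,
      ← CommRingCat.ofHom_comp]
    exact congrArg (fun f : R →+* TrivSqZeroExt K K => Spec.map (CommRingCat.ofHom f))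
      g.comp_algebraMap.symm
  exact deformAut_act_ne h2 h1 h3 hω h hε hg
    (congrArg (Spec.map (CommRingCat.ofHom (TrivSqZeroExt.inlAlgHom R K K).toRingHom) ≫ ·) hφ) hw
    (hz _ _ hw _ (W.baseChange_deformAut_mem_effectiveModel h2 h1 h3 hω hu hv huv _))

end WeierstrassCurve

/-! ### Second-order jets -/

section

variable (K : Type u) [Field K]

/-- The ring `K[t] / (t³)`. -/
abbrev Jet : Type u := AdjoinRoot (Polynomial.X ^ 3 : Polynomial K)

namespace Jet

/-- The residue class of `t` in `K[t] / (t³)`. -/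
abbrev t : Jet K := AdjoinRoot.root _

lemma t_pow_three : t K ^ 3 = 0 :=
  (map_pow (AdjoinRoot.mk (Polynomial.X ^ 3 : Polynomial K)) Polynomial.X 3).symm.trans
    AdjoinRoot.mk_self

variable {K}

lemma exists_eq (x : Jet K) : ∃ a b c : K,
    x = algebraMap K _ a + algebraMap K _ b * t K + algebraMap K _ c * t K ^ 2 := by
  have key (x : Jet K) : ∃ (a : K) (y : Jet K), x = algebraMap K _ a + t K * y := by
    obtain ⟨p, rfl⟩ := AdjoinRoot.mk_surjective x
    refine ⟨p.coeff 0, AdjoinRoot.mk _ p.divX, ?_⟩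
    conv_lhs => rw [← p.X_mul_divX_add]
    rw [map_add, map_mul, AdjoinRoot.mk_X, AdjoinRoot.mk_C, add_comm]
    rfl
  obtain ⟨a, y, rfl⟩ := key x
  obtain ⟨b, z, rfl⟩ := key y
  obtain ⟨c, w, rfl⟩ := key z
  exact ⟨a, b, c, by linear_combination w * t_pow_three K⟩

lemma eq_zero_of_eq_zero {a b c : K}
    (h : algebraMap K _ a + algebraMap K _ b * t K + algebraMap K _ c * t K ^ 2 = 0) :
    a = 0 ∧ b = 0 ∧ c = 0 := by
  have h1 : AdjoinRoot.mk (Polynomial.X ^ 3 : Polynomial K) (Polynomial.C a +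
      Polynomial.C b * Polynomial.X + Polynomial.C c * Polynomial.X ^ 2) = 0 := by
    rw [← h]
    simp only [map_add, map_mul, map_pow, AdjoinRoot.mk_X, AdjoinRoot.mk_C]
    rfl
  rw [AdjoinRoot.mk_eq_zero, Polynomial.X_pow_dvd_iff] at h1
  have e0 := h1 0 (by norm_num)
  have e1 := h1 1 (by norm_num)
  have e2 := h1 2 (by norm_num)
  simp [Polynomial.coeff_X, Polynomial.coeff_C, Polynomial.coeff_X_pow] at e0 e1 e2
  exact ⟨e0, e1, e2⟩

lemma isUnit_of_ne_zero {a b c : K} (ha : a ≠ 0) :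
    IsUnit (algebraMap K _ a + algebraMap K _ b * t K + algebraMap K _ c * t K ^ 2) := by
  rw [add_assoc]
  have h : IsNilpotent (algebraMap K _ b * t K + algebraMap K _ c * t K ^ 2) :=
    ⟨3, by linear_combination (algebraMap K _ b + algebraMap K _ c * t K) ^ 3 * t_pow_three K⟩
  exact h.isUnit_add_left_of_commute ((isUnit_iff_ne_zero.2 ha).map _) (Commute.all _ _)

instance : IsLocalRing (Jet K) := by
  have : Nontrivial (Jet K) := AdjoinRoot.nontrivial _ (by simp)
  refine IsLocalRing.of_isUnit_or_isUnit_one_sub_self fun x => ?_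
  obtain ⟨a, b, c, rfl⟩ := exists_eq x
  by_cases ha : a = 0
  · right
    have := isUnit_of_ne_zero (a := (1 : K)) (b := -b) (c := -c) one_ne_zero
    convert this using 1
    simp [ha]
    ring
  · exact .inl (isUnit_of_ne_zero ha)

variable (K) in
/-- The residue class map `K[t] / (t³) → K[t] / (t²)`. -/
def toDual : Jet K →ₐ[K] TrivSqZeroExt K K :=
  AdjoinRoot.liftAlgHom _ (Algebra.ofId K _) (TrivSqZeroExt.inr 1)
    (by simp [pow_succ])

@[simp] lemma toDual_eq (a b c : K) : toDual K (algebraMap K _ a + algebraMap K _ b * t K +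
    algebraMap K _ c * t K ^ 2) = TrivSqZeroExt.inl a + TrivSqZeroExt.inr b := by
  have h : toDual K (t K) = TrivSqZeroExt.inr 1 := AdjoinRoot.liftAlgHom_root _ _ _ _
  have e (r : K) : algebraMap K (TrivSqZeroExt K K) r = TrivSqZeroExt.inl r := rfl
  simp only [map_add, map_mul, map_pow, AlgHom.commutes, h, e]
  ext <;> simp [pow_two]

instance : IsLocalHom (toDual K).toRingHom := by
  constructor
  intro x hx
  obtain ⟨a, b, c, rfl⟩ := exists_eq x
  refine isUnit_of_ne_zero ?_
  have h := hx.map (TrivSqZeroExt.fstHom K K K)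
  have e : (toDual K).toRingHom (algebraMap K _ a + algebraMap K _ b * t K +
    algebraMap K _ c * t K ^ 2) = TrivSqZeroExt.inl a + TrivSqZeroExt.inr b := toDual_eq a b c
  rw [e] at h
  simpa using h

end Jet

/-- The endomorphism `t ↦ ct` of `K[t] / (t²)`. -/
abbrev dualScale {K : Type u} [Field K] (c : K) : TrivSqZeroExt K K →ₐ[K] TrivSqZeroExt K K :=
  TrivSqZeroExt.map (c • LinearMap.id)

instance {K : Type u} [Field K] (c : K) : IsLocalHom (dualScale c).toRingHom := by
  constructor
  intro x hx
  have h := hx.map (TrivSqZeroExt.fstHom K K K)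
  rw [TrivSqZeroExt.isUnit_iff_isUnit_fst]
  have e : (TrivSqZeroExt.fstHom K K K) ((dualScale c).toRingHom x) = x.fst := 
    TrivSqZeroExt.fst_map _ _
  rwa [e] at h

end

/-! ### The Weierstrass equation for first-order and second-order jets -/

namespace WeierstrassCurve

variable {K : Type u} [Field K] (W : WeierstrassCurve K) {x y p q : K}

lemma eqn_dual_iff : W.Eqn (A := TrivSqZeroExt K K) ![TrivSqZeroExt.inl x + TrivSqZeroExt.inr p,
      TrivSqZeroExt.inl y + TrivSqZeroExt.inr q, 1] ↔
    W.Eqn ![x, y, 1] ∧ (2 * y + W.a₁ * x + W.a₃) * q =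
      (3 * x ^ 2 + 2 * W.a₂ * x + W.a₄ - W.a₁ * y) * p := by
  have e : ∀ r : K, algebraMap K (TrivSqZeroExt K K) r = TrivSqZeroExt.inl r := fun r => rfl
  simp only [Eqn, e, Matrix.cons_val_zero, Matrix.cons_val_one, Matrix.cons_val,
    TrivSqZeroExt.ext_iff]
  refine and_congr ?_ ?_
  · simp
  · simp [pow_succ]
    constructor <;> intro h
    · linear_combination h
    · linear_combination h

/-- These are the coefficients of 1, t and t². At a singular point the last one reduces to the
tangent cone q² + a₁pq - (3x + a₂)p². -/
lemma eqn_jet_iff {p' q' : K} : W.Eqn (A := Jet K)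
      ![algebraMap K _ x + algebraMap K _ p * Jet.t K + algebraMap K _ p' * Jet.t K ^ 2,
        algebraMap K _ y + algebraMap K _ q * Jet.t K + algebraMap K _ q' * Jet.t K ^ 2, 1] ↔
    W.Eqn ![x, y, 1] ∧ (2 * y + W.a₁ * x + W.a₃) * q =
      (3 * x ^ 2 + 2 * W.a₂ * x + W.a₄ - W.a₁ * y) * p ∧
    (2 * y + W.a₁ * x + W.a₃) * q' + q ^ 2 + W.a₁ * p * q - (3 * x + W.a₂) * p ^ 2 =
      (3 * x ^ 2 + 2 * W.a₂ * x + W.a₄ - W.a₁ * y) * p' := by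
  have key : (algebraMap K _ y + algebraMap K _ q * Jet.t K + algebraMap K _ q' * Jet.t K ^ 2) ^ 2 +
      algebraMap K _ W.a₁ *
        (algebraMap K _ x + algebraMap K _ p * Jet.t K + algebraMap K _ p' * Jet.t K ^ 2) *
        (algebraMap K _ y + algebraMap K _ q * Jet.t K + algebraMap K _ q' * Jet.t K ^ 2) +
      algebraMap K _ W.a₃ *
        (algebraMap K _ y + algebraMap K _ q * Jet.t K + algebraMap K _ q' * Jet.t K ^ 2) -
      ((algebraMap K _ x + algebraMap K _ p * Jet.t K + algebraMap K _ p' * Jet.t K ^ 2) ^ 3 +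
      algebraMap K _ W.a₂ *
        (algebraMap K _ x + algebraMap K _ p * Jet.t K + algebraMap K _ p' * Jet.t K ^ 2) ^ 2 +
      algebraMap K _ W.a₄ *
        (algebraMap K _ x + algebraMap K _ p * Jet.t K + algebraMap K _ p' * Jet.t K ^ 2) +
      algebraMap K _ W.a₆) =
      algebraMap K (Jet K) (y ^ 2 + W.a₁ * x * y + W.a₃ * y -
        (x ^ 3 + W.a₂ * x ^ 2 + W.a₄ * x + W.a₆)) +
      algebraMap K (Jet K) ((2 * y + W.a₁ * x + W.a₃) * q -
        (3 * x ^ 2 + 2 * W.a₂ * x + W.a₄ - W.a₁ * y) * p) * Jet.t K +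
      algebraMap K (Jet K) ((2 * y + W.a₁ * x + W.a₃) * q' + q ^ 2 + W.a₁ * p * q -
        (3 * x + W.a₂) * p ^ 2 - (3 * x ^ 2 + 2 * W.a₂ * x + W.a₄ - W.a₁ * y) * p') *
        Jet.t K ^ 2 := by
    simp only [map_add, map_sub, map_mul, map_pow, map_ofNat]
    generalize algebraMap K (Jet K) W.a₁ = a₁
    generalize algebraMap K (Jet K) W.a₂ = a₂
    generalize algebraMap K (Jet K) W.a₃ = a₃
    generalize algebraMap K (Jet K) W.a₄ = a₄
    generalize algebraMap K (Jet K) W.a₆ = a₆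
    generalize algebraMap K (Jet K) x = x
    generalize algebraMap K (Jet K) y = y
    generalize algebraMap K (Jet K) p = p
    generalize algebraMap K (Jet K) q = q
    generalize algebraMap K (Jet K) p' = p'
    generalize algebraMap K (Jet K) q' = q'
    have ht := Jet.t_pow_three K
    generalize Jet.t K = t at *
    linear_combination (2 * q * q' + q' ^ 2 * t + a₁ * (p * q' + p' * q + p' * q' * t) -
      (p ^ 3 + 6 * x * p * p' + (3 * x * p' ^ 2 + 3 * p ^ 2 * p') * t + 3 * p * p' ^ 2 * t ^ 2 +
        p' ^ 3 * t ^ 3) - a₂ * (2 * p * p' + p' ^ 2 * t)) * ht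
  simp only [Eqn, Matrix.cons_val_zero, Matrix.cons_val_one, Matrix.cons_val, mul_one, one_pow]
  rw [← sub_eq_zero, key]
  constructor
  · intro h
    obtain ⟨h0, h1, h2⟩ := Jet.eq_zero_of_eq_zero h
    exact ⟨sub_eq_zero.1 h0, sub_eq_zero.1 h1, sub_eq_zero.1 h2⟩
  · rintro ⟨h0, h1, h2⟩
    simp only [Algebra.algebraMap_self, RingHom.id_apply] at h0
    rw [sub_eq_zero.2 h0, sub_eq_zero.2 h1, sub_eq_zero.2 h2]
    simp

end WeierstrassCurve

/-! ### Tangent vectors that lift to second order -/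

section

open IsLocalRing (closedPoint)

variable {K : Type u} [Field K] {X Y : Scheme.{u}} (f : X ⟶ Spec (.of K)) (g : Y ⟶ Spec (.of K))

/-- The tangent vector `v` lifts to a second-order jet. -/
def LiftsToJet (v : Spec (.of (TrivSqZeroExt K K)) ⟶ X) : Prop :=
  ∃ w : Spec (.of (Jet K)) ⟶ X, w ≫ f = Spec.map (CommRingCat.ofHom (algebraMap K (Jet K))) ∧
    Spec.map (CommRingCat.ofHom (Jet.toDual K).toRingHom) ≫ w = v

/-- At some rational point, not all tangent vectors lift to second order, and those that lift
form a line. -/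
def HasCuspidalPoint : Prop :=
  ∃ v w : Spec (.of (TrivSqZeroExt K K)) ⟶ X,
    v ≫ f = Spec.map (CommRingCat.ofHom (algebraMap K _)) ∧
    w ≫ f = Spec.map (CommRingCat.ofHom (algebraMap K _)) ∧
    -- Composition with ε ↦ 0 retains only the base point: v and w share it, and below v is required
    -- to be a nonzero vector.
    Spec.map (CommRingCat.ofHom (dualScale (0 : K)).toRingHom) ≫ v =
      Spec.map (CommRingCat.ofHom (dualScale (0 : K)).toRingHom) ≫ w ∧
    LiftsToJet f v ∧ ¬ LiftsToJet f w ∧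
    Spec.map (CommRingCat.ofHom (dualScale (0 : K)).toRingHom) ≫ v ≠ v ∧
    ∀ v' : Spec (.of (TrivSqZeroExt K K)) ⟶ X,
      v' ≫ f = Spec.map (CommRingCat.ofHom (algebraMap K _)) → LiftsToJet f v' →
      Spec.map (CommRingCat.ofHom (dualScale (0 : K)).toRingHom) ≫ v' =
        Spec.map (CommRingCat.ofHom (dualScale (0 : K)).toRingHom) ≫ v →
      ∃ c : K, v' = Spec.map (CommRingCat.ofHom (dualScale c).toRingHom) ≫ v

variable {f g}

lemma LiftsToJet.comp {v : Spec (.of (TrivSqZeroExt K K)) ⟶ X} (h : LiftsToJet f v) {σ : X ⟶ Y}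
    (hσ : σ ≫ g = f) : LiftsToJet g (v ≫ σ) := by
  obtain ⟨w, hw, rfl⟩ := h
  exact ⟨w ≫ σ, by rw [Category.assoc, hσ, hw], by rw [Category.assoc]⟩

lemma liftsToJet_comp_iff {v : Spec (.of (TrivSqZeroExt K K)) ⟶ X} {σ : X ≅ Y}
    (hσ : σ.hom ≫ g = f) : LiftsToJet g (v ≫ σ.hom) ↔ LiftsToJet f v := by
  refine ⟨fun h => ?_, fun h => h.comp hσ⟩
  have := h.comp (g := f) (σ := σ.inv) (by rw [Iso.inv_comp_eq, hσ])
  rwa [Category.assoc, Iso.hom_inv_id, Category.comp_id] at this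

/-- The condition only involves morphisms from fixed affine schemes, so it is an invariant of
K-isomorphism, independent of equations. -/
lemma HasCuspidalPoint.of_iso (h : HasCuspidalPoint f) (σ : X ≅ Y) (hσ : σ.hom ≫ g = f) :
    HasCuspidalPoint g := by
  obtain ⟨v, w, hv, hw, hvw, h1, h2, h3, h4⟩ := h
  refine ⟨v ≫ σ.hom, w ≫ σ.hom, by rw [Category.assoc, hσ, hv], by rw [Category.assoc, hσ, hw],
    by rw [← Category.assoc, hvw, Category.assoc], h1.comp hσ,
    by rwa [liftsToJet_comp_iff hσ], ?_, fun v' hv' hl he => ?_⟩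
  · rw [← Category.assoc]
    intro h
    exact h3 ((cancel_mono _).1 h)
  · obtain ⟨v', rfl⟩ : ∃ v'', v' = v'' ≫ σ.hom := ⟨v' ≫ σ.inv, by simp⟩
    rw [Category.assoc, hσ] at hv'
    rw [liftsToJet_comp_iff hσ] at hl
    rw [← Category.assoc, ← Category.assoc, cancel_mono] at he
    obtain ⟨c, hc⟩ := h4 v' hv' hl he
    exact ⟨c, by rw [← Category.assoc, ← hc]⟩

end

/-! ### Tangent vectors of plane cubics in coordinates -/

namespace WeierstrassCurve

open IsLocalRing (closedPoint)

lemma exists_pt_of_closedPoint_mem {R A : Type u} [CommRing R] (W : WeierstrassCurve R)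
    [CommRing A] [Algebra R A] [IsLocalRing A] (m : Spec (.of A) ⟶ W.model)
    (hm : m ≫ W.modelHom = Spec.map (CommRingCat.ofHom (algebraMap R A))) {i : Fin 3}
    (hi : m (closedPoint A) ∈ Proj.basicOpen W.grading (W.coord i)) :
    ∃ (φ : W.HomogCoordRing →ₐ[R] A) (h : φ (W.coord i) = 1), m = W.pt φ i h := by
  refine W.exists_pt m hm i fun x => ?_
  have h := Scheme.preimage_eq_top_of_closedPoint_mem m hi
  have : x ∈ m ⁻¹ᵁ Proj.basicOpen W.grading (W.coord i) := by
    rw [h]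
    trivial
  exact this

variable {K : Type u} [Field K] (W : WeierstrassCurve K) {x y p q x' y' p' q' : K}

/-- The tangent vector `(p, q)` at the point `(x, y)`. -/
def dualPt (h : W.Eqn (A := TrivSqZeroExt K K) ![TrivSqZeroExt.inl x + TrivSqZeroExt.inr p,
      TrivSqZeroExt.inl y + TrivSqZeroExt.inr q, 1]) :
    Spec (.of (TrivSqZeroExt K K)) ⟶ W.model :=
  W.pt (W.coordHom _ h) 2 (by simp)

section

variable (h : W.Eqn (A := TrivSqZeroExt K K) ![TrivSqZeroExt.inl x + TrivSqZeroExt.inr p,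
      TrivSqZeroExt.inl y + TrivSqZeroExt.inr q, 1])
  (h' : W.Eqn (A := TrivSqZeroExt K K) ![TrivSqZeroExt.inl x' + TrivSqZeroExt.inr p',
      TrivSqZeroExt.inl y' + TrivSqZeroExt.inr q', 1])

lemma dualPt_modelHom :
    W.dualPt h ≫ W.modelHom = Spec.map (CommRingCat.ofHom (algebraMap K _)) :=
  W.pt_modelHom _ _ _

lemma dualPt_inj (e : W.dualPt h = W.dualPt h') : x = x' ∧ y = y' ∧ p = p' ∧ q = q' := by
  have h0 := DFunLike.congr_fun (pt_injective e) (W.coord 0)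
  have h1 := DFunLike.congr_fun (pt_injective e) (W.coord 1)
  simp only [coordHom_coord, Matrix.cons_val_zero, Matrix.cons_val_one] at h0 h1
  exact ⟨by simpa using congrArg TrivSqZeroExt.fst h0, by simpa using congrArg TrivSqZeroExt.fst h1,
    by simpa using congrArg TrivSqZeroExt.snd h0, by simpa using congrArg TrivSqZeroExt.snd h1⟩

include h in
lemma eqn_dual_smul (c : K) : W.Eqn (A := TrivSqZeroExt K K)
    ![TrivSqZeroExt.inl x + TrivSqZeroExt.inr (c * p),
      TrivSqZeroExt.inl y + TrivSqZeroExt.inr (c * q), 1] := by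
  rw [eqn_dual_iff] at h ⊢
  exact ⟨h.1, by linear_combination c * h.2⟩

lemma dualScale_dualPt (c : K) : Spec.map (CommRingCat.ofHom (dualScale c).toRingHom) ≫
    W.dualPt h = W.dualPt (W.eqn_dual_smul h c) := by
  refine (specMap_pt _ _ _ _).trans ?_
  unfold dualPt
  congr 1
  apply algHom_ext
  intro i
  rw [AlgHom.comp_apply, coordHom_coord, coordHom_coord]
  fin_cases i
  · ext <;> simp [mul_comm]
  · ext <;> simp [mul_comm]
  · simp

variable {W} in
lemma exists_dualPt {v : Spec (.of (TrivSqZeroExt K K)) ⟶ W.model}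
    (hv : v ≫ W.modelHom = Spec.map (CommRingCat.ofHom (algebraMap K _)))
    (hv' : v (closedPoint _) ∈ Proj.basicOpen W.grading (W.coord 2)) :
    ∃ (x y p q : K) (h : _), v = W.dualPt (x := x) (y := y) (p := p) (q := q) h := by
  obtain ⟨φ, h, rfl⟩ := W.exists_pt_of_closedPoint_mem v hv hv'
  have e0 := TrivSqZeroExt.inl_fst_add_inr_snd_eq (φ (W.coord 0))
  have e1 := TrivSqZeroExt.inl_fst_add_inr_snd_eq (φ (W.coord 1))
  have he := W.eqn_algHom φ
  have hφ : (fun i => φ (W.coord i)) =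
      ![TrivSqZeroExt.inl (φ (W.coord 0)).fst + TrivSqZeroExt.inr (φ (W.coord 0)).snd,
        TrivSqZeroExt.inl (φ (W.coord 1)).fst + TrivSqZeroExt.inr (φ (W.coord 1)).snd, 1] := by
    funext i
    fin_cases i
    · exact e0.symm
    · exact e1.symm
    · exact h
  rw [hφ] at he
  refine ⟨_, _, _, _, he, ?_⟩
  unfold dualPt
  congr 1
  apply algHom_ext
  intro i
  rw [coordHom_coord, ← hφ]

lemma dualPt_mem : W.dualPt h (closedPoint _) ∈ Proj.basicOpen W.grading (W.coord 2) :=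
  W.mem_basicOpen_of_point (W.coord_mem 2) one_pos _ _

/-- A jet over an affine tangent vector stays in the same chart, and its part of order at most one
is prescribed. Only the coefficient of t² imposes a condition. -/
lemma liftsToJet_dualPt_iff : LiftsToJet W.modelHom (W.dualPt h) ↔ ∃ p' q',
    (2 * y + W.a₁ * x + W.a₃) * q' + q ^ 2 + W.a₁ * p * q - (3 * x + W.a₂) * p ^ 2 =
      (3 * x ^ 2 + 2 * W.a₂ * x + W.a₄ - W.a₁ * y) * p' := by
  constructor
  · rintro ⟨w, hw, e⟩
    have hmem : w (closedPoint _) ∈ Proj.basicOpen W.grading (W.coord 2) := by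
      have := closedPoint_eq_of_specMap (Jet.toDual K).toRingHom e
      rw [this]
      exact W.dualPt_mem h
    obtain ⟨φ, h', rfl⟩ := W.exists_pt_of_closedPoint_mem w hw hmem
    rw [specMap_pt] at e
    have e0 := DFunLike.congr_fun (pt_injective e) (W.coord 0)
    have e1 := DFunLike.congr_fun (pt_injective e) (W.coord 1)
    simp only [AlgHom.comp_apply, coordHom_coord, Matrix.cons_val_zero,
      Matrix.cons_val_one] at e0 e1
    obtain ⟨a, b, c, hx⟩ := Jet.exists_eq (φ (W.coord 0))
    obtain ⟨a', b', c', hy⟩ := Jet.exists_eq (φ (W.coord 1))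
    rw [hx, Jet.toDual_eq] at e0
    rw [hy, Jet.toDual_eq] at e1
    obtain rfl : a = x := by simpa using congrArg TrivSqZeroExt.fst e0
    obtain rfl : b = p := by simpa using congrArg TrivSqZeroExt.snd e0
    obtain rfl : a' = y := by simpa using congrArg TrivSqZeroExt.fst e1
    obtain rfl : b' = q := by simpa using congrArg TrivSqZeroExt.snd e1
    have he := W.eqn_algHom φ
    have hφ : (fun i => φ (W.coord i)) = ![φ (W.coord 0), φ (W.coord 1), 1] := by
      funext i
      fin_cases i
      · rfl
      · rfl
      · exact h'
    rw [hφ, hx, hy, eqn_jet_iff] at he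
    exact ⟨_, _, he.2.2⟩
  · rintro ⟨p', q', e⟩
    rw [eqn_dual_iff] at h
    have hj := W.eqn_jet_iff.2 ⟨h.1, h.2, e⟩
    refine ⟨W.pt (W.coordHom _ hj) 2 (by simp), W.pt_modelHom _ _ _, ?_⟩
    refine (specMap_pt _ _ _ _).trans ?_
    unfold dualPt
    congr 1
    apply algHom_ext
    intro i
    rw [AlgHom.comp_apply, coordHom_coord, coordHom_coord]
    fin_cases i
    · exact Jet.toDual_eq _ _ _
    · exact Jet.toDual_eq _ _ _
    · simp

/-- The only point outside the chart is (0 : 1 : 0), with tangent vectors (εp : 1 : 0). They lift to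
(pt : 1 : 0), because t³ = 0. -/
lemma liftsToJet_of_notMem {v : Spec (.of (TrivSqZeroExt K K)) ⟶ W.model}
    (hv : v ≫ W.modelHom = Spec.map (CommRingCat.ofHom (algebraMap K _)))
    (hv' : v (closedPoint _) ∉ Proj.basicOpen W.grading (W.coord 2)) :
    LiftsToJet W.modelHom v := by
  have h1 := (W.mem_basicOpen_or (v (closedPoint _))).resolve_right hv'
  obtain ⟨φ, h, rfl⟩ := W.exists_pt_of_closedPoint_mem v hv h1
  have hz : ¬ IsUnit (φ (W.coord 2)) := by
    intro hu
    apply hv'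
    have h3 := W.mem_basicOpen_of_point (φ := φ.toRingHom) (W.coord_mem 2) one_pos hu
      (closedPoint _)
    rw [← ProjPoint.point_congr (𝒜 := W.grading) φ.toRingHom (W.coord_mem 1) one_pos
      (by change IsUnit (φ _); simp [h])] at h3
    exact h3
  rw [TrivSqZeroExt.isUnit_iff_isUnit_fst, isUnit_iff_ne_zero, not_not] at hz
  have he := W.eqn_algHom φ
  have e : ∀ r : K, algebraMap K (TrivSqZeroExt K K) r = TrivSqZeroExt.inl r := fun r => rfl
  simp only [Eqn, h, e] at he
  have e0 : (φ (W.coord 0)).fst = 0 := by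
    have := congrArg TrivSqZeroExt.fst he
    simp only [TrivSqZeroExt.fst_add, TrivSqZeroExt.fst_mul, TrivSqZeroExt.fst_pow,
      TrivSqZeroExt.fst_one, TrivSqZeroExt.fst_inl, hz] at this
    exact pow_eq_zero_iff three_ne_zero |>.1 (by linear_combination -this)
  have e2 : (φ (W.coord 2)).snd = 0 := by
    have := congrArg TrivSqZeroExt.snd he
    simpa [hz, e0, pow_succ] using this
  obtain ⟨p, hp⟩ : ∃ p, φ (W.coord 0) = TrivSqZeroExt.inr p :=
    ⟨_, TrivSqZeroExt.ext (by simpa using e0) rfl⟩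
  have h2 : φ (W.coord 2) = 0 := TrivSqZeroExt.ext hz e2
  have hj : W.Eqn ![algebraMap K _ p * Jet.t K, 1, 0] := by
    simp only [Eqn, Matrix.cons_val_zero, Matrix.cons_val_one, Matrix.cons_val]
    linear_combination -algebraMap K _ p ^ 3 * Jet.t_pow_three K
  refine ⟨W.pt (W.coordHom _ hj) 1 (by simp), W.pt_modelHom _ _ _, ?_⟩
  refine (specMap_pt _ _ _ _).trans ?_
  congr 1
  apply algHom_ext
  intro i
  rw [AlgHom.comp_apply, coordHom_coord]
  fin_cases i
  · have := Jet.toDual_eq 0 p 0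
    simp only [map_zero, zero_mul, add_zero, zero_add, TrivSqZeroExt.inl_zero] at this
    exact this.trans hp.symm
  · simp [h]
  · simp [h2]

end

end WeierstrassCurve

/-! ### Cuspidal points of plane cubics in characteristic two -/

namespace WeierstrassCurve

open IsLocalRing (closedPoint)

variable {K : Type u} [Field K] (W : WeierstrassCurve K)

lemma dualPt_congr {x y p q x' y' p' q' : K} (h : W.Eqn (A := TrivSqZeroExt K K)
      ![TrivSqZeroExt.inl x + TrivSqZeroExt.inr p, TrivSqZeroExt.inl y + TrivSqZeroExt.inr q, 1])
    (h' : W.Eqn (A := TrivSqZeroExt K K) ![TrivSqZeroExt.inl x' + TrivSqZeroExt.inr p',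
      TrivSqZeroExt.inl y' + TrivSqZeroExt.inr q', 1]) (hx : x = x') (hy : y = y') (hp : p = p')
    (hq : q = q') : W.dualPt h = W.dualPt h' := by
  subst hx hy hp hq
  rfl

lemma mem_of_dualScale_comp_eq {v w : Spec (.of (TrivSqZeroExt K K)) ⟶ W.model} {c : K}
    (e : Spec.map (CommRingCat.ofHom (dualScale c).toRingHom) ≫ v =
      Spec.map (CommRingCat.ofHom (dualScale c).toRingHom) ≫ w)
    (hw : w (closedPoint _) ∈ Proj.basicOpen W.grading (W.coord 2)) :
    v (closedPoint _) ∈ Proj.basicOpen W.grading (W.coord 2) := by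
  rw [closedPoint_eq_of_specMap (dualScale c).toRingHom e]
  rwa [← closedPoint_eq_of_specMap (dualScale c).toRingHom (m := w) rfl]

/-- At the origin of y² = x³, a vector (p, q) lifts if and only if q² = 0. So (1, 0) spans the
lifting vectors, and (0, 1) does not lift. -/
lemma hasCuspidalPoint (h1 : W.a₁ = 0) (h2 : W.a₂ = 0) (h3 : W.a₃ = 0) (h4 : W.a₄ = 0)
    (h6 : W.a₆ = 0) : HasCuspidalPoint W.modelHom := by
  have he (p q : K) : W.Eqn (A := TrivSqZeroExt K K)
      ![TrivSqZeroExt.inl 0 + TrivSqZeroExt.inr p, TrivSqZeroExt.inl 0 + TrivSqZeroExt.inr q, 1] := by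
    rw [eqn_dual_iff]
    simp [h1, h3, h4, h6, Eqn]
  have hl (p q : K) : LiftsToJet W.modelHom (W.dualPt (he p q)) ↔ q = 0 := by
    rw [liftsToJet_dualPt_iff]
    simp [h1, h2, h3, h4]
  refine ⟨W.dualPt (he 1 0), W.dualPt (he 0 1), W.dualPt_modelHom _, W.dualPt_modelHom _, ?_,
    (hl _ _).2 rfl, fun h => one_ne_zero ((hl _ _).1 h), ?_, fun v' hv' hl' e => ?_⟩
  · rw [dualScale_dualPt, dualScale_dualPt]
    apply dualPt_congr <;> simp
  · rw [dualScale_dualPt]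
    intro h
    have := (W.dualPt_inj _ _ h).2.2.1
    simp at this
  · obtain ⟨x, y, p, q, h, rfl⟩ := exists_dualPt hv'
      (W.mem_of_dualScale_comp_eq e (W.dualPt_mem _))
    rw [dualScale_dualPt, dualScale_dualPt] at e
    obtain ⟨rfl, rfl, -, -⟩ := W.dualPt_inj _ _ e
    obtain rfl := (hl p q).1 hl'
    refine ⟨p, ?_⟩
    rw [dualScale_dualPt]
    apply dualPt_congr <;> simp

/-- If (p, q) lies on the tangent cone q² + a₁pq - (3x + a₂)p² = 0, so does (p, -q - a₁p). When the
solutions form a line with p ≠ 0, the two agree, and a₁p = -2q = 0. -/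
lemma a₁_eq_zero_of_hasCuspidalPoint [CharP K 2] (h : HasCuspidalPoint W.modelHom) : W.a₁ = 0 := by
  obtain ⟨v, w, hv, hw, hvw, h1, h2, h3, h4⟩ := h
  have hw' : w (closedPoint _) ∈ Proj.basicOpen W.grading (W.coord 2) :=
    not_not.1 fun h => h2 (W.liftsToJet_of_notMem hw h)
  obtain ⟨x', y', p', q', he', rfl⟩ := exists_dualPt hw hw'
  obtain ⟨x, y, p, q, he, rfl⟩ := exists_dualPt hv (W.mem_of_dualScale_comp_eq hvw hw')
  rw [dualScale_dualPt, dualScale_dualPt] at hvw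
  obtain ⟨rfl, rfl, -, -⟩ := W.dualPt_inj _ _ hvw
  rw [liftsToJet_dualPt_iff] at h1 h2
  -- With a nonzero partial derivative the second-order equation would be solvable, and w would
  -- lift.
  have hy : 2 * y + W.a₁ * x + W.a₃ = 0 := by
    by_contra hne
    refine h2 ⟨0, (2 * y + W.a₁ * x + W.a₃)⁻¹ *
      (-(q' ^ 2 + W.a₁ * p' * q' - (3 * x + W.a₂) * p' ^ 2)), ?_⟩
    rw [mul_inv_cancel_left₀ hne]
    ring
  have hx : 3 * x ^ 2 + 2 * W.a₂ * x + W.a₄ - W.a₁ * y = 0 := by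
    by_contra hne
    refine h2 ⟨(3 * x ^ 2 + 2 * W.a₂ * x + W.a₄ - W.a₁ * y)⁻¹ *
      (q' ^ 2 + W.a₁ * p' * q' - (3 * x + W.a₂) * p' ^ 2), 0, ?_⟩
    rw [mul_inv_cancel_left₀ hne]
    ring
  obtain ⟨_, _, h1⟩ := h1
  rw [hx, hy, zero_mul, zero_mul, zero_add] at h1
  -- For p = 0 the tangent cone gives q² = 0, and v would be the zero vector.
  have hp : p ≠ 0 := by
    rintro rfl
    obtain rfl : q = 0 := pow_eq_zero_iff two_ne_zero |>.1 (by linear_combination h1)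
    apply h3
    rw [dualScale_dualPt]
    apply dualPt_congr <;> simp
  have he₂ : W.Eqn (A := TrivSqZeroExt K K) ![TrivSqZeroExt.inl x + TrivSqZeroExt.inr p,
      TrivSqZeroExt.inl y + TrivSqZeroExt.inr (-q - W.a₁ * p), 1] := by
    rw [eqn_dual_iff] at he ⊢
    exact ⟨he.1, by rw [hx, hy]; simp⟩
  obtain ⟨c, hc⟩ := h4 (W.dualPt he₂) (W.dualPt_modelHom _)
    ((W.liftsToJet_dualPt_iff _).2 ⟨0, 0, by rw [hx, hy]; linear_combination h1⟩) (by
      rw [dualScale_dualPt, dualScale_dualPt]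
      apply dualPt_congr <;> simp)
  rw [dualScale_dualPt] at hc
  obtain ⟨-, -, e1, e2⟩ := W.dualPt_inj _ _ hc
  obtain rfl : c = 1 := mul_right_cancel₀ hp (by rw [one_mul, ← e1])
  have e3 : W.a₁ * p = 0 := by
    have : (2 : K) = 0 := CharTwo.two_eq_zero
    linear_combination -e2 - q * this
  exact (mul_eq_zero.1 e3).resolve_right hp

/-! ### Closed fibers of additive type -/

section

variable {R : Type u} [CommRing R] [IsLocalRing R] (W : WeierstrassCurve R)

/-- Base change of the closed fiber to an extension field. -/
lemma isPullback_closedFiber (K : Type u) [Field K] [Algebra R K]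
    [Algebra (IsLocalRing.ResidueField R) K] [IsScalarTower R (IsLocalRing.ResidueField R) K] :
    IsPullback (pullback.fst W.closedFiberHom
        (Spec.map (CommRingCat.ofHom (algebraMap (IsLocalRing.ResidueField R) K))) ≫
        pullback.fst W.modelHom (Spec.map (CommRingCat.ofHom (IsLocalRing.residue R))))
      (pullback.snd W.closedFiberHom
        (Spec.map (CommRingCat.ofHom (algebraMap (IsLocalRing.ResidueField R) K)))) W.modelHom
      (Spec.map (CommRingCat.ofHom (algebraMap R K))) := by
  have h := (IsPullback.of_hasPullback W.closedFiberHom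
    (Spec.map (CommRingCat.ofHom (algebraMap (IsLocalRing.ResidueField R) K)))).paste_horiz
    (IsPullback.of_hasPullback W.modelHom (Spec.map (CommRingCat.ofHom (IsLocalRing.residue R))))
  rw [← Spec.map_comp, ← CommRingCat.ofHom_comp] at h
  rw [IsScalarTower.algebraMap_eq R (IsLocalRing.ResidueField R) K]
  exact h

/-- Over K both fiber products are identified with Weierstrass models over K, to which the
coordinate computations apply. -/
lemma hasAdditiveClosedFiber_iff : W.HasAdditiveClosedFiber ↔
    ∃ (K : Type u) (_ : Field K) (_ : Algebra R K) (_ : Algebra (IsLocalRing.ResidueField R) K)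
      (_ : IsScalarTower R (IsLocalRing.ResidueField R) K)
      (σ : (W.map (algebraMap R K)).model ≅
        ((cuspidalCubic (IsLocalRing.ResidueField R)).map (algebraMap _ K)).model),
      σ.hom ≫ modelHom _ = modelHom _ := by
  constructor
  · rintro ⟨K, _, _, e, he⟩
    let : Algebra R K := ((algebraMap (IsLocalRing.ResidueField R) K).comp
      (IsLocalRing.residue R)).toAlgebra
    have : IsScalarTower R (IsLocalRing.ResidueField R) K := IsScalarTower.of_algebraMap_eq fun _ => rfl
    have h1 := W.isPullback_baseHom K
    have h2 := W.isPullback_closedFiber K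
    have h3 := (cuspidalCubic (IsLocalRing.ResidueField R)).isPullback_baseHom K
    refine ⟨K, _, _, _, this, h1.isoIsPullback _ _ h2 ≪≫ e ≪≫ h3.isoPullback.symm, ?_⟩
    rw [Iso.trans_hom, Iso.trans_hom, Category.assoc, Category.assoc, Iso.symm_hom,
      h3.isoPullback_inv_snd, he, h1.isoIsPullback_hom_snd]
  · rintro ⟨K, _, _, _, _, σ, hσ⟩
    have h1 := W.isPullback_baseHom K
    have h2 := W.isPullback_closedFiber K
    have h3 := (cuspidalCubic (IsLocalRing.ResidueField R)).isPullback_baseHom K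
    refine ⟨K, _, _, h2.isoIsPullback _ _ h1 ≪≫ σ ≪≫ h3.isoPullback, ?_⟩
    rw [Iso.trans_hom, Iso.trans_hom, Category.assoc, Category.assoc,
      h3.isoPullback_hom_snd, hσ, h2.isoIsPullback_hom_snd]

lemma residue_a₁_eq_zero [CharP (IsLocalRing.ResidueField R) 2] (h : W.HasAdditiveClosedFiber) :
    IsLocalRing.residue R W.a₁ = 0 := by
  obtain ⟨K, _, _, _, _, σ, hσ⟩ := W.hasAdditiveClosedFiber_iff.1 h
  have : CharP K 2 := charP_of_injective_algebraMap
    (algebraMap (IsLocalRing.ResidueField R) K).injective 2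
  have h1 : HasCuspidalPoint
      ((cuspidalCubic (IsLocalRing.ResidueField R)).map (algebraMap _ K)).modelHom := by
    apply hasCuspidalPoint <;> simp [cuspidalCubic]
  have h2 := (W.map (algebraMap R K)).a₁_eq_zero_of_hasCuspidalPoint
    (h1.of_iso σ.symm (by rw [Iso.symm_hom, Iso.inv_comp_eq, hσ]))
  rw [map_a₁, IsScalarTower.algebraMap_apply R (IsLocalRing.ResidueField R) K] at h2
  exact (map_eq_zero _).1 h2

end

section

variable (V : WeierstrassCurve K)

/-- In characteristic two, a curve with `a₁ = a₃ = 0` becomes the cuspidal cubic after a change of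
coordinates `X ↦ X + rZ`, `Y ↦ Y + sX + uZ`. -/
def cuspidalSubst [CharP K 2] (h1 : W.a₁ = 0) (h3 : W.a₃ = 0) {r s u : K} (hr : r ^ 2 = W.a₄)
    (hs : s ^ 2 = r + W.a₂) (hu : u ^ 2 = r ^ 3 + W.a₂ * r ^ 2 + W.a₄ * r + W.a₆)
    (v1 : V.a₁ = 0) (v2 : V.a₂ = 0) (v3 : V.a₃ = 0) (v4 : V.a₄ = 0) (v6 : V.a₆ = 0) :
    SubstEquiv W V where
  hom := ![V.coord 0 + algebraMap K _ r * V.coord 2,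
    V.coord 1 + algebraMap K _ s * V.coord 0 + algebraMap K _ u * V.coord 2, V.coord 2]
  inv := ![W.coord 0 - algebraMap K _ r * W.coord 2,
    W.coord 1 - algebraMap K _ s * (W.coord 0 - algebraMap K _ r * W.coord 2) -
      algebraMap K _ u * W.coord 2, W.coord 2]
  eqn_hom := by
    have h := V.eqn_coord
    have h2 : (2 : V.HomogCoordRing) = 0 := by
      rw [← map_ofNat (algebraMap K V.HomogCoordRing), CharTwo.two_eq_zero, map_zero]
    simp only [Eqn, h1, h3, v1, v2, v3, v4, v6, map_zero, Matrix.cons_val_zero,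
      Matrix.cons_val_one, Matrix.cons_val] at h ⊢
    replace hr := congrArg (algebraMap K V.HomogCoordRing) hr
    replace hs := congrArg (algebraMap K V.HomogCoordRing) hs
    replace hu := congrArg (algebraMap K V.HomogCoordRing) hu
    simp only [map_add, map_mul, map_pow] at hr hs hu
    generalize algebraMap K V.HomogCoordRing r = r at *
    generalize algebraMap K V.HomogCoordRing s = s at *
    generalize algebraMap K V.HomogCoordRing u = u at *
    generalize algebraMap K V.HomogCoordRing W.a₂ = a₂ at *
    generalize V.coord 0 = X at *
    generalize V.coord 1 = Y at *
    generalize V.coord 2 = Z at *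
    -- Squaring is additive here: s removes the term X²Z, r the term XZ², and u the term Z³.
    linear_combination h + X ^ 2 * Z * hs + X * Z ^ 2 * hr + Z ^ 3 * hu +
      (Y * s * X * Z + Y * u * Z ^ 2 + s * u * X * Z ^ 2 - r * X ^ 2 * Z - 2 * r ^ 2 * X * Z ^ 2 -
        a₂ * r * X * Z ^ 2) * h2
  eqn_inv := by
    have h := W.eqn_coord
    have h2 : (2 : W.HomogCoordRing) = 0 := by
      rw [← map_ofNat (algebraMap K W.HomogCoordRing), CharTwo.two_eq_zero, map_zero]
    simp only [Eqn, h1, h3, v1, v2, v3, v4, v6, map_zero, Matrix.cons_val_zero,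
      Matrix.cons_val_one, Matrix.cons_val] at h ⊢
    replace hr := congrArg (algebraMap K W.HomogCoordRing) hr
    replace hs := congrArg (algebraMap K W.HomogCoordRing) hs
    replace hu := congrArg (algebraMap K W.HomogCoordRing) hu
    simp only [map_add, map_mul, map_pow] at hr hs hu
    generalize algebraMap K W.HomogCoordRing r = r at *
    generalize algebraMap K W.HomogCoordRing s = s at *
    generalize algebraMap K W.HomogCoordRing u = u at *
    generalize algebraMap K W.HomogCoordRing W.a₂ = a₂ at *
    generalize algebraMap K W.HomogCoordRing W.a₆ = a₆ at *
    generalize W.coord 0 = X at *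
    generalize W.coord 1 = Y at *
    generalize W.coord 2 = Z at *
    linear_combination h + (X - r * Z) ^ 2 * Z * hs + Z ^ 3 * hu - (X * Z ^ 2 + r * Z ^ 3) * hr +
      (-Y * s * (X - r * Z) * Z - Y * u * Z ^ 2 + s * (X - r * Z) * u * Z ^ 2 + 2 * r * X ^ 2 * Z -
        2 * r ^ 2 * X * Z ^ 2 + 2 * r ^ 3 * Z ^ 3 + a₂ * X ^ 2 * Z - a₂ * r * X * Z ^ 2 +
        a₂ * r ^ 2 * Z ^ 3 + a₆ * Z ^ 3) * h2
  hom_mem i := by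
    have hm (a : K) (j : Fin 3) : algebraMap K _ a * V.coord j ∈ V.grading 1 := by
      rw [← Algebra.smul_def]
      exact Submodule.smul_mem _ a (V.coord_mem j)
    fin_cases i
    · exact add_mem (V.coord_mem 0) (hm _ _)
    · exact add_mem (add_mem (V.coord_mem 1) (hm _ _)) (hm _ _)
    · exact V.coord_mem 2
  inv_mem i := by
    have hm (a : K) {x : W.HomogCoordRing} (hx : x ∈ W.grading 1) :
        algebraMap K _ a * x ∈ W.grading 1 := by
      rw [← Algebra.smul_def]
      exact Submodule.smul_mem _ a hx
    have h0 := sub_mem (W.coord_mem 0) (hm r (W.coord_mem 2))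
    fin_cases i
    · exact h0
    · exact sub_mem (sub_mem (W.coord_mem 1) (hm _ h0)) (hm _ (W.coord_mem 2))
    · exact W.coord_mem 2
  coordHom_inv_hom i := by
    fin_cases i
    · simp
    · simp
      ring
    · simp
  coordHom_hom_inv i := by
    fin_cases i
    · simp
    · simp
      ring
    · simp

end

section

variable {R : Type u} [CommRing R] [IsLocalRing R] (W : WeierstrassCurve R)

/-- Reaching the cuspidal cubic requires only square roots, which exist in the algebraic closure of
the residue field. -/
lemma hasAdditiveClosedFiber [CharP (IsLocalRing.ResidueField R) 2]
    (h1 : IsLocalRing.residue R W.a₁ = 0) (h3 : IsLocalRing.residue R W.a₃ = 0) :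
    W.HasAdditiveClosedFiber := by
  let k := IsLocalRing.ResidueField R
  let K := AlgebraicClosure k
  have hK : IsScalarTower R k K := inferInstance
  have : CharP K 2 := charP_of_injective_algebraMap (algebraMap k K).injective 2
  obtain ⟨r, hr⟩ := IsAlgClosed.exists_pow_nat_eq (W.map (algebraMap R K)).a₄ two_pos
  obtain ⟨s, hs⟩ := IsAlgClosed.exists_pow_nat_eq (r + (W.map (algebraMap R K)).a₂) two_pos
  obtain ⟨u, hu⟩ := IsAlgClosed.exists_pow_nat_eq (r ^ 3 + (W.map (algebraMap R K)).a₂ * r ^ 2 +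
    (W.map (algebraMap R K)).a₄ * r + (W.map (algebraMap R K)).a₆) two_pos
  have e (a : R) (ha : IsLocalRing.residue R a = 0) : algebraMap R K a = 0 :=
    (IsScalarTower.algebraMap_apply R k K a).trans
      ((congrArg (algebraMap k K) ha).trans (map_zero _))
  refine W.hasAdditiveClosedFiber_iff.2 ⟨K, _, _, _, hK, ?_⟩
  let σ := cuspidalSubst (W.map (algebraMap R K)) ((cuspidalCubic k).map (algebraMap k K))
    (e _ h1) (e _ h3) hr hs hu (by simp [cuspidalCubic]) (by simp [cuspidalCubic])
    (by simp [cuspidalCubic]) (by simp [cuspidalCubic]) (by simp [cuspidalCubic])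
  exact ⟨σ.iso.symm, by rw [Iso.symm_hom, Iso.inv_comp_eq]; exact σ.map_modelHom.symm⟩

end

end WeierstrassCurve

/-! ### The Jacobian criterion for plane cubics -/

namespace WeierstrassCurve

open HomogeneousLocalization

section

variable {R A B : Type u} [CommRing R] (W : WeierstrassCurve R) [CommRing A] [Algebra R A]
  [CommRing B] [Algebra R B]

/-- The difference of the two sides of the homogeneous Weierstrass equation. -/
def eqnValue (v : Fin 3 → A) : A :=
  v 1 ^ 2 * v 2 + algebraMap R A W.a₁ * v 0 * v 1 * v 2 + algebraMap R A W.a₃ * v 1 * v 2 ^ 2 -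
    (v 0 ^ 3 + algebraMap R A W.a₂ * v 0 ^ 2 * v 2 + algebraMap R A W.a₄ * v 0 * v 2 ^ 2 +
      algebraMap R A W.a₆ * v 2 ^ 3)

/-- The partial derivatives of the homogeneous Weierstrass polynomial. -/
def gradient (v : Fin 3 → A) : Fin 3 → A :=
  ![algebraMap R A W.a₁ * v 1 * v 2 - (3 * v 0 ^ 2 + 2 * algebraMap R A W.a₂ * v 0 * v 2 +
      algebraMap R A W.a₄ * v 2 ^ 2),
    2 * v 1 * v 2 + algebraMap R A W.a₁ * v 0 * v 2 + algebraMap R A W.a₃ * v 2 ^ 2,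
    v 1 ^ 2 + algebraMap R A W.a₁ * v 0 * v 1 + 2 * algebraMap R A W.a₃ * v 1 * v 2 -
      (algebraMap R A W.a₂ * v 0 ^ 2 + 2 * algebraMap R A W.a₄ * v 0 * v 2 +
        3 * algebraMap R A W.a₆ * v 2 ^ 2)]

lemma eqn_iff_eqnValue (v : Fin 3 → A) : W.Eqn v ↔ W.eqnValue v = 0 := sub_eq_zero.symm

lemma map_eqnValue (f : A →ₐ[R] B) (v : Fin 3 → A) :
    f (W.eqnValue v) = W.eqnValue fun i => f (v i) := by
  simp [eqnValue]

lemma map_gradient (f : A →ₐ[R] B) (v : Fin 3 → A) (i : Fin 3) :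
    f (W.gradient v i) = W.gradient (fun i => f (v i)) i := by
  fin_cases i <;> simp [gradient, map_ofNat]

/-- A Newton step. -/
lemma eqn_newton {I : Ideal A} (hI : I ^ 2 = ⊥) {v b : Fin 3 → A} (hv : W.eqnValue v ∈ I)
    (hb : 1 - ∑ i, b i * W.gradient v i ∈ I) : W.Eqn fun i => v i - W.eqnValue v * b i := by
  have hmul {x y : A} (hx : x ∈ I) (hy : y ∈ I) : x * y = 0 := by
    have := Ideal.mul_mem_mul hx hy
    rwa [← pow_two, hI] at this
  -- By Taylor expansion F(v - F(v)b) is F(v)(1 - ∑ bᵢ∂ᵢF(v)) plus a multiple of F(v)², and both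
  -- products lie in I² = 0.
  have h1 := hmul hv hv
  have h2 := hmul hv hb
  rw [eqn_iff_eqnValue]
  obtain ⟨e, he⟩ : ∃ e, e = W.eqnValue v := ⟨_, rfl⟩
  rw [← he] at h1 h2 ⊢
  rw [Fin.sum_univ_three] at h2
  simp only [eqnValue, gradient, Matrix.cons_val_zero, Matrix.cons_val_one, Matrix.cons_val]
    at he h2 ⊢
  generalize algebraMap R A W.a₁ = a₁ at *
  generalize algebraMap R A W.a₂ = a₂ at *
  generalize algebraMap R A W.a₃ = a₃ at *
  generalize algebraMap R A W.a₄ = a₄ at *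
  generalize algebraMap R A W.a₆ = a₆ at *
  generalize v 0 = x at *
  generalize v 1 = y at *
  generalize v 2 = z at *
  generalize b 0 = p at *
  generalize b 1 = q at *
  generalize b 2 = r at *
  linear_combination -he + h2 + (q ^ 2 * z + 2 * y * q * r - e * q ^ 2 * r +
    a₁ * (p * q * z + p * y * r + x * q * r - e * p * q * r) +
    a₃ * (2 * q * z * r + y * r ^ 2 - e * q * r ^ 2) -
    (3 * x * p ^ 2 - e * p ^ 3 + a₂ * (p ^ 2 * z + 2 * x * p * r - e * p ^ 2 * r) +
      a₄ * (2 * p * z * r + x * r ^ 2 - e * p * r ^ 2) + a₆ * (3 * z * r ^ 2 - e * r ^ 3))) * h1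

end

section

variable {R : Type u} [CommRing R] (W : WeierstrassCurve R) (i : Fin 3)

/-- The coordinate ring of a standard chart as an algebra. -/
abbrev awayAlgebra : Algebra R (Away W.grading (W.coord i)) := (W.awayStr (W.coord i)).toAlgebra

attribute [local instance] awayAlgebra

/-- Dehomogenization as a homomorphism of algebras. -/
def dehomAlgHom : W.HomogCoordRing →ₐ[R] Away W.grading (W.coord i) where
  __ := ProjPoint.dehom (W.coord_mem i)
  commutes' r := DFunLike.congr_fun (W.dehom_comp_algebraMap (W.coord_mem i)) r

lemma dehomAlgHom_self : W.dehomAlgHom i (W.coord i) = 1 := ProjPoint.dehom_self _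

lemma dehomAlgHom_surjective : Function.Surjective (W.dehomAlgHom i) := by
  intro x
  obtain ⟨n, a, ha, rfl⟩ := Away.mk_surjective W.grading (W.coord_mem i) x
  exact ⟨a, ProjPoint.dehom_of_mem (W.coord_mem i) (by simpa using ha) ha⟩

variable {i} in
lemma away_algHom_ext {B : Type u} [CommRing B] [Algebra R B]
    {f g : Away W.grading (W.coord i) →ₐ[R] B}
    (h : ∀ j, f (W.dehomAlgHom i (W.coord j)) = g (W.dehomAlgHom i (W.coord j))) : f = g := by
  have : f.comp (W.dehomAlgHom i) = g.comp (W.dehomAlgHom i) := algHom_ext h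
  ext x
  obtain ⟨y, rfl⟩ := W.dehomAlgHom_surjective i x
  exact DFunLike.congr_fun this y

/-- The homomorphism from the coordinate ring of a chart given by a solution of the equation. -/
def awayLift {B : Type u} [CommRing B] [Algebra R B] (φ : W.HomogCoordRing →ₐ[R] B)
    (h : IsUnit (φ (W.coord i))) : Away W.grading (W.coord i) →ₐ[R] B where
  __ := ProjPoint.lift W.grading φ.toRingHom (W.coord i) h
  commutes' r := by
    refine (ProjPoint.lift_comp_fromZero φ.toRingHom (W.coord i) h _).trans ?_
    exact φ.commutes r

lemma awayLift_mul {B : Type u} [CommRing B] [Algebra R B] (φ : W.HomogCoordRing →ₐ[R] B)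
    (h : IsUnit (φ (W.coord i))) (j : Fin 3) :
    W.awayLift i φ h (W.dehomAlgHom i (W.coord j)) * φ (W.coord i) = φ (W.coord j) := by
  have h1 := ProjPoint.lift_mk_mul φ.toRingHom (W.coord_mem i) h 1 (W.coord j)
    (by simpa using W.coord_mem j)
  rw [pow_one] at h1
  have h2 := ProjPoint.dehom_of_mem (W.coord_mem i) (W.coord_mem j) (by simpa using W.coord_mem j)
  rw [← h2] at h1
  exact h1

/-- A solution modulo I is lifted arbitrarily and corrected by one Newton step. Its i-th coordinate
is then only congruent to 1 modulo I, hence a unit, and `awayLift` divides by it. -/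
lemma formallySmooth_away {b : Fin 3 → Away W.grading (W.coord i)}
    (hb : ∑ j, b j * W.gradient (fun k => W.dehomAlgHom i (W.coord k)) j = 1) :
    Algebra.FormallySmooth R (Away W.grading (W.coord i)) := by
  refine Algebra.FormallySmooth.of_comp_surjective fun B _ _ I hI f => ?_
  have hq := Ideal.Quotient.mk_surjective (I := I)
  choose v hv using fun j => hq (f (W.dehomAlgHom i (W.coord j)))
  choose c hc using fun j => hq (f (b j))
  have h1 : W.eqnValue v ∈ I := by
    rw [← Ideal.Quotient.eq_zero_iff_mem]
    refine (W.map_eqnValue (Ideal.Quotient.mkₐ R I) v).trans ?_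
    rw [← eqn_iff_eqnValue]
    have := (W.eqn_algHom (W.dehomAlgHom i)).map f
    convert this using 2
    exact hv _
  have h2 : 1 - ∑ j, c j * W.gradient v j ∈ I := by
    rw [← Ideal.Quotient.eq_zero_iff_mem, map_sub, map_one, map_sum, sub_eq_zero, ← map_one f, ← hb,
      map_sum]
    refine Finset.sum_congr rfl fun j _ => ?_
    rw [map_mul, map_mul, hc, map_gradient]
    congr 1
    refine Eq.trans ?_ (W.map_gradient (Ideal.Quotient.mkₐ R I) v j).symm
    congr 1
    funext k
    exact (hv k).symm
  have he := W.eqn_newton hI h1 h2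
  have hred (j : Fin 3) : Ideal.Quotient.mk I (v j - W.eqnValue v * c j) =
      f (W.dehomAlgHom i (W.coord j)) := by
    rw [map_sub, hv, map_mul, Ideal.Quotient.eq_zero_iff_mem.2 h1, zero_mul, sub_zero]
  have hu : IsUnit (W.coordHom _ he (W.coord i)) := by
    rw [coordHom_coord]
    have h3 : IsNilpotent (v i - W.eqnValue v * c i - 1) := by
      refine ⟨2, ?_⟩
      have h4 : v i - W.eqnValue v * c i - 1 ∈ I := by
        rw [← Ideal.Quotient.eq_zero_iff_mem, map_sub, hred, dehomAlgHom_self, map_one, map_one,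
          sub_self]
      have := Ideal.pow_mem_pow h4 2
      rwa [hI] at this
    have := h3.isUnit_one_add
    rwa [add_sub_cancel] at this
  refine ⟨W.awayLift i _ hu, ?_⟩
  apply away_algHom_ext
  intro j
  have h5 := congrArg (Ideal.Quotient.mk I) (W.awayLift_mul i _ hu j)
  rw [map_mul, coordHom_coord, coordHom_coord, hred, hred, dehomAlgHom_self, map_one, mul_one] at h5
  exact h5

lemma finitePresentation_away [IsNoetherianRing R] :
    Algebra.FinitePresentation R (Away W.grading (W.coord i)) := by
  rw [← Algebra.FinitePresentation.of_finiteType]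
  exact Algebra.FiniteType.of_surjective (W.dehomAlgHom i) (W.dehomAlgHom_surjective i)

/-- Otherwise a maximal ideal contains all partial derivatives, and its residue field carries a
singular solution. -/
lemma exists_sum_mul_gradient_eq_one
    (hns : ∀ (K : Type u) [Field K] [Algebra R K] (v : Fin 3 → K), W.Eqn v →
      (∀ j, W.gradient v j = 0) → v i ≠ 1) :
    ∃ b : Fin 3 → Away W.grading (W.coord i),
      ∑ j, b j * W.gradient (fun k => W.dehomAlgHom i (W.coord k)) j = 1 := by
  by_contra! h
  have hJ : Ideal.span (Set.range (W.gradient fun k => W.dehomAlgHom i (W.coord k))) ≠ ⊤ := by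
    rw [Ne, Ideal.eq_top_iff_one, Ideal.mem_span_range_iff_exists_fun]
    rintro ⟨b, hb⟩
    exact h b hb
  obtain ⟨M, hM, hJM⟩ := Ideal.exists_le_maximal _ hJ
  let := Ideal.Quotient.field M
  refine hns (Away W.grading (W.coord i) ⧸ M)
    (fun k => Ideal.Quotient.mkₐ R M (W.dehomAlgHom i (W.coord k)))
    ((W.eqn_algHom (W.dehomAlgHom i)).map (Ideal.Quotient.mkₐ R M)) (fun j => ?_) ?_
  · rw [← map_gradient]
    exact Ideal.Quotient.eq_zero_iff_mem.2 (hJM (Ideal.subset_span ⟨j, rfl⟩))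
  · rw [dehomAlgHom_self, map_one]

end

section

variable {R : Type u} [CommRing R] (W : WeierstrassCurve R)

lemma smooth_modelHom [IsNoetherianRing R]
    (hns : ∀ (K : Type u) [Field K] [Algebra R K] (v : Fin 3 → K), W.Eqn v →
      (∀ j, W.gradient v j = 0) → v = 0) : Smooth W.modelHom := by
  have : IsZariskiLocalAtSource @Smooth.{u} :=
    HasRingHomProperty.instIsZariskiLocalAtSource (Q := RingHom.Smooth)
  rw [IsZariskiLocalAtSource.iff_of_openCover (P := @Smooth.{u})
    (Proj.affineOpenCoverOfIrrelevantLESpan W.grading W.coord W.coord_mem (fun _ => one_pos)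
      W.irrelevant_le_span_coord).openCover]
  intro i
  change Smooth (Proj.awayι W.grading (W.coord i) (W.coord_mem i) one_pos ≫ W.modelHom)
  rw [awayι_modelHom, HasRingHomProperty.Spec_iff (P := @Smooth)]
  let := W.awayAlgebra i
  obtain ⟨b, hb⟩ := W.exists_sum_mul_gradient_eq_one i fun K _ _ v h1 h2 h3 => by
    rw [hns K v h1 h2] at h3
    exact zero_ne_one h3
  have := W.formallySmooth_away i hb
  have := W.finitePresentation_away i
  exact Algebra.Smooth.mk

end

end WeierstrassCurve

/-! ### Singular points and the discriminant -/

namespace WeierstrassCurve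

section

variable {R K : Type u} [CommRing R] [Field K] [Algebra R K] (W : WeierstrassCurve R)

/-- If Z = 0, the equation gives X = 0 and the Z-derivative gives Y = 0. So Z is invertible and can
be scaled to 1. -/
lemma exists_singular_point {v : Fin 3 → K} (he : W.Eqn v) (hg : ∀ j, W.gradient v j = 0)
    (hv : v ≠ 0) : ∃ x y : K, W.Eqn ![x, y, 1] ∧
      2 * y + algebraMap R _ W.a₁ * x + algebraMap R _ W.a₃ = 0 ∧
      algebraMap R _ W.a₁ * y = 3 * x ^ 2 + 2 * algebraMap R _ W.a₂ * x + algebraMap R _ W.a₄ := by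
  have g0 := hg 0
  have g1 := hg 1
  have g2 := hg 2
  simp only [gradient, Matrix.cons_val_zero, Matrix.cons_val_one, Matrix.cons_val] at g0 g1 g2
  have h2 : v 2 ≠ 0 := by
    intro h2
    have h0 : v 0 = 0 := pow_eq_zero_iff three_ne_zero |>.1 (by
      simpa [Eqn, h2] using he.symm)
    have h1 : v 1 = 0 := pow_eq_zero_iff two_ne_zero |>.1 (by simpa [h2, h0] using g2)
    apply hv
    funext j
    fin_cases j
    · exact h0
    · exact h1
    · exact h2
  refine ⟨v 0 / v 2, v 1 / v 2, ?_, ?_, ?_⟩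
  · simp only [Eqn, Matrix.cons_val_zero, Matrix.cons_val_one, Matrix.cons_val] at he ⊢
    field_simp
    linear_combination he
  · field_simp
    refine mul_right_cancel₀ h2 ?_
    linear_combination g1
  · field_simp
    linear_combination g0

lemma eqn_affine {A : Type u} [CommRing A] [Algebra R A] (φ : W.HomogCoordRing →ₐ[R] A)
    (h : φ (W.coord 2) = 1) : W.Eqn ![φ (W.coord 0), φ (W.coord 1), 1] := by
  convert W.eqn_algHom φ using 1
  funext i
  fin_cases i
  · rfl
  · rfl
  · exact h.symm

lemma algebraMap_Δ_eq_zero {x y : K} (he : W.Eqn ![x, y, 1])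
    (hy : 2 * y + algebraMap R _ W.a₁ * x + algebraMap R _ W.a₃ = 0)
    (hx : algebraMap R _ W.a₁ * y = 3 * x ^ 2 + 2 * algebraMap R _ W.a₂ * x + algebraMap R _ W.a₄) :
    algebraMap R K W.Δ = 0 := by
  by_contra hΔ
  rw [← map_Δ] at hΔ
  have h := Affine.equation_iff_nonsingular_of_Δ_ne_zero (W := (W.map (algebraMap R K)).toAffine)
    (x := x) (y := y) hΔ
  rw [Affine.nonsingular_iff', Affine.equation_iff] at h
  simp only [Eqn, Matrix.cons_val_zero, Matrix.cons_val_one, Matrix.cons_val] at he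
  rcases (h.1 (by simp only [map_a₁, map_a₂, map_a₃, map_a₄, map_a₆]; linear_combination he)).2 with
    h | h
  · exact h (by simp only [map_a₁, map_a₂, map_a₄]; linear_combination hx)
  · exact h hy

end

section

variable {R : Type u} [CommRing R] [IsLocalRing R] (W : WeierstrassCurve R)

/-- By the Jacobian criterion, a closed fiber that is not smooth has a singular solution over some
field over k, and its image in E lies in the singular locus. -/
lemma singLocus_nonempty (hsing : ¬ Smooth W.closedFiberHom) :
    (singLocus W.modelHom).Nonempty := by
  let k := IsLocalRing.ResidueField R
  by_contra hempty
  apply hsing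
  have hs : Smooth (W.map (algebraMap R k)).modelHom := by
    apply smooth_modelHom
    intro K _ _ v he hg
    by_contra hv
    obtain ⟨x, y, he, hy, hx⟩ := exists_singular_point _ he hg hv
    let : Algebra R K := ((algebraMap k K).comp (algebraMap R k)).toAlgebra
    have : IsScalarTower R k K := IsScalarTower.of_algebraMap_eq fun _ => rfl
    rw [eqn_map_iff] at he
    refine hempty ⟨_, W.mem_singLocus_of_partials_eq_zero (φ := W.coordHom _ he) (by simp) ?_ ?_⟩
    · rw [coordHom_coord, coordHom_coord]
      exact hy
    · rw [coordHom_coord, coordHom_coord]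
      exact hx
  have e : W.closedFiberHom =
      (W.isPullback_baseHom k).isoPullback.inv ≫ (W.map (algebraMap R k)).modelHom :=
    (W.isPullback_baseHom k).isoPullback_inv_snd.symm
  rw [e]
  exact MorphismProperty.comp_mem _ _ _ inferInstance hs

end

section

variable {R : Type u} [CommRing R] [IsDomain R] [IsDiscreteValuationRing R]

/-- The kernel is a nonzero prime ideal of a discrete valuation ring, hence the maximal ideal. -/
lemma algebraMap_eq_zero_of_not_isUnit {K : Type u} [Field K] [Algebra R K] {s : R} (hs : s ≠ 0)
    (hs0 : algebraMap R K s = 0) (r : R) (hr : ¬ IsUnit r) : algebraMap R K r = 0 := by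
  have hp : (RingHom.ker (algebraMap R K)).IsPrime := RingHom.ker_isPrime _
  have hm := hp.isMaximal fun h => hs (by simpa [h] using (RingHom.mem_ker).2 hs0)
  have e := IsLocalRing.eq_maximalIdeal hm
  exact RingHom.mem_ker.1 (e ▸ (IsLocalRing.mem_maximalIdeal r).2 hr)

open IsDiscreteValuationRing in
/-- The coefficients `2`, `a₁`, `a₃` of the equation of the fixed line, divided by
their greatest common divisor `d`. -/
lemma exists_primitive_fixed_line (W : WeierstrassCurve R) (hΔ : W.Δ ≠ 0) :
    ∃ d α β γ : R, d ≠ 0 ∧ 2 = d * α ∧ W.a₁ = d * β ∧ W.a₃ = d * γ ∧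
      (IsUnit α ∨ IsUnit β ∨ IsUnit γ) ∧
      addVal R d = min (addVal R 2) (min (addVal R W.a₁) (addVal R W.a₃)) := by
  have key (d : R) (hd : d ∈ ({2, W.a₁, W.a₃} : Set R)) (h2 : d ∣ 2) (h1 : d ∣ W.a₁)
      (h3 : d ∣ W.a₃) : ∃ d α β γ : R, d ≠ 0 ∧ 2 = d * α ∧ W.a₁ = d * β ∧ W.a₃ = d * γ ∧
      (IsUnit α ∨ IsUnit β ∨ IsUnit γ) ∧
      addVal R d = min (addVal R 2) (min (addVal R W.a₁) (addVal R W.a₃)) := by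
    -- If 2, a₁ and a₃ all vanish in R, so does Δ.
    have hd0 : d ≠ 0 := by
      rintro rfl
      have e2 := zero_dvd_iff.1 h2
      have e1 := zero_dvd_iff.1 h1
      have e3 := zero_dvd_iff.1 h3
      apply hΔ
      simp only [Δ, b₂, b₄, b₆, b₈, e1, e3]
      linear_combination (-8 * W.a₂ ^ 2 * (4 * W.a₂ * W.a₆ - W.a₄ ^ 2) - 4 * 8 * W.a₄ ^ 3
        - 216 * W.a₆ ^ 2 + 144 * W.a₂ * W.a₄ * W.a₆) * e2
    have hunit {a b : R} (h : a = d * b) (hda : d = a) : IsUnit b :=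
      (mul_left_cancel₀ hd0 (by rw [← h, hda, mul_one]) : b = 1) ▸ isUnit_one
    obtain ⟨α, h2'⟩ := h2
    obtain ⟨β, h1'⟩ := h1
    obtain ⟨γ, h3'⟩ := h3
    refine ⟨d, α, β, γ, hd0, h2', h1', h3', ?_, le_antisymm (le_min ?_ (le_min ?_ ?_)) ?_⟩
    · rcases hd with h | h | h
      · exact .inl (hunit h2' h)
      · exact .inr (.inl (hunit h1' h))
      · exact .inr (.inr (hunit h3' h))
    · exact addVal_le_iff_dvd.2 ⟨_, h2'⟩
    · exact addVal_le_iff_dvd.2 ⟨_, h1'⟩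
    · exact addVal_le_iff_dvd.2 ⟨_, h3'⟩
    · rcases hd with h | h | h
      · exact h ▸ min_le_left _ _
      · exact h ▸ (min_le_right _ _).trans (min_le_left _ _)
      · exact h ▸ (min_le_right _ _).trans (min_le_right _ _)
  simp only [← addVal_le_iff_dvd] at key
  rcases le_total (addVal R 2) (addVal R W.a₁) with h | h <;>
  rcases le_total (addVal R W.a₁) (addVal R W.a₃) with h' | h' <;>
  rcases le_total (addVal R 2) (addVal R W.a₃) with h'' | h''
  · exact key 2 (by simp) le_rfl h h''
  · exact key 2 (by simp) le_rfl h (h.trans h')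
  · exact key 2 (by simp) le_rfl h h''
  · exact key W.a₃ (by simp) h'' h' le_rfl
  · exact key W.a₁ (by simp) h le_rfl h'
  · exact key W.a₁ (by simp) h le_rfl h'
  · exact key W.a₃ (by simp) (h'.trans h) h' le_rfl
  · exact key W.a₃ (by simp) h'' h' le_rfl

open IsDiscreteValuationRing in
lemma addVal_sq_mul_eq_iff {d : R} (hd : d ≠ 0) (c : R) :
    addVal R (d ^ 2 * c) = 2 * addVal R d ↔ addVal R c = 0 := by
  have h : addVal R (d ^ 2) ≠ ⊤ := fun h => pow_ne_zero 2 hd (addVal_eq_top_iff.1 h)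
  have e : 2 * addVal R d = 0 + addVal R (d ^ 2) := by rw [pow_two, addVal_mul, two_mul, zero_add]
  rw [mul_comm, addVal_mul, e]
  exact (ENat.add_left_injective_of_ne_top h).eq_iff

variable {W : WeierstrassCurve R} (hΔ : W.Δ ≠ 0) {d α β γ : R} (h2 : (2 : R) = d * α)
  (h1 : W.a₁ = d * β) (h3 : W.a₃ = d * γ) (hu : IsUnit α ∨ IsUnit β ∨ IsUnit γ)
  {z : W.model} (hz : z ∈ singLocus W.modelHom)

include hΔ hz

/-- The nonzero element Δ vanishes at a singular point, which therefore lies over the closed point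
of Spec R. -/
lemma residueAlgebra_eq_zero (r : R) (hr : ¬ IsUnit r) :
    letI := W.residueAlgebra z
    algebraMap R (W.model.residueField z) r = 0 := by
  let := W.residueAlgebra z
  obtain ⟨φ, h, -, hy, hx⟩ := W.exists_pt_fromSpecResidueField hz
  exact algebraMap_eq_zero_of_not_isUnit hΔ
    (W.algebraMap_Δ_eq_zero (W.eqn_affine φ h) hy hx) r hr

include h2 h1 h3 hu

/-- The vanishing Y-derivative at z equals dL(z), and d is invertible. -/
lemma mem_fixLocus_of_isUnit (hd : IsUnit d) : z ∈ W.fixLocus := by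
  let := W.residueAlgebra z
  obtain ⟨φ, h, hφ, hy, -⟩ := W.exists_pt_fromSpecResidueField hz
  have h2' := congrArg (algebraMap R (W.model.residueField z)) h2
  rw [map_mul, map_ofNat] at h2'
  refine W.mem_fixLocus_of_hasFixedLift hφ (hasFixedLift (W.eqn_affine φ h) h2 h1 h3 ?_
    (residueAlgebra_eq_zero hΔ hz) hu)
  refine (mul_eq_zero.1 ?_).resolve_left (hd.map (algebraMap R (W.model.residueField z))).ne_zero
  rw [h1, h3, map_mul, map_mul, h2'] at hy
  linear_combination hy

/-- Being fixed means L(z) = 0. In the residue field 2, a₁ and a₃ vanish, so x² = a₄ and y² = x³ +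
a₂x² + a₄x + a₆. This expresses L(z)² by the coefficients alone. -/
lemma mem_fixLocus_iff_of_not_isUnit (hd0 : d ≠ 0) (hd : ¬ IsUnit d) :
    z ∈ W.fixLocus ↔
      ¬ IsUnit ((β ^ 2 + α ^ 2 * W.a₂) * W.a₄ + γ ^ 2 + α ^ 2 * W.a₆) := by
  let := W.residueAlgebra z
  obtain ⟨φ, h, hφ, hy, hx⟩ := W.exists_pt_fromSpecResidueField hz
  have hK := residueAlgebra_eq_zero hΔ hz
  have e2 : (2 : W.model.residueField z) = 0 := by
    rw [← map_ofNat (algebraMap R _), h2, map_mul, hK d hd, zero_mul]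
  have e1 : algebraMap R (W.model.residueField z) W.a₁ = 0 := by
    rw [h1, map_mul, hK d hd, zero_mul]
  have e3 : algebraMap R (W.model.residueField z) W.a₃ = 0 := by
    rw [h3, map_mul, hK d hd, zero_mul]
  have he := W.eqn_affine φ h
  simp only [Eqn, Matrix.cons_val_zero, Matrix.cons_val_one, Matrix.cons_val, e1, e3] at he
  rw [e1] at hx
  have key : (algebraMap R (W.model.residueField z) α * φ (W.coord 1) +
      algebraMap R (W.model.residueField z) β * φ (W.coord 0) +
      algebraMap R (W.model.residueField z) γ) ^ 2 = algebraMap R (W.model.residueField z)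
        ((β ^ 2 + α ^ 2 * W.a₂) * W.a₄ + γ ^ 2 + α ^ 2 * W.a₆) := by
    simp only [map_add, map_mul, map_pow]
    generalize φ (W.coord 0) = x at *
    generalize φ (W.coord 1) = y at *
    generalize algebraMap R (W.model.residueField z) α = A
    generalize algebraMap R (W.model.residueField z) β = B
    generalize algebraMap R (W.model.residueField z) γ = C
    generalize algebraMap R (W.model.residueField z) W.a₂ = a₂ at *
    generalize algebraMap R (W.model.residueField z) W.a₄ = a₄ at *
    have hx' : x ^ 2 - a₄ = 0 := by linear_combination -hx - (x ^ 2 + a₂ * x + a₄) * e2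
    linear_combination A ^ 2 * he + (A ^ 2 * (x + a₂) + B ^ 2) * hx' +
      (A ^ 2 * a₄ * x + A * B * x * y + A * C * y + B * C * x) * e2
  constructor
  · intro hfix hc
    refine notMem_fixLocus hφ hd0 h2 h1 h3 (hK d hd) (fun hε => ?_) hfix
    rw [hε, zero_pow two_ne_zero] at key
    exact (hc.map (algebraMap R (W.model.residueField z))).ne_zero key.symm
  · intro hc
    rw [hK _ hc] at key
    exact W.mem_fixLocus_of_hasFixedLift hφ (hasFixedLift (W.eqn_affine φ h) h2 h1 h3
      (pow_eq_zero_iff two_ne_zero |>.1 key) hK hu)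

end

end WeierstrassCurve

/-! ### Disjointness of the schemes of fixed points and of singularities -/

namespace WeierstrassCurve

variable {R : Type u} [CommRing R] [IsDomain R] [IsDiscreteValuationRing R]
  {W : WeierstrassCurve R}

open IsDiscreteValuationRing in
lemma disjoint_fixLocus_singLocus_iff (hΔ : W.Δ ≠ 0) (hsing : ¬ Smooth W.closedFiberHom) :
    Disjoint W.fixLocus (singLocus W.modelHom) ↔
      W.HasAdditiveClosedFiber ∧ CharP (IsLocalRing.ResidueField R) 2 ∧
      addVal R (W.b₂ * W.a₄ + W.b₆) =
        2 * min (addVal R 2) (min (addVal R W.a₁) (addVal R W.a₃)) := by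
  obtain ⟨d, α, β, γ, hd0, h2, h1, h3, hu, hval⟩ := W.exists_primitive_fixed_line hΔ
  obtain ⟨z, hz⟩ := W.singLocus_nonempty hsing
  have hb : W.b₂ * W.a₄ + W.b₆ =
      d ^ 2 * ((β ^ 2 + α ^ 2 * W.a₂) * W.a₄ + γ ^ 2 + α ^ 2 * W.a₆) := by
    rw [b₂, b₆, h1, h3]
    linear_combination (W.a₂ * W.a₄ + W.a₆) * (2 + d * α) * h2
  rw [← hval, hb, addVal_sq_mul_eq_iff hd0, addVal_eq_zero_iff]
  have hres {r : R} : IsLocalRing.residue R r = 0 ↔ ¬ IsUnit r :=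
    (IsLocalRing.residue_eq_zero_iff r).trans (IsLocalRing.mem_maximalIdeal r)
  by_cases hd : IsUnit d
  · refine iff_of_false (fun h => Set.disjoint_left.1 h
      (mem_fixLocus_of_isUnit hΔ h2 h1 h3 hu hz hd) hz) ?_
    -- Since d is a unit, α and β are not, so γ is. Then 2y + a₁x + a₃ = 0 fails at the singular
    -- point z.
    rintro ⟨hadd, hchar, -⟩
    have hα : ¬ IsUnit α := by
      have e : IsLocalRing.residue R 2 = 0 := by
        rw [map_ofNat]
        exact CharTwo.two_eq_zero
      rw [h2, hres] at e
      exact fun hα => e (hd.mul hα)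
    have hβ : ¬ IsUnit β := by
      have e := W.residue_a₁_eq_zero hadd
      rw [h1, hres] at e
      exact fun hβ => e (hd.mul hβ)
    have hγ : IsUnit γ := by tauto
    let := W.residueAlgebra z
    have hK := residueAlgebra_eq_zero hΔ hz
    obtain ⟨φ, h, -, hy, -⟩ := W.exists_pt_fromSpecResidueField hz
    have e2 : (2 : W.model.residueField z) = 0 := by
      rw [← map_ofNat (algebraMap R _), h2, map_mul, hK α hα, mul_zero]
    rw [e2, h1, h3, map_mul, hK β hβ, mul_zero, zero_mul, zero_mul, zero_add, zero_add] at hy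
    exact ((hd.mul hγ).map (algebraMap R (W.model.residueField z))).ne_zero hy
  -- As multiples of d, the elements 2, a₁ and a₃ vanish in k. The first two conditions are then
  -- automatic, and the third decides for every singular point.
  · have hdvd {r s : R} (h : r = d * s) : IsLocalRing.residue R r = 0 :=
      hres.2 fun hr => hd (isUnit_of_mul_isUnit_left (h ▸ hr))
    have hchar : CharP (IsLocalRing.ResidueField R) 2 := by
      refine CharTwo.of_one_ne_zero_of_two_eq_zero one_ne_zero ?_
      rw [← map_ofNat (IsLocalRing.residue R)]
      exact hdvd h2
    have hfix {z} (hz) := mem_fixLocus_iff_of_not_isUnit (z := z) hΔ h2 h1 h3 hu hz hd0 hd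
    refine ⟨fun h => ⟨W.hasAdditiveClosedFiber (hdvd h1) (hdvd h3), hchar, ?_⟩,
      fun h => Set.disjoint_right.2 fun z hz hz' => (hfix hz).1 hz' h.2.2⟩
    by_contra hc
    exact Set.disjoint_left.1 h ((hfix hz).2 hc) hz

open IsDiscreteValuationRing in
lemma addVal_b₂_mul_a₄_add_b₆_eq_iff (hΔ : W.Δ ≠ 0) (h1 : W.a₁ = 0) (h3 : W.a₃ = 0) :
    addVal R (W.b₂ * W.a₄ + W.b₆) =
        2 * min (addVal R 2) (min (addVal R W.a₁) (addVal R W.a₃)) ↔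
      addVal R (W.a₂ * W.a₄ + W.a₆) = 0 := by
  -- Here β = γ = 0, so α is the unit and 2 = dα ≠ 0.
  have h2 : (2 : R) ≠ 0 := by
    obtain ⟨d, α, β, γ, hd0, h2, h1', h3', hu, -⟩ := W.exists_primitive_fixed_line hΔ
    rw [h1, zero_eq_mul] at h1'
    rw [h3, zero_eq_mul] at h3'
    rw [h2]
    refine mul_ne_zero hd0 ?_
    rintro rfl
    simp [h1'.resolve_left hd0, h3'.resolve_left hd0] at hu
  have hb : W.b₂ * W.a₄ + W.b₆ = 2 ^ 2 * (W.a₂ * W.a₄ + W.a₆) := by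
    rw [b₂, b₆, h1, h3]
    ring
  rw [h1, h3, addVal_zero, min_self, min_eq_left le_top, hb, addVal_sq_mul_eq_iff h2]

end WeierstrassCurve

end

theorem mainTheorem8 (R : Type u) [CommRing R] [IsDomain R] [IsDiscreteValuationRing R]
    (W : WeierstrassCurve R) (hΔ : W.Δ ≠ 0)
    (hsing : ¬ AlgebraicGeometry.Smooth W.closedFiberHom) :
    (Disjoint W.fixLocus (singLocus W.modelHom) ↔
      W.HasAdditiveClosedFiber ∧
      CharP (IsLocalRing.ResidueField R) 2 ∧
      IsDiscreteValuationRing.addVal R (W.b₂ * W.a₄ + W.b₆) =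
        2 * min (IsDiscreteValuationRing.addVal R 2)
          (min (IsDiscreteValuationRing.addVal R W.a₁) (IsDiscreteValuationRing.addVal R W.a₃))) ∧
    (W.a₁ = 0 → W.a₃ = 0 →
      (IsDiscreteValuationRing.addVal R (W.b₂ * W.a₄ + W.b₆) =
          2 * min (IsDiscreteValuationRing.addVal R 2)
            (min (IsDiscreteValuationRing.addVal R W.a₁)
              (IsDiscreteValuationRing.addVal R W.a₃)) ↔
        IsDiscreteValuationRing.addVal R (W.a₂ * W.a₄ + W.a₆) = 0)) :=
  ⟨WeierstrassCurve.disjoint_fixLocus_singLocus_iff hΔ hsing,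
    WeierstrassCurve.addVal_b₂_mul_a₄_add_b₆_eq_iff hΔ⟩
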